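/- Let $d\ge 1$, $R>0$, $B=B(0,R)\subset\mathbb R^d$, and $\widehat f(\xi)=\int f(x)e^{-i\langle \xi,x\rangle}\,dx$. Let $A\subset(0,\infty)$ be infinite, let $\phi_\alpha:\mathbb R^d\to\mathbb C$ $(\alpha\in A)$ be kernels, and for $N\ge 0$ put $$\Phi_N=\Big\{\sum_{j=1}^N a_j\phi_{\alpha_j}(\cdot-x_j): a_j\in\mathbb C,\ \alpha_j\in A,\ x_j\in\mathbb R^d\Big\}.$$ Assume: (A1) each $\Phi_N$ is closed under translations and under dilations $g\mapsto g(\delta\,\cdot)$, $\delta>0$; (A2) each $\phi_\alpha$ is continuous, and $\sup_{\alpha\in A}\|\phi_\alpha\|_{L_\infty}<\infty$; (A3) for every $k\in\mathbb N_0$ there is $\alpha_k\in A$ such that for every $\alpha\in A$ with $\alpha\ge\alpha_k$: $\widehat{\phi_\alpha}\neq0$ a.e. on $B$, and there is a constant $C$ (independent of $h$) with $\sum_{j\in\mathbb Z^d\setminus\{0\}}\big\|\widehat{\phi_\alpha}(\cdot+2\pi j/h)/\widehat{\phi_\alpha}\big\|_{L_\infty(B)}\le C h^k$ for all sufficiently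 small $h>0$; (A4) for every $k\in\mathbb N_0$ there is $\alpha_k'\in A$ such that for every $\alpha\in A$ with $\alpha\ge\alpha_k'$: $\widehat{\phi_\alpha}\ne0$ a.e. on $B$, and the weak derivatives $D^\gamma(1/\widehat{\phi_\alpha})$, $|\gamma|\le k$, exist in $L_2(B)$; (A5) for every $k\in\mathbb N_0$ there is $\alpha_k''\in A$ such that $|\phi_\alpha(x)|=O(|x|^{-2k})$ as $|x|\to\infty$ for every $\alpha\in A$ with $\alpha\ge\alpha_k''$; (A6) for every $\alpha\in A$ there are $C,\varepsilon>0$ with $|\phi_\alpha(x)|+|\widehat{\phi_\alpha}(x)|\le C(1+|x|)^{-d-\varepsilon}$ for all $x\in\mathbb R^d$. Let $\mathcal D_k=\{2^k(n+[0,1]^d): n\in\mathbb Z^d\}$, $k\in\mathbb Z$, be the dyadic cubes of side length $2^k$ and $\mathcal D=\bigcup_k\mathcal D_k$. For $I=2^k(n+[0,1]^d)$ put $\psi_I(x)=\psi\big((x-2^kn)/2^k\big)$. Let $(\psi^e)_{e\in E}$ be a finite family of Schwartz functions whose Fourier transforms vanish outside the closed ball $\overline{B}$ and for which $\{|I|^{-1/2}\psi^e_I: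 e\in E,\ I\in\mathcal D\}$ is a complete orthonormal system in $L_2(\mathbb R^d)$. Put $f_{e,I}=|I|^{-1}\int f\,\overline{\psi^e_I}$. Let $s>0$, $1/\tau=s/d$, $1/q=1+s/d$, and let $B^s_{\tau,q}$ be the set of all $f\in L_\tau(\mathbb R^d)$ (with also $f\in L_1(\mathbb R^d)$ if $\tau<1$, so that the coefficients are defined) such that $$|f|_{B^s_{\tau,q}}=\bigg(\sum_{k\in\mathbb Z}\Big(\sum_{e\in E}\sum_{I\in\mathcal D_k}|f_{e,I}|^\tau\Big)^{q/\tau}\bigg)^{1/q}<\infty .$$ Then there is a constant $C>0$, depending only on $s$, $d$ and the fixed data $R$, $(\phi_\alpha)_{\alpha\in A}$, $(\psi^e)_{e\in E}$, such that for every $f\in B^s_{\tau,q}$ and every integer $N\ge1$ there is $S_{f,N}\in\Phi_N$ with $$\|f-S_{f,N}\|_{L_\infty(\mathbb R^d)}\le C\,N^{-s/d}\,|f|_{B^s_{\tau,q}} .$$ -/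

import Mathlib

open MeasureTheory Filter Topology
open scoped ENNReal ContDiff SchwartzMap

noncomputable section

namespace KernelApprox

/-- Euclidean space `ℝ^d`. -/
abbrev Rd (d : ℕ) : Type := EuclideanSpace ℝ (Fin d)

/-- The Fourier transform `f^(ξ) = ∫ f(x) e^{-i⟨ξ, x⟩} dx`. -/
def hat {d : ℕ} (f : Rd d → ℂ) (ξ : Rd d) : ℂ :=
  ∫ x, Complex.exp (-(Complex.I * ((inner ℝ ξ x : ℝ) : ℂ))) * f x

/-- `hat` is Mathlib's Fourier transform up to rescaling the frequency. -/
theorem hat_eq_fourier {d : ℕ} (f : Rd d → ℂ) (ξ : Rd d) :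
    hat f ξ = FourierTransform.fourier f ((2 * Real.pi)⁻¹ • ξ) := by
  rw [hat, Real.fourier_eq']
  refine integral_congr_ae (Eventually.of_forall fun x => ?_)
  have hpi : (Real.pi : ℂ) ≠ 0 := by exact_mod_cast Real.pi_ne_zero
  simp only [smul_eq_mul, inner_smul_right, real_inner_comm ξ x]
  congr 2
  push_cast
  field_simp

/-- A point of the integer lattice `ℤ^d`, seen in `ℝ^d`. -/
def latticePt {d : ℕ} (n : Fin d → ℤ) : Rd d :=
  WithLp.toLp 2 fun i => (n i : ℝ)

/-! ### The approximation spaces and the conditions on the kernels -/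

/-- The nonlinear space `Φ_N` of all sums `∑_{j=1}^N a_j φ_{α_j}(· - x_j)` with `a_j ∈ ℂ`,
`α_j ∈ A`, `x_j ∈ ℝ^d`. -/
def Phi {d : ℕ} (A : Set ℝ) (φ : ℝ → Rd d → ℂ) (N : ℕ) : Set (Rd d → ℂ) :=
  {g | ∃ (a : Fin N → ℂ) (α : Fin N → ℝ) (y : Fin N → Rd d), (∀ j, α j ∈ A) ∧
    g = fun x => ∑ j, a j * φ (α j) (x - y j)}

/-- (A1): every `Φ_N` is closed under translations and dilations. -/
def CondA1 {d : ℕ} (A : Set ℝ) (φ : ℝ → Rd d → ℂ) : Prop :=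
  ∀ N : ℕ, ∀ g ∈ Phi A φ N,
    (∀ y : Rd d, (fun x => g (x - y)) ∈ Phi A φ N) ∧
    (∀ δ : ℝ, 0 < δ → (fun x => g (δ • x)) ∈ Phi A φ N)

/-- (A2): the kernels are continuous and uniformly bounded. -/
def CondA2 {d : ℕ} (A : Set ℝ) (φ : ℝ → Rd d → ℂ) : Prop :=
  (∀ α ∈ A, Continuous (φ α)) ∧ ∃ C : ℝ, ∀ α ∈ A, ∀ x, ‖φ α x‖ ≤ C

/-- `∑_{j ∈ ℤ^d, j ≠ 0} ‖ φ^(· + 2πj/h) / φ^ ‖_{L_∞(B(0,R))}`. -/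
def ratioSum {d : ℕ} (R : ℝ) (φ : Rd d → ℂ) (h : ℝ) : ℝ≥0∞ :=
  ∑' j : {j : Fin d → ℤ // j ≠ 0},
    eLpNorm (fun ξ => hat φ (ξ + (2 * Real.pi / h) • latticePt j.1) / hat φ ξ) ∞
      (volume.restrict (Metric.ball 0 R))

/-- (A3): for every `k`, if `α` is large enough, then the quotients are defined
(`φ_α^ ≠ 0` a.e. on the ball) and the sum of their norms is at most `C h^k` for small `h > 0`. -/
def CondA3 {d : ℕ} (R : ℝ) (A : Set ℝ) (φ : ℝ → Rd d → ℂ) : Prop :=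
  ∀ k : ℕ, ∃ αk ∈ A, ∀ α ∈ A, αk ≤ α →
    (∀ᵐ ξ ∂(volume.restrict (Metric.ball (0 : Rd d) R)), hat (φ α) ξ ≠ 0) ∧
    ∃ C : ℝ, ∀ᶠ h in 𝓝[>] (0 : ℝ), ratioSum R (φ α) h ≤ ENNReal.ofReal (C * h ^ k)

/-- `u` has weak derivatives of all orders `≤ k` in `L_2(Ω)`. A partial derivative `D^γ` with
`|γ| = m` is written as the derivative along `m` coordinate directions `i 0, …, i (m - 1)`. -/
def HasWeakDerivsL2 {d : ℕ} (Ω : Set (Rd d)) (k : ℕ) (u : Rd d → ℂ) : Prop :=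
  MemLp u 2 (volume.restrict Ω) ∧
  ∀ m ≤ k, ∀ i : Fin m → Fin d, ∃ v : Rd d → ℂ, MemLp v 2 (volume.restrict Ω) ∧
    ∀ θ : Rd d → ℂ, ContDiff ℝ ∞ θ → HasCompactSupport θ → tsupport θ ⊆ Ω →
      ∫ x in Ω, u x * iteratedFDeriv ℝ m θ x (fun l => EuclideanSpace.single (i l) (1 : ℝ)) =
        (-1) ^ m * ∫ x in Ω, v x * θ x

/-- (A4): for every `k`, if `α` is large enough, then `1 / φ_α^` is defined a.e. on the ball and
`D^γ (1 / φ_α^) ∈ L_2(B(0,R))` for `|γ| ≤ k`. -/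
def CondA4 {d : ℕ} (R : ℝ) (A : Set ℝ) (φ : ℝ → Rd d → ℂ) : Prop :=
  ∀ k : ℕ, ∃ αk ∈ A, ∀ α ∈ A, αk ≤ α →
    (∀ᵐ ξ ∂(volume.restrict (Metric.ball (0 : Rd d) R)), hat (φ α) ξ ≠ 0) ∧
    HasWeakDerivsL2 (Metric.ball 0 R) k (fun ξ => 1 / hat (φ α) ξ)

/-- (A5): for every `k`, if `α` is large enough, then `φ_α(x) = O(|x|^{-2k})` as `|x| → ∞`. -/
def CondA5 {d : ℕ} (A : Set ℝ) (φ : ℝ → Rd d → ℂ) : Prop :=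
  ∀ k : ℕ, ∃ αk ∈ A, ∀ α ∈ A, αk ≤ α →
    φ α =O[Bornology.cobounded (Rd d)] fun x => (‖x‖ ^ (2 * k))⁻¹

/-- (A6): each `φ_α` and its Fourier transform decay like `(1 + |x|)^{-d-ε}`. -/
def CondA6 {d : ℕ} (A : Set ℝ) (φ : ℝ → Rd d → ℂ) : Prop :=
  ∀ α ∈ A, ∃ C ε : ℝ, 0 < C ∧ 0 < ε ∧
    ∀ x, ‖φ α x‖ + ‖hat (φ α) x‖ ≤ C * (1 + ‖x‖) ^ (-(d : ℝ) - ε)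

/-- Conditions (A1)–(A6) for the family `(φ_α)_{α ∈ A}` and the ball `B(0,R)`. -/
structure IsAdmissible {d : ℕ} (R : ℝ) (A : Set ℝ) (φ : ℝ → Rd d → ℂ) : Prop where
  a1 : CondA1 A φ
  a2 : CondA2 A φ
  a3 : CondA3 R A φ
  a4 : CondA4 R A φ
  a5 : CondA5 A φ
  a6 : CondA6 A φ

/-! ### Wavelets and Besov spaces -/

/-- `ψ_I(x) = ψ((x - c(I)) / ℓ(I))` for the dyadic cube `I = 2^k (n + [0,1]^d)`, which has corner
`c(I) = 2^k n` and side length `ℓ(I) = 2^k`. -/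
def dyadic {d : ℕ} (ψ : Rd d → ℂ) (k : ℤ) (n : Fin d → ℤ) (x : Rd d) : ℂ :=
  ψ (((2 : ℝ) ^ k)⁻¹ • (x - (2 : ℝ) ^ k • latticePt n))

/-- The volume `|I| = 2^{kd}` of a dyadic cube of side length `2^k`. -/
def cubeVol (d : ℕ) (k : ℤ) : ℝ := ((2 : ℝ) ^ k) ^ d

/-- A wavelet system in `H_B`, `B = B(0,R)`: finitely many Schwartz functions `ψ_e`, with Fourier
transforms supported in the ball, for which the functions `|I|^{-1/2} (ψ_e)_I`, with `I` ranging
over all dyadic cubes, form a complete orthonormal system in `L_2(ℝ^d)`. -/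
structure IsWaveletSystem {d : ℕ} (R : ℝ) {ι : Type} (ψ : ι → 𝓢(Rd d, ℂ)) : Prop where
  bandlimited : ∀ e ξ, R < ‖ξ‖ → hat (ψ e) ξ = 0
  normalized : ∀ e k n,
    ∫ x, dyadic (ψ e) k n x * (starRingEnd ℂ) (dyadic (ψ e) k n x) = (cubeVol d k : ℂ)
  orthogonal : ∀ e k n e' k' n', (e, k, n) ≠ (e', k', n') →
    ∫ x, dyadic (ψ e) k n x * (starRingEnd ℂ) (dyadic (ψ e') k' n' x) = 0
  complete : ∀ f : Rd d → ℂ, MemLp f 2 volume →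
    (∀ e k n, ∫ x, f x * (starRingEnd ℂ) (dyadic (ψ e) k n x) = 0) → f =ᵐ[volume] 0

/-- The coefficient `f_I = |I|^{-1} ∫ f \overline{ψ_I}` of the expansion `f = ∑ f_I ψ_I`. -/
def coeff {d : ℕ} (ψ : Rd d → ℂ) (f : Rd d → ℂ) (k : ℤ) (n : Fin d → ℤ) : ℂ :=
  ((cubeVol d k)⁻¹ : ℝ) * ∫ x, f x * (starRingEnd ℂ) (dyadic ψ k n x)

/-- The Besov quasi-seminorm `( ∑_k ( (∑_{e, I ∈ D_k} |f_{e,I}|^τ)^{1/τ} )^q )^{1/q}`; it belongs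
to the smoothness `s = d/τ`. -/
def besovSeminorm {d : ℕ} {ι : Type} (ψ : ι → 𝓢(Rd d, ℂ)) (τ q : ℝ) (f : Rd d → ℂ) : ℝ≥0∞ :=
  (∑' k : ℤ, ((∑' p : ι × (Fin d → ℤ), ‖coeff (ψ p.1) f k p.2‖ₑ ^ τ) ^ (1 / τ)) ^ q) ^ (1 / q)

/-- The Besov space `B^s_{τ,q}`, `s = d/τ`: functions in `L_τ` of finite quasi-seminorm. If `τ < 1`
they are also required to be in `L_1`, so that the coefficients are defined; if `τ ≥ 1` the second
clause repeats the first. -/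
def BesovSpace {d : ℕ} {ι : Type} (ψ : ι → 𝓢(Rd d, ℂ)) (τ q : ℝ) : Set (Rd d → ℂ) :=
  {f | MemLp f (ENNReal.ofReal τ) volume ∧ MemLp f (ENNReal.ofReal (max 1 τ)) volume ∧
    besovSeminorm ψ τ q f < ⊤}

end KernelApprox

end

open KernelApprox

/-!
The proof combines a linear scheme for one band-limited function with a nonlinear distribution of
the terms over its dyadic copies.

*One wavelet.* A band-limited `ψ` is formally `φ_α * σ`, where `σ` has Fourier transform
`ψ^ / φ_α^` on the ball (`deconv`). The convolution integral is replaced by its Riemann sum with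
mesh `h` (`sampled`), a combination of shifts of `φ_α`. By Poisson summation
(`tsum_latticePt_eq_tsum_fourier`), on the Fourier side the Riemann sum differs from `ψ` exactly by
the aliasing terms, which are the quotients occurring in `CondA3`; hence the error is uniformly
`O(h^k)` with `k` as large as desired (`norm_sub_sampled_le`). The weak derivatives of `1 / φ_α^`
give decay of `σ` through integration by parts (`HasWeakDerivsL2.exists_norm_integral_le_wt`), so
the Riemann sum decays and can be truncated to finitely many nodes. The geometric mean of the
uniform error bound and the decay bound is small and decaying at once. The outcome,
`exists_Phi_approx`, is an `n`-term approximation of `ψ` with an error `O(n^{-r} (1 + ‖x‖)^{-b})`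
for any prescribed `r` and `b`. Invariance of `Φ_n` under translations and dilations transfers it to
every `ψ_I`, with the same constant (`exists_wavelet_approx`).

*The wavelet series.* A function `f` in the Besov space satisfies `f = ∑ f_I ψ_I` almost everywhere
(`IsWaveletSystem.ae_eq_synthesis`). As `q ≤ 1`, the level-wise suprema of the coefficients are
summable, so the series converges uniformly and absolutely, and its sum has the coefficients of `f`.
The difference `g` has vanishing coefficients, and the completeness in `L_2` has to be transferred
to it. Orthogonality forces the wavelets to have mean zero (`IsWaveletSystem.integral_eq_zero`), so
that a mean-zero Schwartz function has a wavelet series converging in `L_1` and uniformly; pairing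
it with `g` shows that `g` annihilates mean-zero test functions, that is, `g` is constant. It is
zero because it is negligible at infinity (`IsWaveletSystem.ae_eq_zero_of_waveletCoeff`).

*Distribution of the terms.* With `r = s / d`, a coefficient `b` on a level with `ℓ_τ` norm `c`
receives `n ≈ N (b / c)^τ (c / B)^q` terms, where `B` is the quasi-seminorm (`budget`). These numbers
add up to at most `N`, and since `τ r = 1` the error `b n^{-r} ≈ N^{-r} B^{1 - q} c^q` depends on the
level only (`mul_rpow_budget_le`). Owing to the decay, the errors of a single level add up to a
multiple of this bound at every point, and the sum of `c^q` over all levels is `B^q`.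
-/

namespace KernelApprox

/-! ### Polynomial weights and lattice sums -/

/-- The polynomially decaying weight `(1 + ‖x‖)^{-m}`. -/
noncomputable def wt {d : ℕ} (m : ℕ) (x : Rd d) : ℝ := ((1 + ‖x‖) ^ m)⁻¹

section Weights

variable {d : ℕ}

theorem wt_pos (m : ℕ) (x : Rd d) : 0 < wt m x := by unfold wt; positivity

theorem wt_nonneg (m : ℕ) (x : Rd d) : 0 ≤ wt m x := (wt_pos m x).le

theorem wt_le_one (m : ℕ) (x : Rd d) : wt m x ≤ 1 :=
  inv_le_one_of_one_le₀ (one_le_pow₀ (by linarith [norm_nonneg x]))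

theorem wt_anti {m n : ℕ} (h : m ≤ n) (x : Rd d) : wt n x ≤ wt m x :=
  inv_anti₀ (by positivity) (pow_le_pow_right₀ (by linarith [norm_nonneg x]) h)

theorem wt_mul_wt (m n : ℕ) (x : Rd d) : wt m x * wt n x = wt (m + n) x := by
  unfold wt; rw [pow_add, mul_inv]

theorem wt_neg (m : ℕ) (x : Rd d) : wt m (-x) = wt m x := by simp [wt]

theorem wt_sub_comm (m : ℕ) (x y : Rd d) : wt m (x - y) = wt m (y - x) := by
  rw [← wt_neg, neg_sub]

theorem wt_mul_wt_le (m : ℕ) (x y : Rd d) : wt m x * wt m y ≤ wt m (x + y) := by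
  unfold wt
  rw [← mul_inv, ← mul_pow]
  refine inv_anti₀ (by positivity) (pow_le_pow_left₀ (by positivity) ?_ m)
  nlinarith [norm_add_le x y, norm_nonneg x, norm_nonneg y,
    mul_nonneg (norm_nonneg x) (norm_nonneg y)]

/-- Moving the argument of the weight by `x - y` costs a factor `(1 + ‖x - y‖)^m`. -/
theorem wt_le_mul_wt (m : ℕ) (x y : Rd d) : wt m x ≤ (1 + ‖x - y‖) ^ m * wt m y := by
  have h := wt_mul_wt_le m x (y - x)
  rw [add_sub_cancel] at h
  have hp : 0 < (1 + ‖x - y‖) ^ m := by positivity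
  calc wt m x = (1 + ‖x - y‖) ^ m * (wt m x * wt m (y - x)) := by
        rw [wt_sub_comm m y x, wt, wt]; field_simp
    _ ≤ _ := by gcongr

theorem integrable_wt {m : ℕ} (hm : d < m) : Integrable (wt (d := d) m) volume := by
  have h := integrable_one_add_norm (E := Rd d) (μ := volume) (r := m) (by simpa using hm)
  refine h.congr (Eventually.of_forall fun x => ?_)
  simp only [wt]
  rw [Real.rpow_neg (by positivity), Real.rpow_natCast]

theorem latticePt_apply (n : Fin d → ℤ) (i : Fin d) : latticePt n i = (n i : ℝ) := rfl

/-- The half-open unit cube with lower corner `n`. -/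
def unitCube (n : Fin d → ℤ) : Set (Rd d) :=
  {x | ∀ i, x i ∈ Set.Ioc (n i : ℝ) (n i + 1)}

theorem unitCube_eq_preimage (n : Fin d → ℤ) :
    unitCube n = (WithLp.ofLp : Rd d → (Fin d → ℝ)) ⁻¹'
      (Set.univ.pi fun i => Set.Ioc (n i : ℝ) (n i + 1)) := by
  ext x; simp [unitCube]

theorem measurableSet_unitCube (n : Fin d → ℤ) : MeasurableSet (unitCube n) := by
  rw [unitCube_eq_preimage]
  exact (PiLp.volume_preserving_ofLp (Fin d)).measurable
    (MeasurableSet.univ_pi fun i => measurableSet_Ioc)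

theorem volume_unitCube (n : Fin d → ℤ) : volume (unitCube n) = 1 := by
  rw [unitCube_eq_preimage, (PiLp.volume_preserving_ofLp (Fin d)).measure_preimage
    (MeasurableSet.univ_pi fun i => measurableSet_Ioc).nullMeasurableSet, volume_pi_pi]
  simp

theorem iUnion_unitCube : ⋃ n : Fin d → ℤ, unitCube n = Set.univ := by
  refine Set.eq_univ_of_forall fun x => Set.mem_iUnion.2 ⟨fun i => ⌈x i⌉ - 1, fun i => ?_⟩
  push_cast
  constructor
  · linarith [Int.ceil_lt_add_one (x i)]
  · linarith [Int.le_ceil (x i)]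

theorem pairwise_disjoint_unitCube :
    Pairwise (Function.onFun Disjoint (unitCube (d := d))) := by
  intro m n hmn
  refine Set.disjoint_left.2 fun x hm hn => hmn (funext fun i => ?_)
  have h1 := hm i
  have h2 := hn i
  have a : ((m i : ℤ) : ℝ) < n i + 1 := h1.1.trans_le h2.2
  have b : ((n i : ℤ) : ℝ) < m i + 1 := h2.1.trans_le h1.2
  norm_cast at a b
  omega

theorem norm_sub_latticePt_le {n : Fin d → ℤ} {x : Rd d} (hx : x ∈ unitCube n) :
    ‖x - latticePt n‖ ≤ d := by
  rw [EuclideanSpace.norm_eq]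
  have hle : ∑ i, ‖(x - latticePt n) i‖ ^ 2 ≤ (d : ℝ) := by
    calc ∑ i, ‖(x - latticePt n) i‖ ^ 2 ≤ ∑ _i : Fin d, (1 : ℝ) := by
          refine Finset.sum_le_sum fun i _ => ?_
          have h := hx i
          rw [PiLp.sub_apply, latticePt_apply, Real.norm_eq_abs, sq_abs]
          nlinarith [h.1, h.2]
      _ = d := by simp
  calc √(∑ i, ‖(x - latticePt n) i‖ ^ 2) ≤ √d := Real.sqrt_le_sqrt hle
    _ ≤ d := by
      rcases Nat.eq_zero_or_pos d with h | h
      · subst h; simp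
      · rw [Real.sqrt_le_left (by positivity)]
        have : (1 : ℝ) ≤ d := by exact_mod_cast h
        nlinarith

theorem tsum_setLIntegral_unitCube (f : Rd d → ℝ≥0∞) :
    ∑' n : Fin d → ℤ, ∫⁻ x in unitCube n, f x = ∫⁻ x, f x := by
  rw [← lintegral_iUnion measurableSet_unitCube pairwise_disjoint_unitCube, iUnion_unitCube,
    Measure.restrict_univ]

/-- Riemann sums of the weight are bounded, uniformly in the mesh size `h ≤ 1` and in the shift. -/
theorem exists_tsum_wt_le (d : ℕ) : ∃ K : ℝ, 0 < K ∧ ∀ h : ℝ, 0 < h → h ≤ 1 → ∀ x : Rd d,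
    ∑' j : Fin d → ℤ, ENNReal.ofReal (wt (d + 1) (x - h • latticePt j)) ≤
      ENNReal.ofReal (K * (h ^ d)⁻¹) := by
  set I : ℝ := ∫ y : Rd d, wt (d + 1) y with hI
  have hI0 : 0 ≤ I := integral_nonneg fun y => wt_nonneg _ y
  refine ⟨(1 + d) ^ (d + 1) * (I + 1), by positivity, fun h h0 h1 x => ?_⟩
  have key : ∀ j : Fin d → ℤ, ENNReal.ofReal (wt (d + 1) (x - h • latticePt j)) ≤
      ∫⁻ y in unitCube j, ENNReal.ofReal ((1 + d) ^ (d + 1) * wt (d + 1) (x - h • y)) := by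
    intro j
    calc ENNReal.ofReal (wt (d + 1) (x - h • latticePt j))
        = ∫⁻ y in unitCube j, ENNReal.ofReal (wt (d + 1) (x - h • latticePt j)) := by
          rw [setLIntegral_const, volume_unitCube, mul_one]
      _ ≤ _ := by
          refine setLIntegral_mono' (measurableSet_unitCube j) fun y hy => ?_
          refine ENNReal.ofReal_le_ofReal ((wt_le_mul_wt _ _ (x - h • y)).trans ?_)
          refine mul_le_mul_of_nonneg_right ?_ (wt_nonneg _ _)
          have : ‖x - h • latticePt j - (x - h • y)‖ ≤ d := by
            rw [sub_sub_sub_cancel_left, ← smul_sub, norm_smul, Real.norm_eq_abs, abs_of_pos h0]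
            have := norm_sub_latticePt_le hy
            nlinarith [norm_nonneg (y - latticePt j)]
          gcongr
  calc _ ≤ ∑' j : Fin d → ℤ,
        ∫⁻ y in unitCube j, ENNReal.ofReal ((1 + d) ^ (d + 1) * wt (d + 1) (x - h • y)) :=
        ENNReal.tsum_le_tsum key
    _ = ∫⁻ y, ENNReal.ofReal ((1 + d) ^ (d + 1) * wt (d + 1) (x - h • y)) :=
        tsum_setLIntegral_unitCube _
    _ = ENNReal.ofReal (∫ y, (1 + d) ^ (d + 1) * wt (d + 1) (x - h • y)) := by
        rw [ofReal_integral_eq_lintegral_ofReal]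
        · refine Integrable.const_mul ?_ _
          exact ((integrable_wt (Nat.lt_succ_self d)).comp_sub_left x).comp_smul h0.ne'
        · exact Eventually.of_forall fun y => mul_nonneg (by positivity) (wt_nonneg _ _)
    _ ≤ _ := by
        refine ENNReal.ofReal_le_ofReal ?_
        rw [integral_const_mul, Measure.integral_comp_smul volume (fun y => wt (d + 1) (x - y)) h,
          integral_sub_left_eq_self (fun y => wt (d + 1) y) volume x, smul_eq_mul]
        simp only [finrank_euclideanSpace, Fintype.card_fin]
        rw [abs_of_pos (by positivity), ← hI, mul_assoc, mul_comm _ I]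
        gcongr
        linarith

end Weights

/-! ### Poisson summation on `ℝ^d` -/

section Poisson

variable {d : ℕ}

theorem latticePt_add (m n : Fin d → ℤ) : latticePt (m + n) = latticePt m + latticePt n := by
  ext i; simp [latticePt_apply]

theorem latticePt_zero : latticePt (0 : Fin d → ℤ) = 0 := by
  ext i; simp [latticePt_apply]

theorem preimage_add_latticePt_unitCube (k : Fin d → ℤ) :
    (fun x : Rd d => x + latticePt k) ⁻¹' unitCube k = unitCube 0 := by
  ext x
  simp only [unitCube, Set.mem_preimage, Set.mem_ofPred_eq, PiLp.add_apply, latticePt_apply,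
    Set.mem_Ioc]
  refine forall_congr' fun i => ?_
  constructor <;> rintro ⟨a, b⟩ <;> constructor <;> simp at * <;> linarith

theorem setIntegral_unitCube_eq (f : Rd d → ℂ) (k : Fin d → ℤ) :
    ∫ x in unitCube k, f x = ∫ x in unitCube 0, f (x + latticePt k) := by
  rw [← preimage_add_latticePt_unitCube k]
  exact ((measurePreserving_add_right volume (latticePt k)).setIntegral_preimage_emb
    (measurableEmbedding_addRight _) f _).symm

theorem setLIntegral_unitCube_eq (f : Rd d → ℝ≥0∞) (k : Fin d → ℤ) :
    ∫⁻ x in unitCube k, f x = ∫⁻ x in unitCube 0, f (x + latticePt k) := by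
  rw [← preimage_add_latticePt_unitCube k]
  exact ((measurePreserving_add_right volume (latticePt k)).setLIntegral_comp_preimage_emb
    (measurableEmbedding_addRight _) f _).symm

/-- The integral over `ℝ^d` is the integral over the unit cube of the periodization. -/
theorem setIntegral_unitCube_tsum {f : Rd d → ℂ} (hf : Integrable f volume) :
    ∫ x in unitCube 0, ∑' k : Fin d → ℤ, f (x + latticePt k) = ∫ x, f x := by
  rw [integral_tsum]
  · simp_rw [← setIntegral_unitCube_eq]
    rw [← integral_iUnion measurableSet_unitCube pairwise_disjoint_unitCube hf.integrableOn,
      iUnion_unitCube, Measure.restrict_univ]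
  · intro k
    exact (hf.comp_add_right (latticePt k)).aestronglyMeasurable.restrict
  · simp_rw [← setLIntegral_unitCube_eq (fun x => ‖f x‖ₑ)]
    rw [tsum_setLIntegral_unitCube]
    exact hf.2.ne

/-- The periodization of a weight of order larger than `d` converges and is bounded. -/
theorem exists_tsum_wt_le' (d : ℕ) : ∃ K : ℝ, 0 < K ∧ ∀ m, d < m → ∀ x : Rd d,
    Summable (fun j : Fin d → ℤ => wt m (x + latticePt j)) ∧
      ∑' j : Fin d → ℤ, wt m (x + latticePt j) ≤ K := by
  obtain ⟨K, K0, hK⟩ := exists_tsum_wt_le d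
  refine ⟨K, K0, fun m hm x => ?_⟩
  have h := hK 1 one_pos le_rfl (-x)
  have h2 : ∑' j : Fin d → ℤ, ENNReal.ofReal (wt m (x + latticePt j)) ≤ ENNReal.ofReal K := by
    refine (ENNReal.tsum_le_tsum fun j => ENNReal.ofReal_le_ofReal ?_).trans (h.trans_eq (by simp))
    rw [one_smul, ← wt_neg (d + 1), neg_sub, sub_neg_eq_add, add_comm]
    exact wt_anti hm _
  have hs : Summable (fun j : Fin d → ℤ => wt m (x + latticePt j)) := by
    have := ENNReal.summable_toReal (ne_top_of_le_ne_top ENNReal.ofReal_ne_top h2)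
    exact this.congr fun j => ENNReal.toReal_ofReal (wt_nonneg _ _)
  refine ⟨hs, ?_⟩
  rw [← ENNReal.ofReal_tsum_of_nonneg (fun j => wt_nonneg _ _) hs] at h2
  exact (ENNReal.ofReal_le_ofReal_iff K0.le).1 h2

theorem summable_wt_latticePt {m : ℕ} (hm : d < m) (x : Rd d) :
    Summable (fun j : Fin d → ℤ => wt m (x + latticePt j)) := by
  obtain ⟨K, -, hK⟩ := exists_tsum_wt_le' d
  exact (hK m hm x).1

theorem continuous_periodization {G : Rd d → ℂ} (hc : Continuous G) {C : ℝ} {m : ℕ} (hm : d < m)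
    (hG : ∀ x, ‖G x‖ ≤ C * wt m x) :
    Continuous fun x => ∑' k : Fin d → ℤ, G (x + latticePt k) := by
  have hC : 0 ≤ C := by
    have := (norm_nonneg _).trans (hG 0)
    nlinarith [wt_pos m (0 : Rd d)]
  rw [continuous_iff_continuousAt]
  intro x₀
  have : ContinuousOn (fun x => ∑' k : Fin d → ℤ, G (x + latticePt k)) (Metric.ball x₀ 1) := by
    refine continuousOn_tsum (u := fun k => C * ((1 + 1) ^ m * wt m (x₀ + latticePt k)))
      (fun k => (hc.comp (continuous_id.add continuous_const)).continuousOn)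
      (((summable_wt_latticePt hm x₀).mul_left _).mul_left _) fun k x hx => ?_
    refine (hG _).trans (mul_le_mul_of_nonneg_left ?_ hC)
    refine (wt_le_mul_wt m _ (x₀ + latticePt k)).trans
      (mul_le_mul_of_nonneg_right ?_ (wt_nonneg _ _))
    rw [add_sub_add_right_eq_sub, ← dist_eq_norm]
    have := (Metric.mem_ball.1 hx).le
    gcongr
  exact this.continuousAt (Metric.ball_mem_nhds x₀ one_pos)

theorem periodization_add (G : Rd d → ℂ) (x : Rd d) (n : Fin d → ℤ) :
    ∑' k : Fin d → ℤ, G (x + latticePt n + latticePt k) = ∑' k : Fin d → ℤ, G (x + latticePt k) := by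
  rw [← (Equiv.addLeft n).tsum_eq (fun k => G (x + latticePt k))]
  simp [latticePt_add, add_assoc]

/-- The characters of the torus, lifted to `ℝ^d`, are those of Mathlib's Fourier transform. -/
theorem mFourier_neg_coe (n : Fin d → ℤ) (x : Rd d) :
    UnitAddTorus.mFourier (-n) (fun i => ((x i : ℝ) : UnitAddCircle)) =
      (Real.fourierChar (-(inner ℝ x (latticePt n))) : ℂ) := by
  simp only [UnitAddTorus.mFourier, ContinuousMap.coe_mk, fourier_coe_apply, ← Complex.exp_sum,
    Real.fourierChar_apply, PiLp.inner_apply, latticePt_apply]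
  congr 1
  push_cast
  rw [← Finset.sum_neg_distrib, Finset.mul_sum, Finset.sum_mul]
  refine Finset.sum_congr rfl fun i _ => ?_
  simp
  ring

/-- **Poisson's summation formula** on `ℝ^d`: the sum of a continuous function of fast decay over
the lattice `ℤ^d` is that of its Fourier transform, if the latter is summable. -/
theorem tsum_latticePt_eq_tsum_fourier {G : Rd d → ℂ} (hc : Continuous G) {C : ℝ} {m : ℕ}
    (hm : d < m) (hG : ∀ x, ‖G x‖ ≤ C * wt m x)
    (hs : Summable fun n : Fin d → ℤ => FourierTransform.fourier G (latticePt n)) :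
    ∑' n : Fin d → ℤ, G (latticePt n) =
      ∑' n : Fin d → ℤ, FourierTransform.fourier G (latticePt n) := by
  set P : Rd d → ℂ := fun x => ∑' k : Fin d → ℤ, G (x + latticePt k) with hP
  have hPc : Continuous P := continuous_periodization hc hm hG
  have hGi : Integrable G volume :=
    ((integrable_wt hm).const_mul C).mono' hc.aestronglyMeasurable (Eventually.of_forall hG)
  -- The periodization descends to the torus.
  let F₀ : UnitAddTorus (Fin d) → ℂ := fun z =>
    P (WithLp.toLp 2 fun i => (AddCircle.equivIoc 1 0 (z i)).1)
  let π : (Fin d → ℝ) → UnitAddTorus (Fin d) := fun x i => (x i : UnitAddCircle)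
  have hF₀ : ∀ x : Fin d → ℝ, F₀ (π x) = P (WithLp.toLp 2 x) := by
    intro x
    have hex : ∀ i, ∃ n : ℤ, (AddCircle.equivIoc 1 0 (x i : UnitAddCircle)).1 = x i + n := by
      intro i
      have h := (AddCircle.equivIoc (1 : ℝ) 0).symm_apply_apply (x i : UnitAddCircle)
      have h' : (((AddCircle.equivIoc 1 0 (x i : UnitAddCircle)).1 : ℝ) : UnitAddCircle) = x i := h
      rw [← sub_eq_zero, ← AddCircle.coe_sub, AddCircle.coe_eq_zero_iff] at h'
      obtain ⟨n, hn⟩ := h'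
      rw [zsmul_one] at hn
      exact ⟨n, by linarith⟩
    choose n hn using hex
    have : (WithLp.toLp 2 fun i => (AddCircle.equivIoc 1 0 (π x i)).1 : Rd d) =
        WithLp.toLp 2 x + latticePt n := by
      ext i
      simp only [PiLp.add_apply, latticePt_apply]
      exact hn i
    simp only [F₀, this, hP]
    exact periodization_add G _ n
  have hπ : IsOpenQuotientMap π :=
    IsOpenQuotientMap.piMap fun _ => QuotientAddGroup.isOpenQuotientMap_mk
  have hF₀c : Continuous F₀ := by
    rw [hπ.isQuotientMap.continuous_iff]
    have : F₀ ∘ π = fun x => P (WithLp.toLp 2 x) := funext hF₀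
    rw [this]
    exact hPc.comp (PiLp.continuous_toLp 2 _)
  let F : C(UnitAddTorus (Fin d), ℂ) := ⟨F₀, hF₀c⟩
  have hcoeff : ∀ n : Fin d → ℤ, UnitAddTorus.mFourierCoeff F n =
      FourierTransform.fourier G (latticePt n) := by
    intro n
    set g : Rd d → ℂ := fun x => (Real.fourierChar (-(inner ℝ x (latticePt n))) : ℂ) * G x with hg
    have hgi : Integrable g volume := by
      refine hGi.norm.mono' ?_ (Eventually.of_forall fun x => ?_)
      · refine Continuous.aestronglyMeasurable (Continuous.mul ?_ hc)
        fun_prop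
      · rw [norm_mul, Circle.norm_coe, one_mul]
    have hg_add : ∀ x k, g (x + latticePt k) =
        (Real.fourierChar (-(inner ℝ x (latticePt n))) : ℂ) * G (x + latticePt k) := by
      intro x k
      simp only [hg]
      congr 1
      rw [← mFourier_neg_coe, ← mFourier_neg_coe]
      congr 1
      funext i
      simp [latticePt_apply]
    calc UnitAddTorus.mFourierCoeff F n
        = ∫ x in (WithLp.ofLp ⁻¹' {x : Fin d → ℝ | ∀ i, x i ∈ Set.Ioc ((0 : Fin d → ℝ) i)
            ((0 : Fin d → ℝ) i + 1)} : Set (Rd d)),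
            UnitAddTorus.mFourier (-n) (fun i => ((x i : ℝ) : UnitAddCircle)) * P x := by
          rw [UnitAddTorus.mFourierCoeff_eq_integral F n 0,
            ← (PiLp.volume_preserving_ofLp (Fin d)).setIntegral_preimage_emb
              (MeasurableEquiv.toLp 2 (Fin d → ℝ)).symm.measurableEmbedding]
          refine integral_congr_ae (Eventually.of_forall fun x => ?_)
          simp only [smul_eq_mul]
          congr 1
          exact hF₀ x.ofLp
      _ = ∫ x in unitCube 0, ∑' k : Fin d → ℤ, g (x + latticePt k) := by
          have : (WithLp.ofLp ⁻¹' {x : Fin d → ℝ | ∀ i, x i ∈ Set.Ioc ((0 : Fin d → ℝ) i)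
            ((0 : Fin d → ℝ) i + 1)} : Set (Rd d)) = unitCube 0 := by
            ext x; simp [unitCube]
          rw [this]
          refine integral_congr_ae (Eventually.of_forall fun x => ?_)
          simp only [hg_add]
          rw [tsum_mul_left, mFourier_neg_coe]
      _ = ∫ x, g x := setIntegral_unitCube_tsum hgi
      _ = _ := by
          rw [Real.fourier_eq]
          simp only [hg, Circle.smul_def, smul_eq_mul]
  have hsum : Summable (UnitAddTorus.mFourierCoeff F) := hs.congr fun n => (hcoeff n).symm
  have h := (UnitAddTorus.hasSum_mFourier_series_apply_of_summable hsum (π 0)).tsum_eq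
  have h0 : F (π 0) = ∑' n : Fin d → ℤ, G (latticePt n) := by
    change F₀ (π 0) = _
    rw [hF₀]
    simp [hP]
  rw [← h0, ← h]
  refine tsum_congr fun n => ?_
  rw [hcoeff]
  simp [UnitAddTorus.mFourier, π]

end Poisson

/-! ### Weak derivatives and decay of inverse Fourier transforms -/

section WeakDerivatives

variable {d : ℕ}

/-- The plane wave `ξ ↦ e^{i⟨x, ξ⟩}`. -/
noncomputable def planeWave (x ξ : Rd d) : ℂ := Complex.exp (Complex.I * ((inner ℝ x ξ : ℝ) : ℂ))

theorem planeWave_comm (x ξ : Rd d) : planeWave x ξ = planeWave ξ x := by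
  rw [planeWave, real_inner_comm, planeWave]

@[simp] theorem norm_planeWave (x ξ : Rd d) : ‖planeWave x ξ‖ = 1 := by
  rw [planeWave, mul_comm, Complex.norm_exp_ofReal_mul_I]

theorem contDiff_planeWave (x : Rd d) : ContDiff ℝ ∞ (planeWave x) := by
  unfold planeWave
  refine ContDiff.cexp (contDiff_const.mul ?_)
  exact Complex.ofRealCLM.contDiff.comp (contDiff_const.inner ℝ contDiff_id)

theorem continuous_planeWave (x : Rd d) : Continuous (planeWave x) :=
  (contDiff_planeWave x).continuous

theorem hat_eq (f : Rd d → ℂ) (ξ : Rd d) : hat f ξ = ∫ x, planeWave (-ξ) x * f x := by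
  simp [hat, planeWave]

/-- The partial derivative in the `i`-th coordinate direction. -/
noncomputable def partialD (i : Fin d) (p : Rd d → ℂ) (x : Rd d) : ℂ :=
  fderiv ℝ p x (EuclideanSpace.single i (1 : ℝ))

theorem contDiff_partialD (i : Fin d) {p : Rd d → ℂ} (hp : ContDiff ℝ ∞ p) :
    ContDiff ℝ ∞ (partialD i p) := by
  unfold partialD
  exact (hp.fderiv_right (m := ∞) (by simp)).clm_apply contDiff_const

theorem partialD_planeWave (i : Fin d) (x ξ : Rd d) :
    partialD i (planeWave x) ξ = Complex.I * (x i : ℂ) * planeWave x ξ := by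
  have h1 : HasFDerivAt (fun ξ : Rd d => Complex.I * ((inner ℝ x ξ : ℝ) : ℂ))
      (Complex.I • (Complex.ofRealCLM.comp (innerSL ℝ x))) ξ :=
    (Complex.ofRealCLM.hasFDerivAt.comp ξ (innerSL ℝ x).hasFDerivAt).const_mul Complex.I
  have h2 := h1.cexp
  unfold partialD
  have : planeWave x = fun ξ : Rd d => Complex.exp (Complex.I * ((inner ℝ x ξ : ℝ) : ℂ)) := rfl
  rw [this, h2.fderiv]
  simp [EuclideanSpace.inner_single_right]
  ring

theorem partialD_mul (i : Fin d) {p r : Rd d → ℂ} (hp : ContDiff ℝ ∞ p) (hr : ContDiff ℝ ∞ r)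
    (x : Rd d) : partialD i (fun y => p y * r y) x = partialD i p x * r x + p x * partialD i r x := by
  have h1 := (hp.differentiable (by simp)) x
  have h2 := (hr.differentiable (by simp)) x
  unfold partialD
  rw [fderiv_fun_mul h1 h2]
  simp
  ring

theorem iteratedFDeriv_succ_const (i : Fin d) {p : Rd d → ℂ} (hp : ContDiff ℝ ∞ p) (m : ℕ)
    (x : Rd d) :
    iteratedFDeriv ℝ (m + 1) p x (fun _ => EuclideanSpace.single i (1 : ℝ)) =
      iteratedFDeriv ℝ m (partialD i p) x (fun _ => EuclideanSpace.single i (1 : ℝ)) := by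
  rw [iteratedFDeriv_succ_apply_right]
  unfold partialD
  rw [iteratedFDeriv_clm_apply_const_apply (n := ∞) (hp.fderiv_right (m := ∞) (by simp))
    (by exact_mod_cast le_top)]
  rfl

theorem tsupport_partialD_subset (i : Fin d) (p : Rd d → ℂ) :
    tsupport (partialD i p) ⊆ tsupport p := by
  refine closure_minimal (fun x hx => ?_) (isClosed_tsupport p)
  refine tsupport_fderiv_subset ℝ (subset_tsupport _ fun h => hx ?_)
  simp [partialD, h]

/-- `v` is a chain of successive weak derivatives in the `i`-th coordinate direction, on the
ball of radius `R` and up to order `k`. -/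
structure IsWeakDerivChain (R : ℝ) (k : ℕ) (i : Fin d) (v : ℕ → Rd d → ℂ) : Prop where
  integrableOn : ∀ m ≤ k, IntegrableOn (v m) (Metric.ball 0 R) volume
  integral_partialD : ∀ m < k, ∀ θ : Rd d → ℂ, ContDiff ℝ ∞ θ → HasCompactSupport θ →
    tsupport θ ⊆ Metric.ball 0 R →
    ∫ x in Metric.ball 0 R, v m x * partialD i θ x = -∫ x in Metric.ball 0 R, v (m + 1) x * θ x

theorem HasWeakDerivsL2.exists_chain {R : ℝ} {k : ℕ} {u : Rd d → ℂ}
    (hu : HasWeakDerivsL2 (Metric.ball 0 R) k u) (i : Fin d) :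
    ∃ v : ℕ → Rd d → ℂ, v 0 = u ∧ IsWeakDerivChain R k i v := by
  obtain ⟨hu0, hu⟩ := hu
  have hex : ∀ m : ℕ, ∃ v : Rd d → ℂ, (m = 0 → v = u) ∧ (m ≤ k →
      MemLp v 2 (volume.restrict (Metric.ball 0 R)) ∧
      ∀ θ : Rd d → ℂ, ContDiff ℝ ∞ θ → HasCompactSupport θ → tsupport θ ⊆ Metric.ball 0 R →
      ∫ x in Metric.ball 0 R, u x *
          iteratedFDeriv ℝ m θ x (fun _ => EuclideanSpace.single i (1 : ℝ)) =
        (-1) ^ m * ∫ x in Metric.ball 0 R, v x * θ x) := by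
    intro m
    rcases Nat.eq_zero_or_pos m with rfl | hm
    · exact ⟨u, fun _ => rfl, fun _ => ⟨hu0, fun θ _ _ _ => by simp⟩⟩
    · by_cases hk : m ≤ k
      · obtain ⟨v, hv⟩ := hu m hk (fun _ => i)
        exact ⟨v, fun h => absurd h hm.ne', fun _ => hv⟩
      · exact ⟨u, fun _ => rfl, fun h => absurd h hk⟩
  choose v hv0 hv using hex
  refine ⟨v, hv0 0 rfl, fun m hm => ?_, fun m hm θ hθ hc hs => ?_⟩
  · have : IsFiniteMeasure (volume.restrict (Metric.ball (0 : Rd d) R)) :=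
      ⟨by simpa using measure_ball_lt_top⟩
    exact (hv m hm).1.integrable (by norm_num)
  · have h1 := (hv m hm.le).2 (partialD i θ) (contDiff_partialD i hθ)
      (hc.mono' ((subset_tsupport _).trans (tsupport_partialD_subset i θ)))
      ((tsupport_partialD_subset i θ).trans hs)
    have h2 := (hv (m + 1) hm).2 θ hθ hc hs
    simp_rw [iteratedFDeriv_succ_const i hθ m] at h2
    rw [h1, pow_succ] at h2
    have h3 : ((-1 : ℂ) ^ m) ≠ 0 := pow_ne_zero _ (by norm_num)
    refine mul_left_cancel₀ h3 (h2.trans ?_)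
    ring

theorem exists_bound_of_eq_zero {R : ℝ} {p : Rd d → ℂ} (hp : Continuous p)
    (h0 : ∀ ξ, R < ‖ξ‖ → p ξ = 0) : ∃ C : ℝ, 0 ≤ C ∧ ∀ ξ, ‖p ξ‖ ≤ C := by
  obtain ⟨C, hC⟩ := (isCompact_closedBall (0 : Rd d) R).exists_bound_of_continuousOn hp.continuousOn
  refine ⟨max C 0, le_max_right _ _, fun ξ => ?_⟩
  by_cases h : R < ‖ξ‖
  · simp [h0 ξ h]
  · exact (hC ξ (by simpa using h)).trans (le_max_left _ _)

theorem partialD_eq_zero {R : ℝ} (i : Fin d) {p : Rd d → ℂ} (h0 : ∀ ξ, R < ‖ξ‖ → p ξ = 0) :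
    ∀ ξ, R < ‖ξ‖ → partialD i p ξ = 0 := by
  intro ξ hξ
  have : p =ᶠ[𝓝 ξ] fun _ => 0 := by
    filter_upwards [(isOpen_lt continuous_const continuous_norm).mem_nhds hξ] with y hy
    exact h0 y hy
  simp [partialD, this.fderiv_eq]

/-- The defining relation of weak derivatives on a ball extends to smooth functions vanishing
outside the closed ball: contracting such a function makes its support compact in the ball. -/
theorem IsWeakDerivChain.integral_partialD_of_eq_zero {R : ℝ} {k : ℕ} {i : Fin d}
    {v : ℕ → Rd d → ℂ} (hv : IsWeakDerivChain R k i v) (hR : 0 < R) {m : ℕ} (hm : m < k)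
    {p : Rd d → ℂ} (hp : ContDiff ℝ ∞ p) (h0 : ∀ ξ, R < ‖ξ‖ → p ξ = 0) :
    ∫ x in Metric.ball 0 R, v m x * partialD i p x = -∫ x in Metric.ball 0 R, v (m + 1) x * p x := by
  set δ : ℕ → ℝ := fun n => 1 + 1 / ((n : ℝ) + 1) with hδ
  have hδ1 : ∀ n, 1 < δ n := fun n => by
    have : 0 < 1 / ((n : ℝ) + 1) := by positivity
    simp only [hδ]; linarith
  have hδ2 : ∀ n, δ n ≤ 2 := fun n => by
    have : 1 / ((n : ℝ) + 1) ≤ 1 := by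
      rw [div_le_one (by positivity)]; linarith [Nat.cast_nonneg (α := ℝ) n]
    simp only [hδ]; linarith
  have hδt : Tendsto δ atTop (𝓝 1) := by
    simpa [hδ] using (tendsto_const_nhds (x := (1 : ℝ))).add
      (tendsto_one_div_add_atTop_nhds_zero_nat (𝕜 := ℝ))
  have hpd : ∀ n x, partialD i (fun y => p (δ n • y)) x = δ n • partialD i p (δ n • x) := by
    intro n x
    have h1 : HasFDerivAt (fun y : Rd d => δ n • y) (δ n • ContinuousLinearMap.id ℝ (Rd d)) x :=
      (hasFDerivAt_id x).const_smul (δ n)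
    have h2 := ((hp.differentiable (by simp)) (δ n • x)).hasFDerivAt.comp x h1
    have h3 : fderiv ℝ (fun y => p (δ n • y)) x = _ := h2.fderiv
    simp [partialD, h3]
  have hrel : ∀ n, ∫ x in Metric.ball 0 R, v m x * (δ n • partialD i p (δ n • x)) =
      -∫ x in Metric.ball 0 R, v (m + 1) x * p (δ n • x) := by
    intro n
    have hts : tsupport (fun y => p (δ n • y)) ⊆ Metric.closedBall 0 (R / δ n) := by
      refine closure_minimal (fun x hx => ?_) Metric.isClosed_closedBall
      rw [mem_closedBall_zero_iff, le_div_iff₀ (by linarith [hδ1 n])]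
      by_contra hlt
      refine hx (h0 _ ?_)
      rw [norm_smul, Real.norm_eq_abs, abs_of_pos (by linarith [hδ1 n]), mul_comm]
      linarith
    have := hv.integral_partialD m hm (fun y => p (δ n • y))
      (hp.comp (contDiff_const_smul (δ n)))
      ((isCompact_closedBall _ _).of_isClosed_subset (isClosed_tsupport _) hts)
      (hts.trans (Metric.closedBall_subset_ball (div_lt_self hR (hδ1 n))))
    simpa only [hpd] using this
  obtain ⟨C1, hC1, hb1⟩ := exists_bound_of_eq_zero (contDiff_partialD i hp).continuous
    (partialD_eq_zero i h0)
  obtain ⟨C2, hC2, hb2⟩ := exists_bound_of_eq_zero hp.continuous h0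
  have hlim : ∀ x : Rd d, Tendsto (fun n => δ n • x) atTop (𝓝 x) := fun x => by
    simpa using hδt.smul_const x
  have t1 : Tendsto (fun n => ∫ x in Metric.ball 0 R, v m x * (δ n • partialD i p (δ n • x))) atTop
      (𝓝 (∫ x in Metric.ball 0 R, v m x * partialD i p x)) := by
    refine tendsto_integral_of_dominated_convergence (fun x => ‖v m x‖ * (2 * C1)) (fun n => ?_)
      ((hv.integrableOn m hm.le).norm.mul_const _) (fun n => ?_) ?_
    · refine (hv.integrableOn m hm.le).aestronglyMeasurable.mul ?_
      exact (((contDiff_partialD i hp).continuous.comp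
        (continuous_const_smul (δ n))).const_smul (δ n)).aestronglyMeasurable
    · refine Eventually.of_forall fun x => ?_
      rw [norm_mul, norm_smul, Real.norm_eq_abs, abs_of_pos (by linarith [hδ1 n])]
      have := hb1 (δ n • x)
      have := hδ2 n
      gcongr
    · refine Eventually.of_forall fun x => tendsto_const_nhds.mul ?_
      have := hδt.smul (((contDiff_partialD i hp).continuous.tendsto x).comp (hlim x))
      simpa using this
  have t2 : Tendsto (fun n => -∫ x in Metric.ball 0 R, v (m + 1) x * p (δ n • x)) atTop
      (𝓝 (-∫ x in Metric.ball 0 R, v (m + 1) x * p x)) := by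
    refine Tendsto.neg ?_
    refine tendsto_integral_of_dominated_convergence (fun x => ‖v (m + 1) x‖ * C2) (fun n => ?_)
      ((hv.integrableOn (m + 1) hm).norm.mul_const _) (fun n => ?_) ?_
    · refine (hv.integrableOn (m + 1) hm).aestronglyMeasurable.mul ?_
      exact (hp.continuous.comp (continuous_const_smul (δ n))).aestronglyMeasurable
    · refine Eventually.of_forall fun x => ?_
      rw [norm_mul]
      have := hb2 (δ n • x)
      gcongr
    · exact Eventually.of_forall fun x =>
        tendsto_const_nhds.mul ((hp.continuous.tendsto x).comp (hlim x))
  simp_rw [hrel] at t1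
  exact tendsto_nhds_unique t1 t2

theorem IsWeakDerivChain.integrableOn_mul {R : ℝ} {k : ℕ} {i : Fin d}
    {v : ℕ → Rd d → ℂ} (hv : IsWeakDerivChain R k i v) {m : ℕ} (hm : m ≤ k)
    {p : Rd d → ℂ} (hp : Continuous p) (h0 : ∀ ξ, R < ‖ξ‖ → p ξ = 0) :
    IntegrableOn (fun ξ => v m ξ * p ξ) (Metric.ball 0 R) volume := by
  obtain ⟨C, -, hC⟩ := exists_bound_of_eq_zero hp h0
  exact (hv.integrableOn m hm).mul_bdd hp.aestronglyMeasurable (Eventually.of_forall hC)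

/-- Integration by parts against a plane wave turns `n` weak derivatives into decay of order `n`
in the `i`-th coordinate. -/
theorem IsWeakDerivChain.exists_coord_pow_mul_le {R : ℝ} {k : ℕ} {i : Fin d}
    {v : ℕ → Rd d → ℂ} (hv : IsWeakDerivChain R k i v) (hR : 0 < R) (n : ℕ) :
    ∀ m, m + n ≤ k → ∀ p : Rd d → ℂ, ContDiff ℝ ∞ p → (∀ ξ, R < ‖ξ‖ → p ξ = 0) →
      ∃ C : ℝ, ∀ x : Rd d,
        |x i| ^ n * ‖∫ ξ in Metric.ball 0 R, v m ξ * p ξ * planeWave x ξ‖ ≤ C := by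
  induction n with
  | zero =>
    intro m hm p hp h0
    refine ⟨∫ ξ in Metric.ball 0 R, ‖v m ξ * p ξ‖, fun x => ?_⟩
    rw [pow_zero, one_mul]
    refine (norm_integral_le_integral_norm _).trans_eq ?_
    simp
  | succ n ih =>
    intro m hm p hp h0
    obtain ⟨C1, h1⟩ := ih (m + 1) (by omega) p hp h0
    obtain ⟨C2, h2⟩ := ih m (by omega) (partialD i p) (contDiff_partialD i hp)
      (partialD_eq_zero i h0)
    refine ⟨C1 + C2, fun x => ?_⟩
    have key := hv.integral_partialD_of_eq_zero hR (m := m) (by omega)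
      (hp.mul (contDiff_planeWave x)) (fun ξ hξ => by simp [h0 ξ hξ])
    have hsplit : ∫ ξ in Metric.ball 0 R, v m ξ * partialD i (fun y => p y * planeWave x y) ξ =
        (∫ ξ in Metric.ball 0 R, v m ξ * partialD i p ξ * planeWave x ξ) +
        Complex.I * (x i : ℂ) * ∫ ξ in Metric.ball 0 R, v m ξ * p ξ * planeWave x ξ := by
      rw [← integral_const_mul, ← integral_add]
      · refine integral_congr_ae (Eventually.of_forall fun ξ => ?_)
        simp only [partialD_mul i hp (contDiff_planeWave x), partialD_planeWave]
        ring
      · have := hv.integrableOn_mul (m := m) (by omega)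
          (p := fun ξ => partialD i p ξ * planeWave x ξ)
          ((contDiff_partialD i hp).continuous.mul (continuous_planeWave x))
          (fun ξ hξ => by simp [partialD_eq_zero i h0 ξ hξ])
        simpa only [mul_assoc, IntegrableOn] using this
      · refine Integrable.const_mul ?_ _
        have := hv.integrableOn_mul (m := m) (by omega)
          (p := fun ξ => p ξ * planeWave x ξ)
          (hp.continuous.mul (continuous_planeWave x))
          (fun ξ hξ => by simp [h0 ξ hξ])
        simpa only [mul_assoc, IntegrableOn] using this
    rw [hsplit] at key
    have hI : ‖Complex.I * (x i : ℂ) * ∫ ξ in Metric.ball 0 R, v m ξ * p ξ * planeWave x ξ‖ =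
        |x i| * ‖∫ ξ in Metric.ball 0 R, v m ξ * p ξ * planeWave x ξ‖ := by
      simp
    calc |x i| ^ (n + 1) * ‖∫ ξ in Metric.ball 0 R, v m ξ * p ξ * planeWave x ξ‖
        = |x i| ^ n * ‖Complex.I * (x i : ℂ) *
            ∫ ξ in Metric.ball 0 R, v m ξ * p ξ * planeWave x ξ‖ := by rw [hI]; ring
      _ = |x i| ^ n * ‖(-∫ ξ in Metric.ball 0 R, v (m + 1) ξ * p ξ * planeWave x ξ) -
            ∫ ξ in Metric.ball 0 R, v m ξ * partialD i p ξ * planeWave x ξ‖ := by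
          congr 2
          simp only [mul_assoc] at key ⊢
          linear_combination key
      _ ≤ |x i| ^ n * (‖∫ ξ in Metric.ball 0 R, v (m + 1) ξ * p ξ * planeWave x ξ‖ +
            ‖∫ ξ in Metric.ball 0 R, v m ξ * partialD i p ξ * planeWave x ξ‖) := by
          gcongr
          refine (norm_sub_le _ _).trans_eq ?_
          rw [norm_neg]
      _ ≤ C1 + C2 := by
          rw [mul_add]
          exact add_le_add (h1 x) (h2 x)

/-- The inverse Fourier transform of `u p` decays of order `k`, if `u` has `k` weak derivatives on
the ball and `p` is smooth and vanishes outside of it. -/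
theorem HasWeakDerivsL2.exists_norm_integral_le_wt {R : ℝ} (hR : 0 < R) (hd : 0 < d) {k : ℕ}
    {u : Rd d → ℂ} (hu : HasWeakDerivsL2 (Metric.ball 0 R) k u) {p : Rd d → ℂ}
    (hp : ContDiff ℝ ∞ p) (h0 : ∀ ξ, R < ‖ξ‖ → p ξ = 0) :
    ∃ C : ℝ, 0 ≤ C ∧
      ∀ x : Rd d, ‖∫ ξ in Metric.ball 0 R, u ξ * p ξ * planeWave x ξ‖ ≤ C * wt k x := by
  set I : Rd d → ℝ := fun x => ‖∫ ξ in Metric.ball 0 R, u ξ * p ξ * planeWave x ξ‖ with hI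
  have hex : ∀ n ≤ k, ∀ i : Fin d, ∃ C : ℝ, ∀ x : Rd d, |x i| ^ n * I x ≤ C := by
    intro n hn i
    obtain ⟨v, rfl, hv⟩ := hu.exists_chain i
    exact hv.exists_coord_pow_mul_le hR n 0 (by omega) p hp h0
  choose C hC using hex
  set i₀ : Fin d := ⟨0, hd⟩
  have hC0 : ∀ n hn i, 0 ≤ C n hn i := fun n hn i =>
    le_trans (mul_nonneg (by positivity) (norm_nonneg _)) (hC n hn i 0)
  refine ⟨(1 + d) ^ k * (C 0 (Nat.zero_le k) i₀ + ∑ i, C k le_rfl i),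
    mul_nonneg (by positivity) (add_nonneg (hC0 _ _ _) (Finset.sum_nonneg fun i _ => hC0 _ _ _)),
    fun x => ?_⟩
  have : Nonempty (Fin d) := ⟨i₀⟩
  obtain ⟨i, -, hi⟩ := Finset.exists_max_image Finset.univ (fun i => |x i|)
    Finset.univ_nonempty
  have hx : ‖x‖ ≤ d * |x i| := by
    calc ‖x‖ ≤ ∑ j, ‖x j‖ := by
          have := norm_sum_le Finset.univ (fun j => x j • EuclideanSpace.single j (1 : ℝ))
          have h2 : ∑ j, x j • EuclideanSpace.single j (1 : ℝ) = x := by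
            ext l; simp [Finset.sum_apply, Pi.single_apply]
          rw [h2] at this
          simpa [norm_smul] using this
      _ ≤ ∑ _j : Fin d, |x i| := Finset.sum_le_sum fun j hj => hi j hj
      _ = d * |x i| := by simp
  have hIx : 0 ≤ I x := norm_nonneg _
  have h1 : (1 + ‖x‖) ^ k ≤ (1 + d) ^ k * (1 + |x i| ^ k) := by
    rcases le_total |x i| 1 with h | h
    · calc (1 + ‖x‖) ^ k ≤ (1 + d) ^ k := by
            gcongr; exact hx.trans (mul_le_of_le_one_right (by positivity) h)
        _ ≤ _ := le_mul_of_one_le_right (by positivity) (by simp)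
    · calc (1 + ‖x‖) ^ k ≤ ((1 + d) * |x i|) ^ k := by
            gcongr; nlinarith
        _ ≤ _ := by rw [mul_pow]; gcongr; linarith
  have h2 := hC 0 (Nat.zero_le k) i₀ x
  have h3 := (hC k le_rfl i x).trans
    (Finset.single_le_sum (f := fun i => C k le_rfl i) (fun i _ => hC0 _ _ _) (Finset.mem_univ i))
  rw [wt, ← div_eq_mul_inv, le_div_iff₀ (by positivity), mul_comm]
  calc (1 + ‖x‖) ^ k * I x ≤ (1 + d) ^ k * (1 + |x i| ^ k) * I x := by gcongr
    _ = (1 + d) ^ k * (|x i₀| ^ 0 * I x + |x i| ^ k * I x) := by ring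
    _ ≤ _ := by gcongr

end WeakDerivatives

/-! ### Fourier inversion and the sampling error -/

section Sampling

variable {d : ℕ}

theorem contDiff_hat (ψ : 𝓢(Rd d, ℂ)) : ContDiff ℝ ∞ (hat ψ) := by
  have : hat ψ = fun ξ => (FourierTransform.fourier ψ) ((2 * Real.pi)⁻¹ • ξ) := by
    funext ξ
    rw [hat_eq_fourier, SchwartzMap.fourier_coe]
  rw [this]
  exact ((FourierTransform.fourier ψ).smooth _).comp (contDiff_const_smul _)

/-- Fourier inversion for a band-limited Schwartz function. -/
theorem eq_integral_hat_mul_planeWave {R : ℝ} (hR : 0 < R) (ψ : 𝓢(Rd d, ℂ))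
    (hψ : ∀ ξ, R < ‖ξ‖ → hat ψ ξ = 0) (x : Rd d) :
    ψ x = (((2 * Real.pi) ^ d)⁻¹ : ℝ) * ∫ ξ in Metric.ball 0 R, hat ψ ξ * planeWave x ξ := by
  have h1 : ∫ ξ in Metric.ball 0 R, hat ψ ξ * planeWave x ξ = ∫ ξ, hat ψ ξ * planeWave x ξ := by
    refine setIntegral_eq_integral_of_ae_compl_eq_zero ?_
    have : ∀ᵐ ξ : Rd d ∂volume, ξ ∉ Metric.sphere (0 : Rd d) R :=
      measure_eq_zero_iff_ae_notMem.1 (Measure.addHaar_sphere_of_ne_zero volume 0 hR.ne')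
    filter_upwards [this] with ξ hξ hb
    rw [hψ ξ, zero_mul]
    rw [mem_ball_zero_iff, not_lt] at hb
    exact lt_of_le_of_ne hb fun h => hξ (by simpa using h.symm)
  have h2 : ψ x = ∫ v, Complex.exp (((2 * Real.pi * inner ℝ v x : ℝ) : ℂ) * Complex.I) *
      FourierTransform.fourier ψ v := by
    have h : FourierTransformInv.fourierInv (FourierTransform.fourier ψ) = ψ :=
      FourierTransform.fourierInv_fourier_eq ψ
    conv_lhs => rw [← h]
    rw [SchwartzMap.fourierInv_coe, Real.fourierInv_eq']
    simp only [smul_eq_mul]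
  have h3 : ∫ ξ, hat ψ ξ * planeWave x ξ =
      ∫ ξ, (fun v => Complex.exp (((2 * Real.pi * inner ℝ v x : ℝ) : ℂ) * Complex.I) *
      FourierTransform.fourier ψ v) ((2 * Real.pi)⁻¹ • ξ) := by
    refine integral_congr_ae (Eventually.of_forall fun ξ => ?_)
    simp only
    rw [hat_eq_fourier, SchwartzMap.fourier_coe, planeWave, mul_comm]
    congr 2
    rw [inner_smul_left, real_inner_comm, mul_comm]
    congr 2
    simp
    field_simp
  rw [h1, h3, Measure.integral_comp_smul volume
    (fun v => Complex.exp (((2 * Real.pi * inner ℝ v x : ℝ) : ℂ) * Complex.I) *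
      FourierTransform.fourier ψ v), ← h2]
  have hp : (0 : ℝ) < 2 * Real.pi := by positivity
  simp only [finrank_euclideanSpace, Fintype.card_fin, inv_pow, inv_inv]
  rw [abs_of_pos (by positivity), Complex.real_smul, ← mul_assoc, ← Complex.ofReal_mul,
    inv_mul_cancel₀ (by positivity), Complex.ofReal_one, one_mul]

theorem summable_wt_add_smul {m : ℕ} (hm : d < m) {h : ℝ} (h0 : 0 < h) (h1 : h ≤ 1) (x : Rd d) :
    Summable fun j : Fin d → ℤ => wt m (x + h • latticePt j) := by
  obtain ⟨K, -, hK⟩ := exists_tsum_wt_le d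
  have := ENNReal.summable_toReal (ne_top_of_le_ne_top ENNReal.ofReal_ne_top (hK h h0 h1 (-x)))
  refine Summable.of_nonneg_of_le (fun j => wt_nonneg _ _) (fun j => ?_) this
  rw [ENNReal.toReal_ofReal (wt_nonneg _ _), ← wt_neg (d + 1), neg_sub, sub_neg_eq_add, add_comm x]
  exact wt_anti hm _

theorem exists_tsum_wt_smul_le (d : ℕ) : ∃ K : ℝ, 0 < K ∧ ∀ h : ℝ, 0 < h → h ≤ 1 →
    h ^ d * ∑' j : Fin d → ℤ, wt (d + 1) (h • latticePt j) ≤ K := by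
  obtain ⟨K, K0, hK⟩ := exists_tsum_wt_le d
  refine ⟨K, K0, fun h h0 h1 => ?_⟩
  have hs := summable_wt_add_smul (Nat.lt_succ_self d) h0 h1 (0 : Rd d)
  have h2 := hK h h0 h1 0
  simp only [zero_sub, wt_neg, zero_add] at h2 hs
  rw [← ENNReal.ofReal_tsum_of_nonneg (fun j => wt_nonneg _ _) hs] at h2
  have h3 := (ENNReal.ofReal_le_ofReal_iff (by positivity)).1 h2
  calc _ ≤ h ^ d * (K * (h ^ d)⁻¹) := by gcongr
    _ = K := by field_simp

theorem summable_norm_add_smul {φ : Rd d → ℂ} {C : ℝ} {k : ℕ} (hk : d < k)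
    (hφ : ∀ x, ‖φ x‖ ≤ C * wt k x) {h : ℝ} (h0 : 0 < h) (h1 : h ≤ 1) (x : Rd d) :
    Summable fun j : Fin d → ℤ => ‖φ (x + h • latticePt j)‖ :=
  Summable.of_nonneg_of_le (fun _ => norm_nonneg _) (fun _ => hφ _)
    ((summable_wt_add_smul hk h0 h1 x).mul_left C)

/-- Poisson summation for the modulated samples of `φ` on the grid `x + h ℤ^d`. -/
theorem tsum_samples_eq_tsum_hat {φ : Rd d → ℂ} (hc : Continuous φ) {C : ℝ} {k : ℕ} (hk : d < k)
    (hφ : ∀ x, ‖φ x‖ ≤ C * wt k x) {h : ℝ} (h0 : 0 < h) (x ξ : Rd d)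
    (hs : Summable fun m : Fin d → ℤ => hat φ (ξ + (2 * Real.pi / h) • latticePt m) *
      planeWave x (ξ + (2 * Real.pi / h) • latticePt m)) :
    (h ^ d : ℝ) * ∑' j : Fin d → ℤ, φ (x + h • latticePt j) * planeWave (-(h • latticePt j)) ξ =
      ∑' m : Fin d → ℤ, hat φ (ξ + (2 * Real.pi / h) • latticePt m) *
        planeWave x (ξ + (2 * Real.pi / h) • latticePt m) := by
  have hC : 0 ≤ C := by
    have := (norm_nonneg _).trans (hφ 0)
    nlinarith [wt_pos k (0 : Rd d)]
  set G : Rd d → ℂ := fun y => φ (x + h • y) * planeWave (-(h • y)) ξ with hG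
  have hGc : Continuous G := by
    have : G = fun y => φ (x + h • y) * planeWave ξ (-(h • y)) := by
      funext y; rw [hG, planeWave_comm ξ]
    rw [this]
    exact (hc.comp (by fun_prop)).mul ((continuous_planeWave ξ).comp (by fun_prop))
  have hGb : ∀ y, ‖G y‖ ≤ (C * ((1 + ‖x‖) ^ k * (1 + h⁻¹) ^ k)) * wt k y := by
    intro y
    simp only [hG, norm_mul, norm_planeWave, mul_one]
    refine (hφ _).trans ?_
    rw [mul_assoc, mul_assoc]
    refine mul_le_mul_of_nonneg_left ?_ hC
    calc wt k (x + h • y) ≤ (1 + ‖x‖) ^ k * wt k (h • y) := by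
          simpa using wt_le_mul_wt k (x + h • y) (h • y)
      _ ≤ (1 + ‖x‖) ^ k * ((1 + h⁻¹) ^ k * wt k y) := by
          gcongr
          rw [wt, wt, ← div_eq_mul_inv, le_div_iff₀ (by positivity), inv_mul_le_iff₀ (by positivity),
            ← mul_pow]
          gcongr
          rw [norm_smul, Real.norm_eq_abs, abs_of_pos h0]
          have : h * h⁻¹ = 1 := mul_inv_cancel₀ h0.ne'
          have : 0 ≤ h * ‖y‖ := by positivity
          have : 0 < h⁻¹ := by positivity
          nlinarith
  have hF : ∀ m : Fin d → ℤ, (h ^ d : ℝ) * FourierTransform.fourier G (latticePt m) =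
      hat φ (ξ + (2 * Real.pi / h) • latticePt m) *
        planeWave x (ξ + (2 * Real.pi / h) • latticePt m) := by
    intro m
    set ζ : Rd d := ξ + (2 * Real.pi / h) • latticePt m with hζ
    set F : Rd d → ℂ := fun z => planeWave (-ζ) z * φ z * planeWave x ζ with hFd
    have e1 : FourierTransform.fourier G (latticePt m) = ∫ y, F (x + h • y) := by
      rw [Real.fourier_eq']
      refine integral_congr_ae (Eventually.of_forall fun y => ?_)
      simp only [hG, hFd, smul_eq_mul]
      have : Complex.exp (((-2 * Real.pi * inner ℝ y (latticePt m) : ℝ) : ℂ) * Complex.I) *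
          planeWave (-(h • y)) ξ = planeWave (-ζ) (x + h • y) * planeWave x ζ := by
        simp only [planeWave, ← Complex.exp_add, hζ]
        congr 1
        simp only [inner_add_right, inner_neg_left, inner_neg_right, inner_smul_left,
          inner_smul_right, real_inner_comm x, real_inner_comm y]
        have hh : (h : ℂ) ≠ 0 := by exact_mod_cast h0.ne'
        push_cast
        simp
        field_simp
        ring
      linear_combination φ (x + h • y) * this
    have e2 : ∫ y, F (x + h • y) = ((h ^ d)⁻¹ : ℝ) * ∫ z, F z := by
      rw [Measure.integral_comp_smul volume (fun y => F (x + y)) h, integral_add_left_eq_self F x]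
      simp only [finrank_euclideanSpace, Fintype.card_fin]
      rw [abs_of_pos (by positivity), Complex.real_smul]
    rw [e1, e2, ← mul_assoc, ← Complex.ofReal_mul, mul_inv_cancel₀ (by positivity),
      Complex.ofReal_one, one_mul, hFd, integral_mul_const, hat_eq]
  have hsF : Summable fun m : Fin d → ℤ => FourierTransform.fourier G (latticePt m) := by
    have h2 := hs.mul_left ((h ^ d : ℝ) : ℂ)⁻¹
    refine h2.congr fun m => ?_
    have : ((h ^ d : ℝ) : ℂ) ≠ 0 := by exact_mod_cast (pow_pos h0 d).ne'
    rw [← hF m, inv_mul_cancel_left₀ this]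
  rw [tsum_congr fun m => (hF m).symm, tsum_mul_left,
    ← tsum_latticePt_eq_tsum_fourier hGc hk hGb hsF]

/-- The sampled version of the convolution identity `ψ = φ * σ`: each `σ`-value is the weight of a
shift of `φ` along the grid `h ℤ^d`. -/
noncomputable def sampled (φ σ : Rd d → ℂ) (h : ℝ) (x : Rd d) : ℂ :=
  (((2 * Real.pi) ^ d)⁻¹ * h ^ d : ℝ) *
    ∑' j : Fin d → ℤ, σ (-(h • latticePt j)) * φ (x + h • latticePt j)

/-- The inverse Fourier transform (up to a constant) of `hat ψ / hat φ`, restricted to the ball. -/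
noncomputable def deconv (R : ℝ) (φ ψ : Rd d → ℂ) (y : Rd d) : ℂ :=
  ∫ ξ in Metric.ball 0 R, 1 / hat φ ξ * hat ψ ξ * planeWave y ξ

/-- The uniform error of `sampled` is controlled by the sum of quotients `ratioSum`: by Poisson
summation the error consists of the aliasing terms. -/
theorem norm_sub_sampled_le {R : ℝ} (hR : 0 < R) {φ : Rd d → ℂ} (hc : Continuous φ) {C : ℝ} {k : ℕ}
    (hk : d < k) (hφ : ∀ x, ‖φ x‖ ≤ C * wt k x)
    (hne : ∀ᵐ ξ ∂(volume.restrict (Metric.ball (0 : Rd d) R)), hat φ ξ ≠ 0)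
    (hint : IntegrableOn (fun ξ => 1 / hat φ ξ) (Metric.ball 0 R) volume)
    (ψ : 𝓢(Rd d, ℂ)) (hψ : ∀ ξ, R < ‖ξ‖ → hat ψ ξ = 0) {h : ℝ} (h0 : 0 < h) (h1 : h ≤ 1)
    {ρ : ℝ} (hρ0 : 0 ≤ ρ) (hρ : ratioSum R φ h ≤ ENNReal.ofReal ρ) (x : Rd d) :
    ‖ψ x - sampled φ (deconv R φ ψ) h x‖ ≤
      ((2 * Real.pi) ^ d)⁻¹ * (∫ ξ in Metric.ball 0 R, ‖hat ψ ξ‖) * ρ := by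
  set B : Set (Rd d) := Metric.ball 0 R with hB
  set c : ℝ := ((2 * Real.pi) ^ d)⁻¹ with hcdef
  have hc0 : 0 ≤ c := by positivity
  set u : Rd d → ℂ := fun ξ => 1 / hat φ ξ with hu
  have hψc : Continuous (hat ψ) := (contDiff_hat ψ).continuous
  obtain ⟨Cψ, -, hCψ⟩ := exists_bound_of_eq_zero hψc hψ
  have hη : IntegrableOn (fun ξ => u ξ * hat ψ ξ) B volume :=
    hint.mul_bdd hψc.aestronglyMeasurable (Eventually.of_forall hCψ)
  have hψi : IntegrableOn (fun ξ => hat ψ ξ) B volume :=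
    (hψc.continuousOn.integrableOn_compact (isCompact_closedBall 0 R)).mono_set
      Metric.ball_subset_closedBall
  -- Exchange the sum over the samples with the integral defining the weights.
  have hsw : ∑' j : Fin d → ℤ, deconv R φ ψ (-(h • latticePt j)) * φ (x + h • latticePt j) =
      ∫ ξ in B, ∑' j : Fin d → ℤ,
        u ξ * hat ψ ξ * (φ (x + h • latticePt j) * planeWave (-(h • latticePt j)) ξ) := by
    have e : ∀ j : Fin d → ℤ, deconv R φ ψ (-(h • latticePt j)) * φ (x + h • latticePt j) =
        ∫ ξ in B, u ξ * hat ψ ξ * (φ (x + h • latticePt j) * planeWave (-(h • latticePt j)) ξ) := by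
      intro j
      rw [deconv, ← integral_mul_const]
      refine integral_congr_ae (Eventually.of_forall fun ξ => ?_)
      simp only [hu]
      ring
    rw [tsum_congr e]
    refine integral_tsum_of_summable_integral_norm (fun j => ?_) ?_
    · refine hη.mul_bdd (c := ‖φ (x + h • latticePt j)‖) ?_ (Eventually.of_forall fun ξ => ?_)
      · exact (continuous_const.mul (continuous_planeWave _)).aestronglyMeasurable
      · simp
    · have := (summable_norm_add_smul hk hφ h0 h1 x).mul_left (∫ ξ in B, ‖u ξ * hat ψ ξ‖)
      refine this.congr fun j => ?_
      rw [← integral_mul_const]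
      refine integral_congr_ae (Eventually.of_forall fun ξ => ?_)
      simp
  have hT : sampled φ (deconv R φ ψ) h x = c * ∫ ξ in B, u ξ * hat ψ ξ * ((h ^ d : ℝ) *
      ∑' j : Fin d → ℤ, φ (x + h • latticePt j) * planeWave (-(h • latticePt j)) ξ) := by
    rw [sampled, hsw, Complex.ofReal_mul, mul_assoc, ← integral_const_mul]
    congr 2
    funext ξ
    rw [tsum_mul_left]
    ring
  -- For almost every frequency the difference of the integrands is a sum of aliasing terms.
  have hae : ∀ᵐ ξ ∂(volume.restrict B), ‖hat ψ ξ * planeWave x ξ - u ξ * hat ψ ξ * ((h ^ d : ℝ) *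
      ∑' j : Fin d → ℤ, φ (x + h • latticePt j) * planeWave (-(h • latticePt j)) ξ)‖ ≤
      ‖hat ψ ξ‖ * ρ := by
    have hall : ∀ᵐ ξ ∂(volume.restrict B), ∀ j : {j : Fin d → ℤ // j ≠ 0},
        ‖hat φ (ξ + (2 * Real.pi / h) • latticePt j.1) / hat φ ξ‖ₑ ≤
          eLpNorm (fun ξ => hat φ (ξ + (2 * Real.pi / h) • latticePt j.1) / hat φ ξ) ∞
            (volume.restrict B) :=
      ae_all_iff.2 fun j => ae_le_eLpNormEssSup
    filter_upwards [hne, hall] with ξ hξ hj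
    set a : (Fin d → ℤ) → ℂ := fun m => hat φ (ξ + (2 * Real.pi / h) • latticePt m) *
      planeWave x (ξ + (2 * Real.pi / h) • latticePt m) with ha
    have hq : ∑' j : {j : Fin d → ℤ // j ≠ 0}, ‖a j.1 / hat φ ξ‖ₑ ≤ ENNReal.ofReal ρ := by
      refine (ENNReal.tsum_le_tsum fun j => ?_).trans hρ
      refine le_trans (le_of_eq ?_) (hj j)
      rw [← ofReal_norm, ← ofReal_norm, ha]
      simp
    have hsq : Summable fun j : {j : Fin d → ℤ // j ≠ 0} => ‖a j.1 / hat φ ξ‖ := by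
      have := ENNReal.summable_toReal (ne_top_of_le_ne_top ENNReal.ofReal_ne_top hq)
      simpa using this
    have hsa' : Summable fun j : {j : Fin d → ℤ // j ≠ 0} => a j.1 := by
      have := hsq.of_norm.mul_left (hat φ ξ)
      refine this.congr fun j => ?_
      field_simp
    have hsa : Summable a := by
      have h := (Set.finite_singleton (0 : Fin d → ℤ)).summable_compl_iff (f := a)
      exact h.1 hsa'
    have hsplit : ∑' m, a m = a 0 + ∑' j : {j : Fin d → ℤ // j ≠ 0}, a j.1 := by
      rw [← hsa.tsum_subtype_add_tsum_subtype_compl {0}]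
      congr 1
      exact tsum_singleton 0 a
    rw [tsum_samples_eq_tsum_hat hc hk hφ h0 x ξ hsa, hsplit]
    have ha0 : a 0 = hat φ ξ * planeWave x ξ := by simp [ha, latticePt_zero]
    have hdiff : hat ψ ξ * planeWave x ξ - u ξ * hat ψ ξ *
        (a 0 + ∑' j : {j : Fin d → ℤ // j ≠ 0}, a j.1) =
        -(hat ψ ξ * ∑' j : {j : Fin d → ℤ // j ≠ 0}, a j.1 / hat φ ξ) := by
      rw [tsum_div_const, ha0, hu]
      field_simp
      ring
    rw [hdiff, norm_neg, norm_mul]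
    refine mul_le_mul_of_nonneg_left ?_ (norm_nonneg _)
    refine (norm_tsum_le_tsum_norm hsq).trans ?_
    rw [← ENNReal.ofReal_le_ofReal_iff hρ0,
      ENNReal.ofReal_tsum_of_nonneg (fun _ => norm_nonneg _) hsq]
    simpa only [ofReal_norm] using hq
  have hint2 : IntegrableOn (fun ξ => u ξ * hat ψ ξ * ((h ^ d : ℝ) *
      ∑' j : Fin d → ℤ, φ (x + h • latticePt j) * planeWave (-(h • latticePt j)) ξ)) B volume := by
    refine hη.mul_bdd (c := h ^ d * ∑' j : Fin d → ℤ, ‖φ (x + h • latticePt j)‖) ?_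
      (Eventually.of_forall fun ξ => ?_)
    · refine Continuous.aestronglyMeasurable (continuous_const.mul ?_)
      exact continuous_tsum (fun j => continuous_const.mul (continuous_planeWave _))
        (summable_norm_add_smul hk hφ h0 h1 x) (fun j ξ => by simp)
    · rw [norm_mul, Complex.norm_real, Real.norm_of_nonneg (by positivity)]
      refine mul_le_mul_of_nonneg_left ?_ (by positivity)
      refine (norm_tsum_le_tsum_norm ?_).trans_eq (tsum_congr fun j => by simp)
      simpa using summable_norm_add_smul hk hφ h0 h1 x
  have hint1 : IntegrableOn (fun ξ => hat ψ ξ * planeWave x ξ) B volume :=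
    hψi.mul_bdd (c := 1) (continuous_planeWave x).aestronglyMeasurable
      (Eventually.of_forall fun ξ => by simp)
  rw [hT, eq_integral_hat_mul_planeWave hR ψ hψ x, ← mul_sub, ← integral_sub hint1 hint2, norm_mul,
    Complex.norm_real, Real.norm_of_nonneg hc0, mul_assoc, ← integral_mul_const]
  exact mul_le_mul_of_nonneg_left
    (norm_integral_le_of_norm_le (hψi.norm.mul_const _) hae) hc0

end Sampling

/-! ### Truncation of the sampled sums -/

section Truncation

variable {d : ℕ}

/-- The lattice points with all coordinates in `[-M, M]`. -/
noncomputable def latticeBox (d M : ℕ) : Finset (Fin d → ℤ) :=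
  Fintype.piFinset fun _ => Finset.Icc (-(M : ℤ)) M

theorem card_latticeBox (d M : ℕ) : (latticeBox d M).card = (2 * M + 1) ^ d := by
  rw [latticeBox, Fintype.card_piFinset]
  simp only [Int.card_Icc, Finset.prod_const, Finset.card_univ, Fintype.card_fin]
  congr 1
  omega

theorem le_norm_latticePt {M : ℕ} {j : Fin d → ℤ} (hj : j ∉ latticeBox d M) :
    (M : ℝ) ≤ ‖latticePt j‖ := by
  simp only [latticeBox, Fintype.mem_piFinset, Finset.mem_Icc, not_forall] at hj
  obtain ⟨i, hi⟩ := hj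
  have h1 : (M : ℤ) ≤ |j i| := by
    rw [le_abs']
    omega
  calc (M : ℝ) ≤ |(j i : ℝ)| := by exact_mod_cast h1
    _ = ‖latticePt j i‖ := by rw [latticePt_apply, Real.norm_eq_abs]
    _ ≤ ‖latticePt j‖ := PiLp.norm_apply_le _ i

/-- The part of `sampled` with nodes in a box. -/
noncomputable def sampledBox (φ σ : Rd d → ℂ) (h : ℝ) (M : ℕ) (x : Rd d) : ℂ :=
  (((2 * Real.pi) ^ d)⁻¹ * h ^ d : ℝ) *
    ∑ j ∈ latticeBox d M, σ (-(h • latticePt j)) * φ (x + h • latticePt j)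

/-- If the weights `σ` and the kernel `φ` both decay fast, the order of decay can be shared between
the summation variable, the variable `x` and the truncation. -/
theorem norm_mul_le_of_decay {φ σ : Rd d → ℂ} {Cφ Cσ : ℝ} {a b c k : ℕ} (hk : a + b + c ≤ k)
    (hφ : ∀ x, ‖φ x‖ ≤ Cφ * wt k x) (hσ : ∀ x, ‖σ x‖ ≤ Cσ * wt k x) (x y : Rd d) :
    ‖σ (-y) * φ (x + y)‖ ≤ Cσ * Cφ * (wt a y * (wt b x * wt c y)) := by
  have hφ0 : 0 ≤ Cφ := by
    have := (norm_nonneg _).trans (hφ 0)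
    nlinarith [wt_pos k (0 : Rd d)]
  have hσ0 : 0 ≤ Cσ := by
    have := (norm_nonneg _).trans (hσ 0)
    nlinarith [wt_pos k (0 : Rd d)]
  have h1 : wt k (-y) * wt k (x + y) ≤ wt a y * (wt b x * wt c y) := by
    calc wt k (-y) * wt k (x + y) ≤ wt (a + b + c) (-y) * wt b (x + y) :=
          mul_le_mul (wt_anti hk _) (wt_anti (by omega) _) (wt_nonneg _ _) (wt_nonneg _ _)
      _ = wt a y * ((wt b (x + y) * wt b (-y)) * wt c y) := by
          rw [← wt_mul_wt, ← wt_mul_wt, wt_neg, wt_neg, wt_neg]; ring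
      _ ≤ wt a y * (wt b x * wt c y) := by
          have := wt_mul_wt_le b (x + y) (-y)
          rw [add_neg_cancel_right] at this
          have h2 := wt_nonneg a y
          have h3 := wt_nonneg c y
          gcongr
  rw [norm_mul]
  calc ‖σ (-y)‖ * ‖φ (x + y)‖ ≤ (Cσ * wt k (-y)) * (Cφ * wt k (x + y)) :=
        mul_le_mul (hσ _) (hφ _) (norm_nonneg _) (mul_nonneg hσ0 (wt_nonneg _ _))
    _ = Cσ * Cφ * (wt k (-y) * wt k (x + y)) := by ring
    _ ≤ _ := by gcongr

/-- Decay of `sampled`, and decay of its truncation error in `x` and in the size `h M` of the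
box, uniformly in the mesh size `h ≤ 1`. -/
theorem exists_sampled_bounds {φ σ : Rd d → ℂ} {Cφ Cσ : ℝ} {b c k : ℕ} (hk : d + 1 + b + c ≤ k)
    (hφ : ∀ x, ‖φ x‖ ≤ Cφ * wt k x) (hσ : ∀ x, ‖σ x‖ ≤ Cσ * wt k x) :
    ∃ K : ℝ, 0 ≤ K ∧ ∀ h : ℝ, 0 < h → h ≤ 1 → ∀ x : Rd d,
      ‖sampled φ σ h x‖ ≤ K * wt b x ∧
      ∀ M : ℕ, 0 < M →
        ‖sampled φ σ h x - sampledBox φ σ h M x‖ ≤ K * ((h * M) ^ c)⁻¹ * wt b x := by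
  have hφ0 : 0 ≤ Cφ := by
    have := (norm_nonneg _).trans (hφ 0)
    nlinarith [wt_pos k (0 : Rd d)]
  have hσ0 : 0 ≤ Cσ := by
    have := (norm_nonneg _).trans (hσ 0)
    nlinarith [wt_pos k (0 : Rd d)]
  obtain ⟨K₀, K₀pos, hK₀⟩ := exists_tsum_wt_smul_le d
  refine ⟨((2 * Real.pi) ^ d)⁻¹ * (Cσ * Cφ) * K₀, by positivity, fun h h0 h1 x => ?_⟩
  set F : (Fin d → ℤ) → ℂ := fun j => σ (-(h • latticePt j)) * φ (x + h • latticePt j) with hF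
  have hsw : Summable fun j : Fin d → ℤ => wt (d + 1) (h • latticePt j) := by
    simpa using summable_wt_add_smul (Nat.lt_succ_self d) h0 h1 (0 : Rd d)
  have hb := hK₀ h h0 h1
  have hFle : ∀ j, ‖F j‖ ≤ Cσ * Cφ * (wt (d + 1) (h • latticePt j) *
      (wt b x * wt c (h • latticePt j))) := fun j => norm_mul_le_of_decay hk hφ hσ x _
  have hFle' : ∀ j, ‖F j‖ ≤ Cσ * Cφ * wt b x * wt (d + 1) (h • latticePt j) := fun j => by
    refine (hFle j).trans ?_
    calc _ ≤ Cσ * Cφ * (wt (d + 1) (h • latticePt j) * (wt b x * 1)) := by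
          have := wt_le_one c (h • latticePt j)
          have := wt_nonneg b x
          have := wt_nonneg (d + 1) (h • latticePt j)
          gcongr
      _ = _ := by ring
  have hFs : Summable F := (Summable.of_nonneg_of_le (fun _ => norm_nonneg _) hFle'
    (hsw.mul_left _)).of_norm
  -- A sum of terms dominated by multiples of the weight.
  have key : ∀ (G : (Fin d → ℤ) → ℂ) (T : ℝ), 0 ≤ T →
      (∀ j, ‖G j‖ ≤ Cσ * Cφ * T * wt (d + 1) (h • latticePt j)) →
      ‖((((2 * Real.pi) ^ d)⁻¹ * h ^ d : ℝ) : ℂ) * ∑' j, G j‖ ≤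
        ((2 * Real.pi) ^ d)⁻¹ * (Cσ * Cφ) * K₀ * T := by
    intro G T hT hG
    have hGs : Summable fun j => ‖G j‖ :=
      Summable.of_nonneg_of_le (fun _ => norm_nonneg _) hG (hsw.mul_left _)
    rw [norm_mul, Complex.norm_real, Real.norm_of_nonneg (by positivity)]
    calc _ ≤ ((2 * Real.pi) ^ d)⁻¹ * h ^ d *
          (Cσ * Cφ * T * ∑' j : Fin d → ℤ, wt (d + 1) (h • latticePt j)) := by
          refine mul_le_mul_of_nonneg_left ?_ (by positivity)
          rw [← tsum_mul_left]
          exact (norm_tsum_le_tsum_norm hGs).trans (hGs.tsum_le_tsum hG (hsw.mul_left _))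
      _ = ((2 * Real.pi) ^ d)⁻¹ * (Cσ * Cφ) * T *
          (h ^ d * ∑' j : Fin d → ℤ, wt (d + 1) (h • latticePt j)) := by ring
      _ ≤ ((2 * Real.pi) ^ d)⁻¹ * (Cσ * Cφ) * T * K₀ := by gcongr
      _ = _ := by ring
  refine ⟨key F (wt b x) (wt_nonneg _ _) hFle', fun M hM => ?_⟩
  have hdiff : sampled φ σ h x - sampledBox φ σ h M x =
      (((2 * Real.pi) ^ d)⁻¹ * h ^ d : ℝ) *
        ∑' j, if j ∈ latticeBox d M then 0 else F j := by
    rw [sampled, sampledBox, ← mul_sub]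
    congr 1
    rw [sub_eq_iff_eq_add', ← hFs.sum_add_tsum_compl (s := latticeBox d M)]
    congr 1
    rw [tsum_subtype (((latticeBox d M : Finset (Fin d → ℤ)) : Set (Fin d → ℤ))ᶜ) F]
    refine tsum_congr fun j => ?_
    by_cases hj : j ∈ latticeBox d M <;> simp [hj]
  rw [hdiff]
  have hhM : 0 < h * M := by positivity
  refine (key _ (((h * M) ^ c)⁻¹ * wt b x) (mul_nonneg (by positivity) (wt_nonneg _ _))
    fun j => ?_).trans_eq (by ring)
  by_cases hj : j ∈ latticeBox d M
  · simp only [hj, if_true, norm_zero]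
    have := wt_nonneg b x
    have := wt_nonneg (d + 1) (h • latticePt j)
    positivity
  · simp only [hj, if_false]
    refine (hFle j).trans ?_
    have hc : wt c (h • latticePt j) ≤ ((h * M) ^ c)⁻¹ := by
      unfold wt
      refine inv_anti₀ (by positivity) (pow_le_pow_left₀ hhM.le ?_ c)
      rw [norm_smul, Real.norm_eq_abs, abs_of_pos h0]
      have := mul_le_mul_of_nonneg_left (le_norm_latticePt hj) h0.le
      linarith
    calc _ ≤ Cσ * Cφ * (wt (d + 1) (h • latticePt j) * (wt b x * ((h * M) ^ c)⁻¹)) := by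
          have := wt_nonneg b x
          have := wt_nonneg (d + 1) (h • latticePt j)
          gcongr
      _ = _ := by ring

theorem exists_norm_le_wt_of_isBigO {E : Type*} [NormedAddCommGroup E] {φ : Rd d → E}
    (hc : Continuous φ) {k : ℕ}
    (hO : φ =O[Bornology.cobounded (Rd d)] fun x => (‖x‖ ^ k)⁻¹) :
    ∃ C : ℝ, 0 ≤ C ∧ ∀ x, ‖φ x‖ ≤ C * wt k x := by
  obtain ⟨c, hc0, hcb⟩ := hO.exists_pos
  rw [Asymptotics.isBigOWith_iff] at hcb
  obtain ⟨r, hr⟩ := (Metric.hasBasis_cobounded_compl_closedBall (0 : Rd d)).eventually_iff.1 hcb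
  obtain ⟨M, hM⟩ := (isCompact_closedBall (0 : Rd d) (max r 1)).exists_bound_of_continuousOn
    hc.continuousOn
  set r' := max r 1 with hr'
  refine ⟨max M 0 * (1 + r') ^ k + c * 2 ^ k, by positivity, fun x => ?_⟩
  by_cases hx : ‖x‖ ≤ r'
  · have h1 := hM x (by simpa using hx)
    have h2 : 1 ≤ (1 + r') ^ k * wt k x := by
      rw [wt, ← div_eq_mul_inv, one_le_div (by positivity)]
      gcongr
    calc ‖φ x‖ ≤ max M 0 * 1 := by rw [mul_one]; exact h1.trans (le_max_left _ _)
      _ ≤ max M 0 * ((1 + r') ^ k * wt k x) := by gcongr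
      _ ≤ _ := by
        have := wt_nonneg k x
        rw [add_mul, mul_assoc]
        exact le_add_of_nonneg_right (by positivity)
  · push Not at hx
    have hx1 : 1 < ‖x‖ := (le_max_right _ _).trans_lt hx
    have h1 := hr.2 (x := x) (by simpa using (le_max_left _ _).trans_lt hx)
    have h2 : (‖x‖ ^ k)⁻¹ ≤ 2 ^ k * wt k x := by
      rw [wt, ← div_eq_mul_inv, le_div_iff₀ (by positivity), inv_mul_le_iff₀ (by positivity),
        ← mul_pow]
      gcongr
      linarith
    rw [norm_inv, norm_pow, norm_norm] at h1
    calc ‖φ x‖ ≤ c * (‖x‖ ^ k)⁻¹ := h1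
      _ ≤ c * (2 ^ k * wt k x) := by gcongr
      _ ≤ _ := by
        have := wt_nonneg k x
        rw [add_mul, ← mul_assoc]
        exact le_add_of_nonneg_left (by positivity)

theorem exists_schwartz_le_wt {E : Type*} [NormedAddCommGroup E] [NormedSpace ℝ E]
    (ψ : 𝓢(Rd d, E)) (k : ℕ) :
    ∃ C : ℝ, 0 ≤ C ∧ ∀ x, ‖ψ x‖ ≤ C * wt k x := by
  refine exists_norm_le_wt_of_isBigO ψ.continuous ?_
  have := ψ.isBigO_cocompact_zpow_neg_nat k
  rw [← Metric.cobounded_eq_cocompact] at this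
  simpa using this

end Truncation

/-! ### Algebra of the spaces `Φ_N` -/

section PhiAlgebra

variable {d : ℕ} {A : Set ℝ} {φ : ℝ → Rd d → ℂ}

theorem zero_mem_Phi (hA : A.Nonempty) (N : ℕ) : (fun _ => 0) ∈ Phi A φ N := by
  obtain ⟨α, hα⟩ := hA
  exact ⟨fun _ => 0, fun _ => α, fun _ => 0, fun _ => hα, by simp⟩

theorem add_mem_Phi {M N : ℕ} {f g : Rd d → ℂ} (hf : f ∈ Phi A φ M) (hg : g ∈ Phi A φ N) :
    (fun x => f x + g x) ∈ Phi A φ (M + N) := by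
  obtain ⟨a, α, y, hα, rfl⟩ := hf
  obtain ⟨b, β, z, hβ, rfl⟩ := hg
  refine ⟨Fin.append a b, Fin.append α β, Fin.append y z, fun j => ?_, ?_⟩
  · refine Fin.addCases (fun i => ?_) (fun i => ?_) j
    · simpa using hα i
    · simpa using hβ i
  · funext x
    simp [Fin.sum_univ_add]

theorem const_mul_mem_Phi {N : ℕ} {f : Rd d → ℂ} (hf : f ∈ Phi A φ N) (c : ℂ) :
    (fun x => c * f x) ∈ Phi A φ N := by
  obtain ⟨a, α, y, hα, rfl⟩ := hf
  exact ⟨fun j => c * a j, α, y, hα, by funext x; simp [Finset.mul_sum, mul_assoc]⟩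

theorem Phi_mono (hA : A.Nonempty) {M N : ℕ} (h : M ≤ N) {f : Rd d → ℂ} (hf : f ∈ Phi A φ M) :
    f ∈ Phi A φ N := by
  have := add_mem_Phi hf (zero_mem_Phi (φ := φ) hA (N - M))
  simpa [Nat.add_sub_cancel' h] using this

theorem shift_mem_Phi {α : ℝ} (hα : α ∈ A) (y : Rd d) : (fun x => φ α (x - y)) ∈ Phi A φ 1 :=
  ⟨fun _ => 1, fun _ => α, fun _ => y, fun _ => hα, by simp⟩

theorem sum_mem_Phi (hA : A.Nonempty) {κ : Type*} (J : Finset κ) (n : κ → ℕ) (f : κ → Rd d → ℂ)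
    (hf : ∀ j ∈ J, f j ∈ Phi A φ (n j)) : (fun x => ∑ j ∈ J, f j x) ∈ Phi A φ (∑ j ∈ J, n j) := by
  classical
  induction J using Finset.induction_on with
  | empty => simpa using zero_mem_Phi (φ := φ) hA 0
  | insert j J hj ih =>
    simp only [Finset.sum_insert hj]
    exact add_mem_Phi (hf j (Finset.mem_insert_self _ _))
      (ih fun i hi => hf i (Finset.mem_insert_of_mem hi))

theorem dyadic_mem_Phi (h1 : CondA1 A φ) {N : ℕ} {S : Rd d → ℂ} (hS : S ∈ Phi A φ N) (k : ℤ)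
    (n : Fin d → ℤ) : dyadic S k n ∈ Phi A φ N := by
  have h2 := (h1 N S hS).2 ((2 : ℝ) ^ k)⁻¹ (by positivity)
  exact (h1 N _ h2).1 ((2 : ℝ) ^ k • latticePt n)

theorem sampledBox_mem_Phi {α : ℝ} (hα : α ∈ A) (σ : Rd d → ℂ) (h : ℝ) (M : ℕ) :
    sampledBox (φ α) σ h M ∈ Phi A φ ((2 * M + 1) ^ d) := by
  have h1 := sum_mem_Phi ⟨α, hα⟩ (latticeBox d M) (fun _ => 1)
    (fun j x => σ (-(h • latticePt j)) * φ α (x - -(h • latticePt j)))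
    (fun j _ => const_mul_mem_Phi (shift_mem_Phi hα _) _)
  rw [Finset.sum_const, smul_eq_mul, mul_one, card_latticeBox] at h1
  have h2 := const_mul_mem_Phi h1 ((((2 * Real.pi) ^ d)⁻¹ * h ^ d : ℝ) : ℂ)
  simpa only [sampledBox, sub_neg_eq_add] using! h2

end PhiAlgebra

/-! ### Approximation of a single band-limited Schwartz function -/

section SingleWavelet

variable {d : ℕ}

/-- With mesh size `1 / L` and `O(L^{2d})` nodes, a band-limited Schwartz function is approximated
at any prescribed rate in `L`, with an error of any prescribed decay. -/
theorem exists_sampledBox_approx (hd : 0 < d) {R : ℝ} (hR : 0 < R) {A : Set ℝ}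
    {φ : ℝ → Rd d → ℂ} (hφ : IsAdmissible R A φ) (b p : ℕ) :
    ∃ α ∈ A, ∀ ψ : 𝓢(Rd d, ℂ), (∀ ξ, R < ‖ξ‖ → hat ψ ξ = 0) →
      ∃ C : ℝ, 0 ≤ C ∧ ∃ L₀ : ℕ, 0 < L₀ ∧ ∀ L : ℕ, L₀ ≤ L → ∀ x,
        ‖ψ x - sampledBox (φ α) (deconv R (φ α) ψ) (1 / L) (L ^ 2) x‖ ≤
          C * ((L : ℝ) ^ p)⁻¹ * wt b x := by
  -- The geometric mean below halves both orders, hence the doubled `b` and `p`; the order `d + 1`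
  -- makes the sums over the grid converge.
  set k : ℕ := d + 1 + 2 * b + 2 * p with hk
  obtain ⟨α₃, hα₃, h3⟩ := hφ.a3 k
  obtain ⟨α₄, hα₄, h4⟩ := hφ.a4 k
  obtain ⟨α₅, hα₅, h5⟩ := hφ.a5 k
  obtain ⟨α, hα, hle3, hle4, hle5⟩ : ∃ α ∈ A, α₃ ≤ α ∧ α₄ ≤ α ∧ α₅ ≤ α := by
    rcases le_total α₃ α₄ with h | h <;> rcases le_total α₄ α₅ with h' | h' <;>
      rcases le_total α₃ α₅ with h'' | h''
    all_goals first
      | exact ⟨α₃, hα₃, by linarith, by linarith, by linarith⟩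
      | exact ⟨α₄, hα₄, by linarith, by linarith, by linarith⟩
      | exact ⟨α₅, hα₅, by linarith, by linarith, by linarith⟩
  refine ⟨α, hα, fun ψ hψ => ?_⟩
  obtain ⟨hne, C₃, hC₃⟩ := h3 α hα hle3
  have hw := (h4 α hα hle4).2
  have hc := hφ.a2.1 α hα
  obtain ⟨Cφ, -, hCφ⟩ := exists_norm_le_wt_of_isBigO hc (h5 α hα hle5)
  replace hCφ : ∀ x, ‖φ α x‖ ≤ Cφ * wt k x := fun x => by
    refine (hCφ x).trans ?_
    have : 0 ≤ Cφ := by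
      have := (norm_nonneg _).trans (hCφ 0)
      nlinarith [wt_pos (2 * k) (0 : Rd d)]
    have := wt_anti (show k ≤ 2 * k by omega) x
    gcongr
  obtain ⟨Cσ, -, hCσ⟩ := hw.exists_norm_integral_le_wt hR hd (contDiff_hat ψ) hψ
  replace hCσ : ∀ x, ‖deconv R (φ α) ψ x‖ ≤ Cσ * wt k x := hCσ
  obtain ⟨v, hv0, hv⟩ := hw.exists_chain (⟨0, hd⟩ : Fin d)
  have hint := hv.integrableOn 0 (Nat.zero_le k)
  rw [hv0] at hint
  obtain ⟨K₁, hK₁, hb1⟩ := exists_sampled_bounds (b := 2 * b) (c := 0) (k := k) (by omega) hCφ hCσ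
  obtain ⟨K₂, hK₂, hb2⟩ := exists_sampled_bounds (b := b) (c := p) (k := k) (by omega) hCφ hCσ
  obtain ⟨Cψ, hCψ0, hCψ⟩ := exists_schwartz_le_wt ψ (2 * b)
  set D : ℝ := ((2 * Real.pi) ^ d)⁻¹ * (∫ ξ in Metric.ball 0 R, ‖hat ψ ξ‖) * max C₃ 0 with hD
  have hD0 : 0 ≤ D := by positivity
  -- The mesh size `1 / L` is eventually admissible in `CondA3`.
  have htend : Tendsto (fun L : ℕ => 1 / (L : ℝ)) atTop (𝓝[>] 0) := by
    refine tendsto_nhdsWithin_iff.2 ⟨tendsto_one_div_atTop_nhds_zero_nat, ?_⟩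
    filter_upwards [eventually_gt_atTop 0] with L hL
    simp only [Set.mem_Ioi]
    positivity
  obtain ⟨L₁, hL₁⟩ := eventually_atTop.1 (htend.eventually hC₃)
  set E : ℝ := D + Cψ + K₁ with hE
  have hE0 : 0 ≤ E := by positivity
  refine ⟨E + K₂, by positivity, max L₁ 1, by positivity, fun L hL x => ?_⟩
  have hLpos : 0 < L := lt_of_lt_of_le one_pos ((le_max_right _ _).trans hL)
  have hL1 : (1 : ℝ) ≤ L := by exact_mod_cast hLpos
  have h0 : (0 : ℝ) < 1 / L := by positivity
  have h1 : (1 : ℝ) / L ≤ 1 := by rw [div_le_one (by positivity)]; exact hL1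
  have hρ : ratioSum R (φ α) (1 / L) ≤ ENNReal.ofReal (max C₃ 0 * (1 / (L : ℝ)) ^ k) := by
    refine (hL₁ L ((le_max_left _ _).trans hL)).trans (ENNReal.ofReal_le_ofReal ?_)
    gcongr
    exact le_max_left _ _
  have e1 : ‖ψ x - sampled (φ α) (deconv R (φ α) ψ) (1 / L) x‖ ≤ E * (((L : ℝ) ^ p)⁻¹) ^ 2 := by
    refine (norm_sub_sampled_le hR hc (show d < k by omega) hCφ hne hint ψ hψ h0 h1
      (by positivity) hρ x).trans ?_
    rw [← mul_assoc, ← hD, one_div, inv_pow]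
    have : ((L : ℝ) ^ k)⁻¹ ≤ (((L : ℝ) ^ p)⁻¹) ^ 2 := by
      rw [inv_pow, ← pow_mul]
      exact inv_anti₀ (by positivity) (pow_le_pow_right₀ hL1 (by omega))
    have : D ≤ E := by linarith
    gcongr
  have e2 : ‖ψ x - sampled (φ α) (deconv R (φ α) ψ) (1 / L) x‖ ≤ E * (wt b x) ^ 2 := by
    refine (norm_sub_le _ _).trans ?_
    have := hCψ x
    have := (hb1 (1 / L) h0 h1 x).1
    have h2 : wt (2 * b) x = wt b x ^ 2 := by rw [two_mul, ← wt_mul_wt, sq]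
    have := mul_nonneg hD0 (wt_nonneg (2 * b) x)
    rw [← h2, hE, add_mul, add_mul]
    linarith
  -- The geometric mean of the two bounds.
  have e3 : ‖ψ x - sampled (φ α) (deconv R (φ α) ψ) (1 / L) x‖ ≤
      E * ((L : ℝ) ^ p)⁻¹ * wt b x := by
    have hw0 := wt_nonneg b x
    refine abs_le_of_sq_le_sq' ?_ (by positivity) |>.2
    rw [sq]
    refine (mul_le_mul e1 e2 (norm_nonneg _) (by positivity)).trans_eq ?_
    ring
  have e4 := (hb2 (1 / L) h0 h1 x).2 (L ^ 2) (by positivity)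
  -- The nodes fill a box of size `L`, so the truncation error is of order `L^{-p}`.
  have e5 : (1 / (L : ℝ)) * ((L ^ 2 : ℕ) : ℝ) = L := by push_cast; field_simp
  rw [e5] at e4
  calc _ ≤ _ := norm_sub_le_norm_sub_add_norm_sub _
        (sampled (φ α) (deconv R (φ α) ψ) (1 / L) x) _
    _ ≤ E * ((L : ℝ) ^ p)⁻¹ * wt b x + K₂ * ((L : ℝ) ^ p)⁻¹ * wt b x := add_le_add e3 e4
    _ = _ := by ring

/-- The `n`-term approximation of a single band-limited Schwartz function: the rate `n^{-r}` and the
decay of the error are arbitrary. -/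
theorem exists_Phi_approx (hd : 0 < d) {R : ℝ} (hR : 0 < R) {A : Set ℝ}
    {φ : ℝ → Rd d → ℂ} (hφ : IsAdmissible R A φ) {r : ℝ} (hr : 0 ≤ r) (b : ℕ)
    (ψ : 𝓢(Rd d, ℂ)) (hψ : ∀ ξ, R < ‖ξ‖ → hat ψ ξ = 0) :
    ∃ C : ℝ, 0 ≤ C ∧ ∀ n : ℕ, 0 < n → ∃ S ∈ Phi A φ n, ∀ x,
      ‖ψ x - S x‖ ≤ C * (n : ℝ) ^ (-r) * wt b x := by
  -- The number of terms is of order `L^{2d}`, so the rate `n^{-r}` amounts to `L^{-2dr}`.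
  set p : ℕ := ⌈2 * d * r⌉₊ with hp
  have hpr : 2 * d * r ≤ p := Nat.le_ceil _
  obtain ⟨α, hα, happ⟩ := exists_sampledBox_approx hd hR hφ b p
  obtain ⟨C, hC0, L₀, hL₀, hC⟩ := happ ψ hψ
  obtain ⟨Cψ, hCψ0, hCψ⟩ := exists_schwartz_le_wt ψ b
  refine ⟨C * ((12 : ℝ) ^ d) ^ r + Cψ * ((3 * (L₀ : ℝ) ^ 2) ^ d) ^ r, by positivity, fun n hn => ?_⟩
  have hn' : (0 : ℝ) < n := by exact_mod_cast hn
  -- The largest mesh parameter `L` affordable with `n` terms, `2 L² + 1` nodes in each direction.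
  set P : ℕ → Prop := fun L => (3 * L ^ 2) ^ d ≤ n with hP
  have hdec : DecidablePred P := fun L => inferInstanceAs (Decidable (_ ≤ _))
  set L := Nat.findGreatest P n with hL
  have hPL : (3 * L ^ 2) ^ d ≤ n := by
    refine Nat.findGreatest_spec (P := P) (m := 0) (Nat.zero_le _) ?_
    simp [hP, hd.ne']
  have hPL1 : n < (3 * (L + 1) ^ 2) ^ d := by
    by_contra hcon
    push Not at hcon
    have hLn : L + 1 ≤ n := by
      calc L + 1 ≤ 3 * (L + 1) ^ 2 := by nlinarith
        _ ≤ (3 * (L + 1) ^ 2) ^ d := Nat.le_self_pow hd.ne' _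
        _ ≤ n := hcon
    have := Nat.le_findGreatest (P := P) hLn hcon
    omega
  -- If `n` is too small for the mesh size to be admissible, zero is good enough.
  by_cases hLL : L₀ ≤ L
  · have hLpos : 0 < L := lt_of_lt_of_le hL₀ hLL
    have hL1 : (1 : ℝ) ≤ L := by exact_mod_cast hLpos
    refine ⟨_, Phi_mono ⟨α, hα⟩ ?_ (sampledBox_mem_Phi hα (deconv R (φ α) ψ) (1 / L) (L ^ 2)),
      fun x => (hC L hLL x).trans ?_⟩
    · refine le_trans (Nat.pow_le_pow_left ?_ d) hPL
      have : 1 ≤ L ^ 2 := Nat.one_le_pow _ _ hLpos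
      omega
    · refine mul_le_mul_of_nonneg_right ?_ (wt_nonneg _ _)
      have h1 : (n : ℝ) ≤ 12 ^ d * (L : ℝ) ^ (2 * d) := by
        have : (n : ℝ) ≤ ((3 * ((L : ℝ) + 1) ^ 2) ^ d) := by exact_mod_cast hPL1.le
        refine this.trans ?_
        rw [pow_mul, ← mul_pow]
        exact pow_le_pow_left₀ (by positivity) (by nlinarith) d
      have h2 : (n : ℝ) ^ r ≤ ((12 : ℝ) ^ d) ^ r * (L : ℝ) ^ p := by
        calc (n : ℝ) ^ r ≤ (12 ^ d * (L : ℝ) ^ (2 * d)) ^ r := by gcongr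
          _ = ((12 : ℝ) ^ d) ^ r * (L : ℝ) ^ (2 * d * r) := by
            rw [Real.mul_rpow (by positivity) (by positivity), ← Real.rpow_natCast (L : ℝ) (2 * d),
              ← Real.rpow_mul (by positivity)]
            push_cast
            rfl
          _ ≤ ((12 : ℝ) ^ d) ^ r * (L : ℝ) ^ p := by
            rw [← Real.rpow_natCast (L : ℝ) p]
            gcongr
      have h3 : ((L : ℝ) ^ p)⁻¹ ≤ ((12 : ℝ) ^ d) ^ r * (n : ℝ) ^ (-r) := by
        rw [Real.rpow_neg hn'.le, ← div_eq_mul_inv, le_div_iff₀ (by positivity),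
          inv_mul_le_iff₀ (by positivity), mul_comm]
        exact h2
      calc C * ((L : ℝ) ^ p)⁻¹ ≤ C * (((12 : ℝ) ^ d) ^ r * (n : ℝ) ^ (-r)) := by gcongr
        _ ≤ _ := by
          rw [add_mul, mul_assoc C]
          exact le_add_of_nonneg_right (by positivity)
  · refine ⟨_, zero_mem_Phi ⟨α, hα⟩ n, fun x => ?_⟩
    rw [sub_zero]
    refine (hCψ x).trans (mul_le_mul_of_nonneg_right ?_ (wt_nonneg _ _))
    have h1 : (n : ℝ) ≤ (3 * (L₀ : ℝ) ^ 2) ^ d := by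
      have : (n : ℝ) ≤ ((3 * ((L : ℝ) + 1) ^ 2) ^ d) := by exact_mod_cast hPL1.le
      refine this.trans ?_
      have : (L : ℝ) + 1 ≤ L₀ := by exact_mod_cast (show L + 1 ≤ L₀ by omega)
      gcongr
    have h2 : 1 ≤ ((3 * (L₀ : ℝ) ^ 2) ^ d) ^ r * (n : ℝ) ^ (-r) := by
      rw [Real.rpow_neg hn'.le, ← div_eq_mul_inv, one_le_div (by positivity)]
      gcongr
    calc Cψ ≤ Cψ * (((3 * (L₀ : ℝ) ^ 2) ^ d) ^ r * (n : ℝ) ^ (-r)) :=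
          le_mul_of_one_le_right hCψ0 h2
      _ ≤ _ := by
        rw [add_mul, mul_assoc Cψ]
        exact le_add_of_nonneg_left (by positivity)

end SingleWavelet

/-! ### Cancellation: pairings of dyadic shifts -/

section Pairing

variable {d : ℕ}

theorem cubeVol_pos (d : ℕ) (k : ℤ) : 0 < cubeVol d k := by unfold cubeVol; positivity

/-- The change of variables `x = 2^k (y + n)`. -/
theorem integral_eq_cubeVol_mul (H : Rd d → ℂ) (k : ℤ) (n : Fin d → ℤ) :
    ∫ x, H x = (cubeVol d k : ℂ) * ∫ y, H ((2 : ℝ) ^ k • (y + latticePt n)) := by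
  have h2 : (0 : ℝ) < (2 : ℝ) ^ k := by positivity
  rw [integral_add_right_eq_self (fun y => H ((2 : ℝ) ^ k • y)) (latticePt n),
    Measure.integral_comp_smul]
  simp only [finrank_euclideanSpace, Fintype.card_fin]
  rw [abs_of_pos (by positivity), Complex.real_smul, ← mul_assoc, ← Complex.ofReal_mul, cubeVol,
    mul_inv_cancel₀ (by positivity), Complex.ofReal_one, one_mul]

theorem dyadic_smul_add (ψ : Rd d → ℂ) (k : ℤ) (n : Fin d → ℤ) (y : Rd d) :
    dyadic ψ k n ((2 : ℝ) ^ k • (y + latticePt n)) = ψ y := by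
  have h2 : (2 : ℝ) ^ k ≠ 0 := by positivity
  rw [dyadic, smul_add, add_sub_cancel_right, smul_smul, inv_mul_cancel₀ h2, one_smul]

theorem dyadic_eq (ψ : Rd d → ℂ) (k : ℤ) (n : Fin d → ℤ) (x : Rd d) :
    dyadic ψ k n x = ψ (((2 : ℝ) ^ k)⁻¹ • x - latticePt n) := by
  have h2 : (2 : ℝ) ^ k ≠ 0 := by positivity
  rw [dyadic, smul_sub, smul_smul, inv_mul_cancel₀ h2, one_smul]

theorem continuous_dyadic (ψ : 𝓢(Rd d, ℂ)) (k : ℤ) (n : Fin d → ℤ) :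
    Continuous (dyadic ψ k n) := by
  unfold dyadic
  exact ψ.continuous.comp (by fun_prop)

/-- The mean value inequality for Schwartz functions, with decay. -/
theorem exists_norm_sub_le_wt (g : 𝓢(Rd d, ℂ)) (m : ℕ) :
    ∃ C : ℝ, 0 ≤ C ∧ ∀ z c, ‖g z - g c‖ ≤ C * ‖z - c‖ * (1 + ‖z - c‖) ^ m * wt m c := by
  obtain ⟨C, hC0, hC⟩ := exists_schwartz_le_wt (SchwartzMap.fderivCLM ℝ (Rd d) ℂ g) m
  refine ⟨C, hC0, fun z c => ?_⟩
  have := (convex_segment c z).norm_image_sub_le_of_norm_fderiv_le (𝕜 := ℝ) (f := g)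
    (C := C * ((1 + ‖z - c‖) ^ m * wt m c)) (fun x _ => g.differentiableAt) (fun x hx => ?_)
    (left_mem_segment ℝ c z) (right_mem_segment ℝ c z)
  · calc _ ≤ _ := this
      _ = _ := by ring
  · have h1 := hC x
    rw [SchwartzMap.fderivCLM_apply] at h1
    have h2 := wt_le_mul_wt m x c
    have h3 : ‖x - c‖ ≤ ‖z - c‖ := by
      obtain ⟨t, ht, rfl⟩ := (segment_eq_image' ℝ c z ▸ hx : x ∈ _)
      rw [add_sub_cancel_left, norm_smul, Real.norm_eq_abs, abs_of_nonneg ht.1]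
      exact mul_le_of_le_one_left (norm_nonneg _) ht.2
    have h4 := wt_nonneg m c
    calc _ ≤ C * wt m x := h1
      _ ≤ C * ((1 + ‖x - c‖) ^ m * wt m c) := by gcongr
      _ ≤ _ := by gcongr

/-- A mean-zero function at unit scale, tested against a function that varies at the larger scale
`1 / t`, gains a factor `t`. -/
theorem exists_norm_pairing_le (g w : 𝓢(Rd d, ℂ)) (hw : ∫ x, w x = 0) (m : ℕ) :
    ∃ C : ℝ, 0 ≤ C ∧ ∀ t : ℝ, 0 < t → t ≤ 1 → ∀ c : Rd d,
      ‖∫ y, g (t • y + c) * (starRingEnd ℂ) (w y)‖ ≤ C * t * wt m c := by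
  obtain ⟨C, hC0, hC⟩ := exists_norm_sub_le_wt g m
  obtain ⟨D, hD0, hD⟩ := exists_schwartz_le_wt w (m + 1 + (d + 1))
  refine ⟨C * D * ∫ y : Rd d, wt (d + 1) y, mul_nonneg (by positivity)
    (integral_nonneg fun y => wt_nonneg _ _), fun t ht0 ht1 c => ?_⟩
  have hwi : Integrable (fun y => (starRingEnd ℂ) (w y)) volume :=
    (LinearIsometryEquiv.integrable_comp_iff (RCLike.conjLIE (K := ℂ))).2 w.integrable
  have hgb : ∃ M, ∀ y, ‖g y‖ ≤ M := by
    obtain ⟨M, hM0, hM⟩ := exists_schwartz_le_wt g 0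
    exact ⟨M, fun y => (hM y).trans (by simp [wt])⟩
  obtain ⟨M, hM⟩ := hgb
  have hi1 : Integrable (fun y => g (t • y + c) * (starRingEnd ℂ) (w y)) volume :=
    hwi.bdd_mul (c := M) (g.continuous.comp (by fun_prop)).aestronglyMeasurable
      (Eventually.of_forall fun y => hM _)
  have hzero : ∫ y, (starRingEnd ℂ) (w y) = 0 := by rw [integral_conj, hw, map_zero]
  have hsub : ∫ y, g (t • y + c) * (starRingEnd ℂ) (w y) =
      ∫ y, (g (t • y + c) - g c) * (starRingEnd ℂ) (w y) := by
    simp_rw [sub_mul]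
    rw [integral_sub hi1 (hwi.const_mul _), integral_const_mul, hzero, mul_zero, sub_zero]
  rw [hsub]
  have hbd : ∀ y, ‖(g (t • y + c) - g c) * (starRingEnd ℂ) (w y)‖ ≤
      C * D * t * wt m c * wt (d + 1) y := by
    intro y
    rw [norm_mul, RCLike.norm_conj]
    have h1 := hC (t • y + c) c
    rw [add_sub_cancel_right, norm_smul, Real.norm_eq_abs, abs_of_pos ht0] at h1
    have h2 : ‖w y‖ ≤ D * (((1 + ‖y‖) ^ (m + 1))⁻¹ * wt (d + 1) y) := by
      rw [show ((1 + ‖y‖) ^ (m + 1))⁻¹ = wt (m + 1) y from rfl, wt_mul_wt]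
      exact hD y
    have hwc := wt_nonneg m c
    have hwy := wt_nonneg (d + 1) y
    calc _ ≤ (C * (t * ‖y‖) * (1 + t * ‖y‖) ^ m * wt m c) *
          (D * (((1 + ‖y‖) ^ (m + 1))⁻¹ * wt (d + 1) y)) :=
          mul_le_mul h1 h2 (norm_nonneg _) (by positivity)
      _ ≤ (C * (t * (1 + ‖y‖)) * (1 + ‖y‖) ^ m * wt m c) *
          (D * (((1 + ‖y‖) ^ (m + 1))⁻¹ * wt (d + 1) y)) := by
          have : t * ‖y‖ ≤ ‖y‖ := mul_le_of_le_one_left (norm_nonneg _) ht1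
          have : ‖y‖ ≤ 1 + ‖y‖ := by linarith
          gcongr
      _ = _ := by
          rw [pow_succ]
          field_simp
  refine (norm_integral_le_of_norm_le ((integrable_wt (Nat.lt_succ_self d)).const_mul _)
    (Eventually.of_forall hbd)).trans_eq ?_
  rw [integral_const_mul]
  ring

/-- The pairing of two mean-zero Schwartz functions, one of them rescaled: it is small both for
very fine and for very coarse scales, and localized. -/
theorem exists_norm_integral_mul_dyadic_le (θ w : 𝓢(Rd d, ℂ)) (hθ : ∫ x, θ x = 0)
    (hw : ∫ x, w x = 0) (m : ℕ) :
    ∃ C : ℝ, 0 ≤ C ∧ ∀ (k : ℤ) (n : Fin d → ℤ),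
      ‖∫ x, θ x * (starRingEnd ℂ) (dyadic w k n x)‖ ≤
        C * (2 : ℝ)⁻¹ ^ k.natAbs * (min 1 (cubeVol d k) * wt m (min 1 ((2 : ℝ) ^ k) • latticePt n)) := by
  obtain ⟨C₁, hC₁, h1⟩ := exists_norm_pairing_le θ w hw m
  obtain ⟨C₂, hC₂, h2⟩ := exists_norm_pairing_le w θ hθ m
  refine ⟨max C₁ C₂, by positivity, fun k n => ?_⟩
  have hp : (0 : ℝ) < (2 : ℝ) ^ k := by positivity
  rcases le_total k 0 with hk | hk
  · have hk1 : (2 : ℝ) ^ k ≤ 1 := zpow_le_one_of_nonpos₀ (by norm_num) hk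
    have hv1 : cubeVol d k ≤ 1 := pow_le_one₀ hp.le hk1
    have e : (2 : ℝ)⁻¹ ^ k.natAbs = (2 : ℝ) ^ k := by
      rw [← zpow_natCast, inv_zpow', Int.natCast_natAbs, abs_of_nonpos hk, neg_neg]
    rw [min_eq_right hk1, min_eq_right hv1, integral_eq_cubeVol_mul _ k n, norm_mul,
      Complex.norm_real, Real.norm_of_nonneg (cubeVol_pos d k).le, e]
    simp_rw [dyadic_smul_add, smul_add]
    calc _ ≤ cubeVol d k * (C₁ * (2 : ℝ) ^ k * wt m ((2 : ℝ) ^ k • latticePt n)) :=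
          mul_le_mul_of_nonneg_left (h1 _ hp hk1 _) (cubeVol_pos d k).le
      _ ≤ cubeVol d k * (max C₁ C₂ * (2 : ℝ) ^ k * wt m ((2 : ℝ) ^ k • latticePt n)) := by
          have := (cubeVol_pos d k).le
          have := wt_nonneg m ((2 : ℝ) ^ k • latticePt n)
          gcongr
          exact le_max_left _ _
      _ = _ := by ring
  · have hk1 : 1 ≤ (2 : ℝ) ^ k := one_le_zpow₀ (by norm_num) hk
    have hv1 : 1 ≤ cubeVol d k := one_le_pow₀ hk1
    have e : (2 : ℝ)⁻¹ ^ k.natAbs = ((2 : ℝ) ^ k)⁻¹ := by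
      rw [← zpow_natCast, inv_zpow, Int.natCast_natAbs, abs_of_nonneg hk]
    rw [min_eq_left hk1, min_eq_left hv1, one_smul, one_mul, e]
    have e2 : ∫ x, θ x * (starRingEnd ℂ) (dyadic w k n x) =
        (starRingEnd ℂ) (∫ x, w (((2 : ℝ) ^ k)⁻¹ • x + -latticePt n) * (starRingEnd ℂ) (θ x)) := by
      rw [← integral_conj]
      refine integral_congr_ae (Eventually.of_forall fun x => ?_)
      simp only [dyadic_eq, map_mul, Complex.conj_conj, sub_eq_add_neg]
      ring
    rw [e2, RCLike.norm_conj]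
    refine (h2 _ (by positivity) (inv_le_one_of_one_le₀ hk1) _).trans ?_
    rw [wt_neg]
    have := wt_nonneg m (latticePt n)
    gcongr
    exact le_max_right _ _

/-- Each point is a limit of dyadic points. -/
theorem exists_norm_sub_dyadic_le (x : Rd d) (K : ℕ) :
    ∃ n : Fin d → ℤ, ‖((2 : ℝ) ^ K)⁻¹ • latticePt n - x‖ ≤ d * ((2 : ℝ) ^ K)⁻¹ := by
  have h : (2 : ℝ) ^ K • x ∈ ⋃ n : Fin d → ℤ, unitCube n := by rw [iUnion_unitCube]; trivial
  obtain ⟨n, hn⟩ := Set.mem_iUnion.1 h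
  refine ⟨n, ?_⟩
  have h2 := norm_sub_latticePt_le hn
  have h3 : ((2 : ℝ) ^ K)⁻¹ • latticePt n - x = -(((2 : ℝ) ^ K)⁻¹ • ((2 : ℝ) ^ K • x - latticePt n)) := by
    rw [smul_sub, smul_smul, inv_mul_cancel₀ (by positivity), one_smul, neg_sub]
  rw [h3, norm_neg, norm_smul, norm_inv, norm_pow, Real.norm_ofNat, mul_comm]
  gcongr

/-- The wavelets have mean zero: test a wavelet that does not vanish at a dyadic point against
wavelets which concentrate at that point. -/
theorem IsWaveletSystem.integral_eq_zero {R : ℝ} {ι : Type} {ψ : ι → 𝓢(Rd d, ℂ)}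
    (hψ : IsWaveletSystem R ψ) (e : ι) : ∫ x, ψ e x = 0 := by
  have hne : ∃ x, ψ e x ≠ 0 := by
    by_contra hcon
    push Not at hcon
    have h := hψ.normalized e 0 0
    simp [dyadic, hcon] at h
    exact (cubeVol_pos d 0).ne' (by exact_mod_cast h.symm)
  obtain ⟨x₁, hx₁⟩ := hne
  obtain ⟨K, n, hKn⟩ : ∃ (K : ℕ) (n : Fin d → ℤ), ψ e (((2 : ℝ) ^ K)⁻¹ • latticePt n) ≠ 0 := by
    choose n hn using exists_norm_sub_dyadic_le x₁
    have ht : Tendsto (fun K : ℕ => ((2 : ℝ) ^ K)⁻¹ • latticePt (n K)) atTop (𝓝 x₁) := by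
      rw [tendsto_iff_norm_sub_tendsto_zero]
      refine squeeze_zero (fun _ => norm_nonneg _) hn ?_
      have : Tendsto (fun K : ℕ => ((2 : ℝ) ^ K)⁻¹) atTop (𝓝 0) :=
        tendsto_inv_atTop_zero.comp (tendsto_pow_atTop_atTop_of_one_lt (by norm_num))
      simpa using this.const_mul (d : ℝ)
    obtain ⟨K, hK⟩ := (((ψ e).continuous.tendsto x₁).comp ht).eventually_ne hx₁ |>.exists
    exact ⟨K, n K, hK⟩
  set x₀ : Rd d := ((2 : ℝ) ^ K)⁻¹ • latticePt n with hx₀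
  have horth : ∀ l : ℕ, ∫ y, ψ e (((2 : ℝ) ^ (K + l + 1))⁻¹ • y + x₀) *
      (starRingEnd ℂ) (ψ e y) = 0 := by
    intro l
    set k : ℤ := -((K + l + 1 : ℕ) : ℤ) with hk
    set n' : Fin d → ℤ := fun i => 2 ^ (l + 1) * n i with hn'
    have h := hψ.orthogonal e 0 0 e k n' (by
      intro h
      have := congrArg (fun p : ι × ℤ × (Fin d → ℤ) => p.2.1) h
      simp only at this
      omega)
    rw [integral_eq_cubeVol_mul _ k n'] at h
    have h2 := (mul_eq_zero.1 h).resolve_left (by exact_mod_cast (cubeVol_pos d k).ne')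
    rw [← h2]
    refine integral_congr_ae (Eventually.of_forall fun y => ?_)
    simp only [dyadic_smul_add]
    congr 1
    rw [dyadic_eq, latticePt_zero, sub_zero, zpow_zero, inv_one, one_smul, smul_add, hk, zpow_neg,
      zpow_natCast]
    congr 2
    rw [hx₀]
    ext i
    simp only [PiLp.smul_apply, latticePt_apply, hn', smul_eq_mul]
    push_cast
    rw [add_assoc K l 1, pow_add (2 : ℝ) K]
    field_simp
  have hlim : Tendsto (fun l : ℕ => ∫ y, ψ e (((2 : ℝ) ^ (K + l + 1))⁻¹ • y + x₀) *
      (starRingEnd ℂ) (ψ e y)) atTop (𝓝 (∫ y, ψ e x₀ * (starRingEnd ℂ) (ψ e y))) := by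
    obtain ⟨M, hM0, hM⟩ := exists_schwartz_le_wt (ψ e) 0
    have hM' : ∀ y, ‖ψ e y‖ ≤ M := fun y => (hM y).trans (by simp [wt])
    refine tendsto_integral_of_dominated_convergence (fun y => M * ‖ψ e y‖) (fun l => ?_)
      ((ψ e).integrable.norm.const_mul M) (fun l => ?_) ?_
    · refine Continuous.aestronglyMeasurable (Continuous.mul ?_ ?_)
      · exact (ψ e).continuous.comp (by fun_prop)
      · exact Complex.continuous_conj.comp (ψ e).continuous
    · refine Eventually.of_forall fun y => ?_
      rw [norm_mul, RCLike.norm_conj]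
      have := hM' (((2 : ℝ) ^ (K + l + 1))⁻¹ • y + x₀)
      gcongr
    · refine Eventually.of_forall fun y => Tendsto.mul_const _ ?_
      have h0 : Tendsto (fun l : ℕ => ((2 : ℝ) ^ (K + l + 1))⁻¹) atTop (𝓝 0) := by
        refine tendsto_inv_atTop_zero.comp
          ((tendsto_pow_atTop_atTop_of_one_lt (by norm_num : (1 : ℝ) < 2)).comp ?_)
        exact tendsto_atTop_mono (fun l => by simp only [id]; omega) tendsto_id
      have h1 : Tendsto (fun l : ℕ => ((2 : ℝ) ^ (K + l + 1))⁻¹ • y + x₀) atTop (𝓝 x₀) := by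
        simpa using (h0.smul_const y).add_const x₀
      exact ((ψ e).continuous.tendsto x₀).comp h1
  simp_rw [horth] at hlim
  have h0 := tendsto_nhds_unique hlim tendsto_const_nhds
  rw [integral_const_mul, integral_conj] at h0
  have h1 := (mul_eq_zero.1 h0).resolve_left hKn
  simpa using h1

end Pairing

/-! ### Wavelet series -/

section Synthesis

variable {d : ℕ} {ι : Type}

/-- The wavelet `ψ_{e,I}` with index `(e, k, n)`, where `I = 2^k (n + [0,1]^d)`. -/
noncomputable def wavelet (ψ : ι → 𝓢(Rd d, ℂ)) (p : ι × ℤ × (Fin d → ℤ)) : Rd d → ℂ :=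
  dyadic (ψ p.1) p.2.1 p.2.2

/-- The coefficient of `f` with index `(e, k, n)`. -/
noncomputable def waveletCoeff (ψ : ι → 𝓢(Rd d, ℂ)) (f : Rd d → ℂ)
    (p : ι × ℤ × (Fin d → ℤ)) : ℂ :=
  coeff (ψ p.1) f p.2.1 p.2.2

/-- The sum of the wavelet series with coefficients `a`. -/
noncomputable def synthesis (ψ : ι → 𝓢(Rd d, ℂ)) (a : ι × ℤ × (Fin d → ℤ) → ℂ) (x : Rd d) : ℂ :=
  ∑' p, a p * wavelet ψ p x

/-- The sum of the absolute values of the terms of a wavelet series. -/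
noncomputable def majorant (ψ : ι → 𝓢(Rd d, ℂ)) (a : ι × ℤ × (Fin d → ℤ) → ℂ) (x : Rd d) : ℝ≥0∞ :=
  ∑' p, ‖a p‖ₑ * ‖wavelet ψ p x‖ₑ

/-- The sum over all indices, arranged by levels. -/
theorem tsum_index_eq (F : ι × ℤ × (Fin d → ℤ) → ℝ≥0∞) :
    ∑' p, F p = ∑' k : ℤ, ∑' r : ι × (Fin d → ℤ), F (r.1, k, r.2) := by
  let σ : ℤ × (ι × (Fin d → ℤ)) ≃ ι × ℤ × (Fin d → ℤ) :=
    { toFun := fun q => (q.2.1, q.1, q.2.2)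
      invFun := fun p => (p.2.1, p.1, p.2.2)
      left_inv := fun _ => rfl
      right_inv := fun _ => rfl }
  rw [← σ.tsum_eq F, ENNReal.tsum_prod']
  rfl

theorem continuous_wavelet (ψ : ι → 𝓢(Rd d, ℂ)) (p : ι × ℤ × (Fin d → ℤ)) :
    Continuous (wavelet ψ p) := continuous_dyadic _ _ _

theorem lintegral_wavelet (ψ : ι → 𝓢(Rd d, ℂ)) (p : ι × ℤ × (Fin d → ℤ)) :
    Integrable (wavelet ψ p) volume ∧
    ∫⁻ x, ‖wavelet ψ p x‖ₑ = ENNReal.ofReal (cubeVol d p.2.1 * ∫ x, ‖ψ p.1 x‖) := by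
  have h2 : (2 : ℝ) ^ p.2.1 ≠ 0 := by positivity
  have hi : Integrable (wavelet ψ p) volume := by
    have h : wavelet ψ p = fun x =>
        (fun y => ψ p.1 (y - latticePt p.2.2)) (((2 : ℝ) ^ p.2.1)⁻¹ • x) := by
      funext x; exact dyadic_eq _ _ _ _
    rw [h]
    exact ((ψ p.1).integrable.comp_sub_right (latticePt p.2.2)).comp_smul (inv_ne_zero h2)
  refine ⟨hi, ?_⟩
  have h3 := integral_eq_cubeVol_mul (fun x => ((‖wavelet ψ p x‖ : ℝ) : ℂ)) p.2.1 p.2.2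
  simp only [wavelet, dyadic_smul_add] at h3
  rw [integral_complex_ofReal, integral_complex_ofReal] at h3
  have h4 : ∫ x, ‖wavelet ψ p x‖ = cubeVol d p.2.1 * ∫ x, ‖ψ p.1 x‖ := by exact_mod_cast h3
  rw [← h4, ofReal_integral_norm_eq_lintegral_enorm hi]

theorem exists_wavelet_le_wt [Fintype ι] (ψ : ι → 𝓢(Rd d, ℂ)) (m : ℕ) : ∃ C : ℝ, 0 ≤ C ∧
    ∀ p x, ‖wavelet ψ p x‖ ≤ C * wt m (((2 : ℝ) ^ p.2.1)⁻¹ • x - latticePt p.2.2) := by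
  choose C hC0 hC using fun e => exists_schwartz_le_wt (ψ e) m
  refine ⟨∑ e, C e, Finset.sum_nonneg fun e _ => hC0 e, fun p x => ?_⟩
  rw [wavelet, dyadic_eq]
  refine (hC p.1 _).trans (mul_le_mul_of_nonneg_right ?_ (wt_nonneg _ _))
  exact Finset.single_le_sum (f := C) (fun e _ => hC0 e) (Finset.mem_univ _)

/-- The weights attached to the cubes of one level have a bounded sum, uniformly in the level. -/
theorem exists_tsum_level_wt_le (d : ℕ) (ι : Type) [Fintype ι] : ∃ K : ℝ≥0∞, K ≠ ⊤ ∧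
    ∀ (k : ℤ) (x : Rd d), ∑' r : ι × (Fin d → ℤ),
      ENNReal.ofReal (wt (d + 1) (((2 : ℝ) ^ k)⁻¹ • x - latticePt r.2)) ≤ K := by
  obtain ⟨K, -, hK⟩ := exists_tsum_wt_le d
  refine ⟨Fintype.card ι * ENNReal.ofReal K, by finiteness, fun k x => ?_⟩
  rw [ENNReal.tsum_prod']
  calc _ ≤ ∑' _ : ι, ENNReal.ofReal K := by
        refine ENNReal.tsum_le_tsum fun e => ?_
        have := hK 1 one_pos le_rfl (((2 : ℝ) ^ k)⁻¹ • x)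
        simpa using this
    _ = _ := by rw [tsum_fintype]; simp

/-- If the coefficients on the level `k` are bounded by `c k`, the wavelet series is bounded by a
multiple of the sum of the `c k`. -/
theorem exists_majorant_le [Fintype ι] (ψ : ι → 𝓢(Rd d, ℂ)) : ∃ K : ℝ≥0∞, K ≠ ⊤ ∧
    ∀ (a : ι × ℤ × (Fin d → ℤ) → ℂ) (c : ℤ → ℝ≥0∞), (∀ p, ‖a p‖ₑ ≤ c p.2.1) →
      ∀ x, majorant ψ a x ≤ K * ∑' k, c k := by
  obtain ⟨C, hC0, hC⟩ := exists_wavelet_le_wt ψ (d + 1)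
  obtain ⟨K, hKtop, hK⟩ := exists_tsum_level_wt_le d ι
  refine ⟨ENNReal.ofReal C * K, by finiteness, fun a c hac x => ?_⟩
  rw [majorant, tsum_index_eq, ← ENNReal.tsum_mul_left]
  refine ENNReal.tsum_le_tsum fun k => ?_
  calc _ ≤ ∑' r : ι × (Fin d → ℤ), c k * ENNReal.ofReal C *
        ENNReal.ofReal (wt (d + 1) (((2 : ℝ) ^ k)⁻¹ • x - latticePt r.2)) := by
        refine ENNReal.tsum_le_tsum fun r => ?_
        rw [mul_assoc, ← ENNReal.ofReal_mul hC0]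
        gcongr
        · exact hac (r.1, k, r.2)
        · rw [← ofReal_norm]
          exact ENNReal.ofReal_le_ofReal (hC (r.1, k, r.2) x)
    _ ≤ c k * ENNReal.ofReal C * K := by
        rw [ENNReal.tsum_mul_left]
        gcongr
        exact hK k x
    _ = _ := by ring

theorem enorm_synthesis_le (ψ : ι → 𝓢(Rd d, ℂ)) (a : ι × ℤ × (Fin d → ℤ) → ℂ) (x : Rd d) :
    ‖synthesis ψ a x‖ₑ ≤ majorant ψ a x := by
  refine enorm_tsum_le_tsum_enorm.trans_eq (tsum_congr fun p => ?_)
  rw [enorm_mul]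

theorem summable_synthesis {ψ : ι → 𝓢(Rd d, ℂ)} {a : ι × ℤ × (Fin d → ℤ) → ℂ} {x : Rd d}
    (h : majorant ψ a x ≠ ⊤) : Summable fun p => a p * wavelet ψ p x := by
  have := ENNReal.summable_toReal h
  refine Summable.of_norm (this.congr fun p => ?_)
  simp

theorem measurable_majorant [Countable ι] (ψ : ι → 𝓢(Rd d, ℂ)) (a : ι × ℤ × (Fin d → ℤ) → ℂ) :
    Measurable (majorant ψ a) :=
  Measurable.tsum fun p => ((continuous_wavelet ψ p).measurable.enorm).const_mul _

theorem aestronglyMeasurable_synthesis [Countable ι] {ψ : ι → 𝓢(Rd d, ℂ)}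
    {a : ι × ℤ × (Fin d → ℤ) → ℂ}
    (h : ∀ x, majorant ψ a x ≠ ⊤) : AEStronglyMeasurable (synthesis ψ a) volume := by
  refine aestronglyMeasurable_of_tendsto_ae (u := atTop)
    (f := fun (s : Finset (ι × ℤ × (Fin d → ℤ))) x => ∑ p ∈ s, a p * wavelet ψ p x) (fun s => ?_)
    (Eventually.of_forall fun x => (summable_synthesis (h x)).hasSum)
  exact (continuous_finsetSum _ fun p _ =>
    continuous_const.mul (continuous_wavelet ψ p)).aestronglyMeasurable

/-- Integration term by term. -/
theorem integral_synthesis_mul [Countable ι] {ψ : ι → 𝓢(Rd d, ℂ)} {a : ι × ℤ × (Fin d → ℤ) → ℂ}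
    {G : Rd d → ℂ} (hG : AEStronglyMeasurable G volume)
    (hfin : ∫⁻ x, majorant ψ a x * ‖G x‖ₑ ≠ ⊤) :
    ∫ x, synthesis ψ a x * G x = ∑' p, a p * ∫ x, wavelet ψ p x * G x := by
  have h1 : ∀ x, synthesis ψ a x * G x = ∑' p, a p * wavelet ψ p x * G x := fun x => by
    rw [synthesis, tsum_mul_right]
  have hm : ∀ p, AEStronglyMeasurable (fun x => a p * wavelet ψ p x * G x) volume := fun p =>
    (continuous_const.mul (continuous_wavelet ψ p)).aestronglyMeasurable.mul hG
  simp_rw [h1]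
  rw [integral_tsum hm]
  · refine tsum_congr fun p => ?_
    rw [← integral_const_mul]
    simp only [mul_assoc]
  · rw [← lintegral_tsum fun p => (hm p).enorm]
    refine ne_top_of_le_ne_top hfin (lintegral_mono fun x => ?_)
    rw [majorant, ← ENNReal.tsum_mul_right]
    simp [enorm_mul]

theorem IsWaveletSystem.integral_wavelet_mul_conj {R : ℝ} {ψ : ι → 𝓢(Rd d, ℂ)}
    (hψ : IsWaveletSystem R ψ) (p r : ι × ℤ × (Fin d → ℤ)) [Decidable (p = r)] :
    ∫ x, wavelet ψ p x * (starRingEnd ℂ) (wavelet ψ r x) =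
      if p = r then (cubeVol d r.2.1 : ℂ) else 0 := by
  split_ifs with h
  · subst h
    exact hψ.normalized _ _ _
  · exact hψ.orthogonal _ _ _ _ _ _ h

/-- The coefficients of a bounded wavelet series are recovered from its sum. -/
theorem IsWaveletSystem.waveletCoeff_synthesis [Countable ι] {R : ℝ} {ψ : ι → 𝓢(Rd d, ℂ)}
    (hψ : IsWaveletSystem R ψ) {a : ι × ℤ × (Fin d → ℤ) → ℂ} {M : ℝ≥0∞} (hM : M ≠ ⊤)
    (h : ∀ x, majorant ψ a x ≤ M) (r : ι × ℤ × (Fin d → ℤ)) :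
    waveletCoeff ψ (synthesis ψ a) r = a r := by
  classical
  have hfin : ∫⁻ x, majorant ψ a x * ‖(starRingEnd ℂ) (wavelet ψ r x)‖ₑ ≠ ⊤ := by
    have hle : ∫⁻ x, majorant ψ a x * ‖(starRingEnd ℂ) (wavelet ψ r x)‖ₑ ≤
        ∫⁻ x, M * ‖wavelet ψ r x‖ₑ := by
      refine lintegral_mono fun x => ?_
      rw [← ofReal_norm ((starRingEnd ℂ) _), RCLike.norm_conj, ofReal_norm]
      gcongr
      exact h x
    refine ne_top_of_le_ne_top ?_ hle
    rw [lintegral_const_mul _ (continuous_wavelet ψ r).measurable.enorm, (lintegral_wavelet ψ r).2]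
    finiteness
  have hv : (cubeVol d r.2.1 : ℂ) ≠ 0 := by exact_mod_cast (cubeVol_pos d _).ne'
  rw [waveletCoeff, coeff]
  change ((cubeVol d r.2.1)⁻¹ : ℝ) *
    ∫ x, synthesis ψ a x * (starRingEnd ℂ) (wavelet ψ r x) = a r
  have hG : Continuous fun x => (starRingEnd ℂ) (wavelet ψ r x) :=
    Complex.continuous_conj.comp (continuous_wavelet ψ r)
  rw [integral_synthesis_mul hG.aestronglyMeasurable hfin]
  simp_rw [hψ.integral_wavelet_mul_conj]
  rw [tsum_eq_single r fun p hp => by simp [hp]]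
  simp only [if_true, Complex.ofReal_inv]
  field_simp

end Synthesis

/-! ### Wavelet expansion of test functions, and uniqueness -/

section Expansion

variable {d : ℕ} {ι : Type}

theorem summable_inv_two_pow_natAbs : Summable fun k : ℤ => (2 : ℝ)⁻¹ ^ k.natAbs := by
  have h : Summable fun n : ℕ => (2 : ℝ)⁻¹ ^ n :=
    summable_geometric_of_lt_one (by norm_num) (by norm_num)
  refine Summable.of_nat_of_neg (by simpa using h) (by simpa using h)

theorem tsum_inv_two_pow_natAbs_ne_top :
    ∑' k : ℤ, ENNReal.ofReal ((2 : ℝ)⁻¹ ^ k.natAbs) ≠ ⊤ := by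
  rw [← ENNReal.ofReal_tsum_of_nonneg (fun k => by positivity) summable_inv_two_pow_natAbs]
  exact ENNReal.ofReal_ne_top

theorem min_one_cubeVol (d : ℕ) (k : ℤ) : min 1 (cubeVol d k) = min 1 ((2 : ℝ) ^ k) ^ d := by
  have hp : (0 : ℝ) < (2 : ℝ) ^ k := by positivity
  rcases le_total ((2 : ℝ) ^ k) 1 with h | h
  · rw [min_eq_right h, cubeVol, min_eq_right (pow_le_one₀ hp.le h)]
  · rw [min_eq_left h, cubeVol, min_eq_left (one_le_pow₀ h), one_pow]

/-- The wavelet series of a mean-zero Schwartz function converges absolutely both in `L_1` and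
uniformly. The cancellation of `θ` and of the wavelets makes both the coarse and the fine scales
summable. -/
theorem IsWaveletSystem.majorant_waveletCoeff_schwartz [Fintype ι] {R : ℝ} {ψ : ι → 𝓢(Rd d, ℂ)}
    (hψ : IsWaveletSystem R ψ) (θ : 𝓢(Rd d, ℂ)) (hθ : ∫ x, θ x = 0) :
    ∃ M : ℝ≥0∞, M ≠ ⊤ ∧ (∀ x, majorant ψ (waveletCoeff ψ θ) x ≤ M) ∧
      ∫⁻ x, majorant ψ (waveletCoeff ψ θ) x ≠ ⊤ := by
  choose C hC0 hC using fun e =>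
    exists_norm_integral_mul_dyadic_le θ (ψ e) hθ (hψ.integral_eq_zero e) (d + 1)
  set D : ℝ := ∑ e, C e with hD
  have hD0 : 0 ≤ D := Finset.sum_nonneg fun e _ => hC0 e
  have hCD : ∀ e, C e ≤ D := fun e =>
    Finset.single_le_sum (f := C) (fun e _ => hC0 e) (Finset.mem_univ e)
  have hpair : ∀ p : ι × ℤ × (Fin d → ℤ), cubeVol d p.2.1 * ‖waveletCoeff ψ θ p‖ ≤
      D * (2 : ℝ)⁻¹ ^ p.2.1.natAbs * (min 1 (cubeVol d p.2.1) *
        wt (d + 1) (min 1 ((2 : ℝ) ^ p.2.1) • latticePt p.2.2)) := by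
    intro p
    have hv := cubeVol_pos d p.2.1
    rw [waveletCoeff, coeff, norm_mul, Complex.norm_real, norm_inv, Real.norm_of_nonneg hv.le,
      mul_inv_cancel_left₀ hv.ne']
    refine (hC p.1 p.2.1 p.2.2).trans ?_
    have := hCD p.1
    have := wt_nonneg (d + 1) (min 1 ((2 : ℝ) ^ p.2.1) • latticePt p.2.2)
    have : 0 ≤ min 1 (cubeVol d p.2.1) := le_min zero_le_one hv.le
    gcongr
  obtain ⟨K, hKtop, hK⟩ := exists_majorant_le ψ
  obtain ⟨K', hK'0, hK'⟩ := exists_tsum_wt_le d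
  refine ⟨K * ∑' k : ℤ, ENNReal.ofReal D * ENNReal.ofReal ((2 : ℝ)⁻¹ ^ k.natAbs), ?_,
    hK _ _ fun p => ?_, ?_⟩
  · rw [ENNReal.tsum_mul_left]
    have := tsum_inv_two_pow_natAbs_ne_top
    finiteness
  · rw [← ENNReal.ofReal_mul hD0, ← ofReal_norm]
    refine ENNReal.ofReal_le_ofReal ?_
    have hv := cubeVol_pos d p.2.1
    have h1 := hpair p
    have h2 : D * (2 : ℝ)⁻¹ ^ p.2.1.natAbs * (min 1 (cubeVol d p.2.1) *
        wt (d + 1) (min 1 ((2 : ℝ) ^ p.2.1) • latticePt p.2.2)) ≤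
        D * (2 : ℝ)⁻¹ ^ p.2.1.natAbs * (cubeVol d p.2.1 * 1) := by
      have := wt_nonneg (d + 1) (min 1 ((2 : ℝ) ^ p.2.1) • latticePt p.2.2)
      gcongr
      · exact min_le_right _ _
      · exact wt_le_one _ _
    refine le_of_mul_le_mul_left ((h1.trans h2).trans_eq ?_) hv
    ring
  · set E : ℝ := ∑ e, ∫ x, ‖ψ e x‖ with hE
    have hE0 : 0 ≤ E := Finset.sum_nonneg fun e _ => integral_nonneg fun x => norm_nonneg _
    have hEe : ∀ e, ∫ x, ‖ψ e x‖ ≤ E := fun e =>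
      Finset.single_le_sum (f := fun e => ∫ x, ‖ψ e x‖)
        (fun e _ => integral_nonneg fun x => norm_nonneg _) (Finset.mem_univ e)
    have h1 : ∫⁻ x, majorant ψ (waveletCoeff ψ θ) x =
        ∑' p, ‖waveletCoeff ψ θ p‖ₑ * ENNReal.ofReal (cubeVol d p.2.1 * ∫ x, ‖ψ p.1 x‖) := by
      simp only [majorant]
      rw [lintegral_tsum fun p =>
        ((continuous_wavelet ψ p).measurable.enorm.const_mul _).aemeasurable]
      refine tsum_congr fun p => ?_
      rw [lintegral_const_mul _ (continuous_wavelet ψ p).measurable.enorm, (lintegral_wavelet ψ p).2]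
    rw [h1, tsum_index_eq]
    have h2 : ∀ k : ℤ, ∑' r : ι × (Fin d → ℤ), ‖waveletCoeff ψ θ (r.1, k, r.2)‖ₑ *
        ENNReal.ofReal (cubeVol d k * ∫ x, ‖ψ r.1 x‖) ≤
        ENNReal.ofReal ((2 : ℝ)⁻¹ ^ k.natAbs) *
          (ENNReal.ofReal (E * D) * (Fintype.card ι * ENNReal.ofReal K')) := by
      intro k
      set h : ℝ := min 1 ((2 : ℝ) ^ k) with hh
      have hh0 : 0 < h := lt_min one_pos (by positivity)
      have hh1 : h ≤ 1 := min_le_left _ _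
      calc _ ≤ ∑' r : ι × (Fin d → ℤ), ENNReal.ofReal ((2 : ℝ)⁻¹ ^ k.natAbs * (E * D) * h ^ d) *
            ENNReal.ofReal (wt (d + 1) (h • latticePt r.2)) := by
            refine ENNReal.tsum_le_tsum fun r => ?_
            have hv := cubeVol_pos d k
            rw [← ofReal_norm, ← ENNReal.ofReal_mul (norm_nonneg _),
              ← ENNReal.ofReal_mul (by positivity)]
            refine ENNReal.ofReal_le_ofReal ?_
            have h3 := hpair (r.1, k, r.2)
            simp only [min_one_cubeVol, ← hh] at h3
            have h4 := wt_nonneg (d + 1) (h • latticePt r.2)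
            calc _ = (cubeVol d k * ‖waveletCoeff ψ θ (r.1, k, r.2)‖) * ∫ x, ‖ψ r.1 x‖ := by ring
              _ ≤ (D * (2 : ℝ)⁻¹ ^ k.natAbs * (h ^ d * wt (d + 1) (h • latticePt r.2))) * E :=
                mul_le_mul h3 (hEe r.1) (integral_nonneg fun x => norm_nonneg _) (by positivity)
              _ = _ := by ring
        _ = ENNReal.ofReal ((2 : ℝ)⁻¹ ^ k.natAbs * (E * D) * h ^ d) *
            ∑' _e : ι, ∑' n : Fin d → ℤ, ENNReal.ofReal (wt (d + 1) (h • latticePt n)) := by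
            rw [ENNReal.tsum_mul_left, ENNReal.tsum_prod']
        _ ≤ ENNReal.ofReal ((2 : ℝ)⁻¹ ^ k.natAbs * (E * D) * h ^ d) *
            ∑' _e : ι, ENNReal.ofReal (K' * (h ^ d)⁻¹) := by
            gcongr
            have := hK' h hh0 hh1 0
            simpa only [zero_sub, wt_neg] using this
        _ = _ := by
            rw [tsum_fintype, Finset.sum_const, Finset.card_univ, nsmul_eq_mul]
            rw [mul_left_comm, ← ENNReal.ofReal_mul (by positivity)]
            have : (2 : ℝ)⁻¹ ^ k.natAbs * (E * D) * h ^ d * (K' * (h ^ d)⁻¹) =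
                (2 : ℝ)⁻¹ ^ k.natAbs * ((E * D) * K') := by field_simp
            rw [this, ENNReal.ofReal_mul (by positivity), ENNReal.ofReal_mul (by positivity)]
            ring
    refine ne_top_of_le_ne_top ?_ (ENNReal.tsum_le_tsum h2)
    rw [ENNReal.tsum_mul_right]
    have := tsum_inv_two_pow_natAbs_ne_top
    finiteness

/-- The series lies in `L_2` and has the coefficients of `θ`, so completeness applies. -/
theorem IsWaveletSystem.ae_eq_synthesis_schwartz [Fintype ι] {R : ℝ} {ψ : ι → 𝓢(Rd d, ℂ)}
    (hψ : IsWaveletSystem R ψ) (θ : 𝓢(Rd d, ℂ)) (hθ : ∫ x, θ x = 0) :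
    θ =ᵐ[volume] synthesis ψ (waveletCoeff ψ θ) := by
  obtain ⟨M, hM, hb, hi⟩ := hψ.majorant_waveletCoeff_schwartz θ hθ
  set a := waveletCoeff ψ θ with ha
  have hm : AEStronglyMeasurable (synthesis ψ a) volume :=
    aestronglyMeasurable_synthesis fun x => ne_top_of_le_ne_top hM (hb x)
  have hbd : ∀ x, ‖synthesis ψ a x‖ ≤ M.toReal := fun x => by
    rw [← toReal_enorm]
    exact ENNReal.toReal_mono hM ((enorm_synthesis_le ψ a x).trans (hb x))
  have hint : Integrable (synthesis ψ a) volume :=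
    ⟨hm, lt_of_le_of_lt (lintegral_mono (enorm_synthesis_le ψ a)) hi.lt_top⟩
  have h2 : MemLp (synthesis ψ a) 2 volume := by
    rw [memLp_two_iff_integrable_sq_norm hm]
    have := hint.norm.mul_bdd (c := M.toReal) hm.norm (Eventually.of_forall fun x => by
      rw [norm_norm]; exact hbd x)
    exact this.congr (Eventually.of_forall fun x => by simp only [sq])
  have hwb : ∀ r, ∃ C, ∀ x, ‖(starRingEnd ℂ) (wavelet ψ r x)‖ ≤ C := fun r => by
    obtain ⟨C, hC0, hC⟩ := exists_wavelet_le_wt ψ 0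
    exact ⟨C, fun x => by rw [RCLike.norm_conj]; exact (hC r x).trans (by simp [wt])⟩
  have hwm : ∀ r, Continuous fun x => (starRingEnd ℂ) (wavelet ψ r x) := fun r =>
    Complex.continuous_conj.comp (continuous_wavelet ψ r)
  have hz := hψ.complete (fun x => θ x - synthesis ψ a x) ((θ.memLp 2).sub h2) (fun e k n => by
    obtain ⟨C, hC⟩ := hwb (e, k, n)
    have e1 := hψ.waveletCoeff_synthesis hM hb (e, k, n)
    simp only [ha, waveletCoeff, coeff] at e1
    have hv : (((cubeVol d k)⁻¹ : ℝ) : ℂ) ≠ 0 := by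
      exact_mod_cast (inv_pos.2 (cubeVol_pos d k)).ne'
    have e2 := mul_left_cancel₀ hv e1
    simp_rw [sub_mul]
    rw [integral_sub, sub_eq_zero]
    · exact e2.symm
    · exact θ.integrable.mul_bdd (hwm (e, k, n)).aestronglyMeasurable (Eventually.of_forall hC)
    · exact hint.mul_bdd (hwm (e, k, n)).aestronglyMeasurable (Eventually.of_forall hC))
  filter_upwards [hz] with x hx
  exact sub_eq_zero.1 hx

/-- Up to a uniformly small error, the function is dominated by an integrable one. This holds for
`L_p`, `1 ≤ p < ∞`, and for `C_0`, and it excludes nonzero constants. -/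
def NegligibleAtInfinity (g : Rd d → ℂ) : Prop :=
  ∀ ε : ℝ≥0∞, ε ≠ 0 → ∃ w : Rd d → ℝ≥0∞, ∫⁻ x, w x ≠ ⊤ ∧ ∀ x, ‖g x‖ₑ ≤ ε + w x

theorem NegligibleAtInfinity.sub {f g : Rd d → ℂ} (hf : NegligibleAtInfinity f)
    (hg : NegligibleAtInfinity g) (hm : AEMeasurable (fun x => ‖g x‖ₑ) volume) :
    NegligibleAtInfinity fun x => f x - g x := by
  intro ε hε
  have hε2 : ε / 2 ≠ 0 := by simpa using hε
  obtain ⟨v, hv, hfv⟩ := hf (ε / 2) hε2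
  obtain ⟨w, hw, hgw⟩ := hg (ε / 2) hε2
  refine ⟨fun x => v x + (‖g x‖ₑ - ε / 2), ?_, fun x => ?_⟩
  · rw [lintegral_add_right' _ (hm.sub_const _)]
    refine ENNReal.add_ne_top.2 ⟨hv, ne_top_of_le_ne_top hw (lintegral_mono fun x => ?_)⟩
    exact tsub_le_iff_left.2 (hgw x)
  · calc ‖f x - g x‖ₑ ≤ ‖f x‖ₑ + ‖g x‖ₑ := enorm_sub_le
      _ ≤ (ε / 2 + v x) + (ε / 2 + (‖g x‖ₑ - ε / 2)) := by
        gcongr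
        · exact hfv x
        · exact le_add_tsub
      _ = (ε / 2 + ε / 2) + (v x + (‖g x‖ₑ - ε / 2)) := by ring
      _ = _ := by rw [ENNReal.add_halves]

theorem NegligibleAtInfinity.lintegral_mul_ne_top {g : Rd d → ℂ} (hg : NegligibleAtInfinity g)
    {H : Rd d → ℝ≥0∞} (hH : AEMeasurable H volume) (hi : ∫⁻ x, H x ≠ ⊤) {M : ℝ≥0∞} (hM : M ≠ ⊤)
    (hb : ∀ x, H x ≤ M) : ∫⁻ x, H x * ‖g x‖ₑ ≠ ⊤ := by
  obtain ⟨w, hw, hgw⟩ := hg 1 one_ne_zero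
  have : ∫⁻ x, H x * ‖g x‖ₑ ≤ ∫⁻ x, (H x + M * w x) := by
    refine lintegral_mono fun x => ?_
    calc H x * ‖g x‖ₑ ≤ H x * (1 + w x) := by gcongr; exact hgw x
      _ = H x + H x * w x := by ring
      _ ≤ _ := by gcongr; exact hb x
  refine ne_top_of_le_ne_top ?_ this
  rw [lintegral_add_left' hH, lintegral_const_mul' _ _ hM]
  finiteness

/-- A mean-zero test function annihilates every function all of whose wavelet coefficients
vanish. -/
theorem IsWaveletSystem.integral_mul_conj_eq_zero [Fintype ι] {R : ℝ} {ψ : ι → 𝓢(Rd d, ℂ)}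
    (hψ : IsWaveletSystem R ψ) {g : Rd d → ℂ} (hm : AEStronglyMeasurable g volume)
    (hg : NegligibleAtInfinity g) (h0 : ∀ p, waveletCoeff ψ g p = 0) (θ : 𝓢(Rd d, ℂ))
    (hθ : ∫ x, θ x = 0) : ∫ x, θ x * (starRingEnd ℂ) (g x) = 0 := by
  obtain ⟨M, hM, hb, hi⟩ := hψ.majorant_waveletCoeff_schwartz θ hθ
  have e1 : ∫ x, θ x * (starRingEnd ℂ) (g x) =
      ∫ x, synthesis ψ (waveletCoeff ψ θ) x * (starRingEnd ℂ) (g x) := by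
    refine integral_congr_ae ?_
    filter_upwards [hψ.ae_eq_synthesis_schwartz θ hθ] with x hx
    rw [← hx]
  have hgm : AEStronglyMeasurable (fun x => (starRingEnd ℂ) (g x)) volume :=
    Complex.continuous_conj.comp_aestronglyMeasurable hm
  have hfin := hg.lintegral_mul_ne_top (measurable_majorant ψ _).aemeasurable hi hM hb
  rw [e1, integral_synthesis_mul hgm]
  · refine (tsum_congr fun p => ?_).trans tsum_zero
    have h := h0 p
    rw [waveletCoeff, coeff] at h
    have hv : (((cubeVol d p.2.1)⁻¹ : ℝ) : ℂ) ≠ 0 := by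
      exact_mod_cast (inv_pos.2 (cubeVol_pos d _)).ne'
    have h1 := (mul_eq_zero.1 h).resolve_left hv
    have h2 : ∫ x, wavelet ψ p x * (starRingEnd ℂ) (g x) =
        (starRingEnd ℂ) (∫ x, g x * (starRingEnd ℂ) (wavelet ψ p x)) := by
      rw [← integral_conj]
      refine integral_congr_ae (Eventually.of_forall fun x => ?_)
      simp only [map_mul, Complex.conj_conj]
      ring
    rw [h2]
    change _ * (starRingEnd ℂ) (∫ x, g x * (starRingEnd ℂ) (dyadic (ψ p.1) p.2.1 p.2.2 x)) = 0
    rw [h1]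
    simp
  · convert hfin using 3 with x
    rw [← ofReal_norm ((starRingEnd ℂ) _), RCLike.norm_conj, ofReal_norm]

/-- Uniqueness: a function that is negligible at infinity and has vanishing wavelet coefficients
is zero. A test function is made mean-zero by subtracting a multiple of a wide bump, and the
integrals against wide bumps are small. -/
theorem IsWaveletSystem.ae_eq_zero_of_waveletCoeff [Fintype ι] (hd : 0 < d) {R : ℝ}
    {ψ : ι → 𝓢(Rd d, ℂ)}
    (hψ : IsWaveletSystem R ψ) {g : Rd d → ℂ} (hm : AEStronglyMeasurable g volume)
    (hg : NegligibleAtInfinity g) (h0 : ∀ p, waveletCoeff ψ g p = 0) : g =ᵐ[volume] 0 := by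
  have hbint : ∀ β : Rd d → ℝ, Continuous β → HasCompactSupport β →
      Integrable (fun x => (β x : ℂ) * (starRingEnd ℂ) (g x)) volume := by
    intro β hβ hc
    have hβi : Integrable β volume := hβ.integrable_of_hasCompactSupport hc
    obtain ⟨C, hC⟩ := hc.exists_bound_of_continuous hβ
    refine ⟨(Complex.continuous_ofReal.comp hβ).aestronglyMeasurable.mul
      (Complex.continuous_conj.comp_aestronglyMeasurable hm), ?_⟩
    have := hg.lintegral_mul_ne_top (H := fun x => ‖β x‖ₑ) hβ.aestronglyMeasurable.enorm hβi.2.ne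
      (M := ENNReal.ofReal C) ENNReal.ofReal_ne_top (fun x => by
        rw [← ofReal_norm]; exact ENNReal.ofReal_le_ofReal (hC x))
    refine lt_of_le_of_lt (le_of_eq ?_) this.lt_top
    refine lintegral_congr fun x => ?_
    rw [enorm_mul, ← ofReal_norm, ← ofReal_norm ((starRingEnd ℂ) _), RCLike.norm_conj,
      ofReal_norm (g x), Complex.norm_real, ofReal_norm]
  have hloc : LocallyIntegrable g volume := by
    rw [locallyIntegrable_iff]
    intro S hS
    obtain ⟨w, hw, hgw⟩ := hg 1 one_ne_zero
    refine ⟨hm.restrict, ?_⟩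
    calc ∫⁻ x in S, ‖g x‖ₑ ≤ ∫⁻ x in S, (1 + w x) := lintegral_mono fun x => hgw x
      _ = volume S + ∫⁻ x in S, w x := by rw [lintegral_add_left measurable_const]; simp
      _ ≤ volume S + ∫⁻ x, w x := by gcongr; exact Measure.restrict_le_self
      _ < ⊤ := ENNReal.add_lt_top.2 ⟨hS.measure_lt_top, hw.lt_top⟩
  have hnt : Nontrivial (Rd d) := by
    have : Nonempty (Fin d) := ⟨⟨0, hd⟩⟩
    infer_instance
  refine ae_eq_zero_of_integral_contDiff_smul_eq_zero hloc fun g₀ hg₀ hc₀ => ?_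
  set c : ℝ := ∫ x, g₀ x with hc
  set I : ℂ := ∫ x, (g₀ x : ℂ) * (starRingEnd ℂ) (g x) with hI
  -- Comparison with a wide bump.
  have hcmp : ∀ β : Rd d → ℝ, ContDiff ℝ ∞ β → HasCompactSupport β → ∫ x, β x = 1 →
      I = c * ∫ x, (β x : ℂ) * (starRingEnd ℂ) (g x) := by
    intro β hβ hcβ h1
    have hs : HasCompactSupport fun x => ((g₀ x - c * β x : ℝ) : ℂ) := by
      refine HasCompactSupport.comp_left (g := fun y : ℝ => (y : ℂ)) ?_ Complex.ofReal_zero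
      exact hc₀.sub (hcβ.mul_left (f := fun _ => c))
    have hcd : ContDiff ℝ ∞ fun x => ((g₀ x - c * β x : ℝ) : ℂ) :=
      Complex.ofRealCLM.contDiff.comp (hg₀.sub (contDiff_const.mul hβ))
    have hi0 : Integrable g₀ volume := hg₀.continuous.integrable_of_hasCompactSupport hc₀
    have hi1 : Integrable β volume := hβ.continuous.integrable_of_hasCompactSupport hcβ
    have h2 := hψ.integral_mul_conj_eq_zero hm hg h0 (hs.toSchwartzMap hcd) (by
      change ∫ x, ((g₀ x - c * β x : ℝ) : ℂ) = 0
      rw [integral_complex_ofReal, integral_sub hi0 (hi1.const_mul c), integral_const_mul, h1,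
        mul_one, ← hc, sub_self, Complex.ofReal_zero])
    have h3 : ∫ x, (((g₀ x : ℂ) * (starRingEnd ℂ) (g x)) -
        (c : ℂ) * ((β x : ℂ) * (starRingEnd ℂ) (g x))) = 0 := by
      rw [← h2]
      refine integral_congr_ae (Eventually.of_forall fun x => ?_)
      change _ = ((g₀ x - c * β x : ℝ) : ℂ) * (starRingEnd ℂ) (g x)
      push_cast
      ring
    rw [integral_sub (hbint g₀ hg₀.continuous hc₀) ((hbint β hβ.continuous hcβ).const_mul _),
      integral_const_mul] at h3
    exact sub_eq_zero.1 h3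
  have hsmall : ∀ ε : ℝ, 0 < ε → ‖I‖ ≤ |c| * (2 * ε) := by
    intro ε hε
    obtain ⟨w, hw, hgw⟩ := hg (ENNReal.ofReal ε) (by simpa using hε)
    set W : ℝ := (∫⁻ x, w x).toReal with hW
    -- A ball of volume at least `W / ε`.
    obtain ⟨t, ht0, ht⟩ : ∃ t : ℝ, 0 < t ∧ W ≤ ε * volume.real (Metric.closedBall (0 : Rd d) t) := by
      set v := volume.real (Metric.ball (0 : Rd d) 1) with hv
      have hv0 : 0 < v := ENNReal.toReal_pos (Metric.measure_ball_pos volume _ one_pos).ne'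
        measure_ball_lt_top.ne
      refine ⟨1 + W / (ε * v), by positivity, ?_⟩
      have e : volume.real (Metric.closedBall (0 : Rd d) (1 + W / (ε * v))) =
          (1 + W / (ε * v)) ^ d * v := by
        rw [Measure.real, Measure.addHaar_closedBall volume 0 (by positivity), ENNReal.toReal_mul,
          ENNReal.toReal_ofReal (by positivity)]
        simp [hv, Measure.real]
      rw [e]
      have h1 : 1 + W / (ε * v) ≤ (1 + W / (ε * v)) ^ d :=
        le_self_pow₀ (le_add_of_nonneg_right (by positivity)) hd.ne'
      calc W = ε * (W / (ε * v) * v) := by field_simp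
        _ ≤ ε * ((1 + W / (ε * v)) ^ d * v) := by
          gcongr
          linarith
    let b : ContDiffBump (0 : Rd d) := ⟨t, 2 * t, ht0, by linarith⟩
    have hbp := b.hasCompactSupport_normed (μ := volume)
    have hcd : ContDiff ℝ ∞ (b.normed volume) := b.contDiff_normed
    rw [hcmp _ hcd hbp b.integral_normed, norm_mul, Complex.norm_real, Real.norm_eq_abs]
    refine mul_le_mul_of_nonneg_left ?_ (abs_nonneg _)
    set V := volume.real (Metric.closedBall (0 : Rd d) t) with hV
    have hV0 : 0 < V := ENNReal.toReal_pos (Metric.measure_closedBall_pos volume _ ht0).ne'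
        measure_closedBall_lt_top.ne
    have hbV : ∀ x, b.normed volume x ≤ 1 / V := fun x =>
      b.normed_le_div_measure_closedBall_rIn volume x
    have hI1 : ∫⁻ x, ENNReal.ofReal (b.normed volume x) = 1 := by
      rw [← ofReal_integral_eq_lintegral_ofReal b.integrable_normed
        (Eventually.of_forall b.nonneg_normed), b.integral_normed, ENNReal.ofReal_one]
    have hle : ‖∫ x, (b.normed volume x : ℂ) * (starRingEnd ℂ) (g x)‖ₑ ≤ ENNReal.ofReal (2 * ε) := by
      calc _ ≤ ∫⁻ x, ‖(b.normed volume x : ℂ) * (starRingEnd ℂ) (g x)‖ₑ :=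
            enorm_integral_le_lintegral_enorm _
        _ ≤ ∫⁻ x, (ENNReal.ofReal ε * ENNReal.ofReal (b.normed volume x) +
              ENNReal.ofReal (1 / V) * w x) := by
            refine lintegral_mono fun x => ?_
            rw [enorm_mul, ← ofReal_norm, ← ofReal_norm ((starRingEnd ℂ) _), RCLike.norm_conj,
              ofReal_norm (g x), Complex.norm_real, Real.norm_of_nonneg (b.nonneg_normed x)]
            calc _ ≤ ENNReal.ofReal (b.normed volume x) * (ENNReal.ofReal ε + w x) := by
                  gcongr; exact hgw x
              _ = ENNReal.ofReal ε * ENNReal.ofReal (b.normed volume x) +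
                  ENNReal.ofReal (b.normed volume x) * w x := by ring
              _ ≤ _ := by
                  gcongr
                  exact hbV x
        _ = ENNReal.ofReal ε + ENNReal.ofReal (1 / V) * ∫⁻ x, w x := by
            rw [lintegral_add_left (b.continuous_normed.measurable.ennreal_ofReal.const_mul _),
              lintegral_const_mul' _ _ ENNReal.ofReal_ne_top, hI1, mul_one,
              lintegral_const_mul' _ _ ENNReal.ofReal_ne_top]
        _ ≤ ENNReal.ofReal ε + ENNReal.ofReal ε := by
            gcongr
            rw [← ENNReal.ofReal_toReal hw, ← hW, ← ENNReal.ofReal_mul (by positivity)]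
            refine ENNReal.ofReal_le_ofReal ?_
            rw [one_div, inv_mul_le_iff₀ hV0]
            linarith
        _ = _ := by rw [← ENNReal.ofReal_add hε.le hε.le, two_mul]
    rw [← ofReal_norm, ENNReal.ofReal_le_ofReal_iff (by positivity)] at hle
    exact hle
  have hI0 : I = 0 := by
    by_contra hne
    have hpos : 0 < ‖I‖ := norm_pos_iff.2 hne
    have h1 := hsmall (‖I‖ / (4 * (|c| + 1))) (by positivity)
    have h2 : |c| * (2 * (‖I‖ / (4 * (|c| + 1)))) = ‖I‖ * (|c| / (2 * (|c| + 1))) := by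
      field_simp
      ring
    have h3 : |c| / (2 * (|c| + 1)) < 1 := by
      rw [div_lt_one (by positivity)]
      linarith [abs_nonneg c]
    rw [h2] at h1
    nlinarith
  have h4 : ∫ x, g₀ x • g x = (starRingEnd ℂ) I := by
    rw [hI, ← integral_conj]
    refine integral_congr_ae (Eventually.of_forall fun x => ?_)
    simp
  rw [h4, hI0, map_zero]

end Expansion

/-! ### Wavelet expansion of functions with summable coefficients -/

section BesovExpansion

variable {d : ℕ} {ι : Type}

theorem negligibleAtInfinity_of_memLp {f : Rd d → ℂ} {p : ℝ} (hp : 1 ≤ p)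
    (hf : MemLp f (ENNReal.ofReal p) volume) : NegligibleAtInfinity f := by
  intro ε hε
  rcases eq_or_ne ε ⊤ with rfl | hε'
  · exact ⟨0, by simp, fun x => by simp⟩
  have hfin := lintegral_rpow_enorm_lt_top_of_eLpNorm_lt_top
    (by simpa using zero_lt_one.trans_le hp) ENNReal.ofReal_ne_top hf.2
  rw [ENNReal.toReal_ofReal (by linarith)] at hfin
  have h0 : ε ^ (p - 1) ≠ 0 := (ENNReal.rpow_pos hε.bot_lt hε').ne'
  have htop : ε ^ (p - 1) ≠ ⊤ := ENNReal.rpow_ne_top_of_nonneg (by linarith) hε'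
  refine ⟨fun x => (ε ^ (p - 1))⁻¹ * ‖f x‖ₑ ^ p, ?_, fun x => ?_⟩
  · rw [lintegral_const_mul' _ _ (ENNReal.inv_ne_top.2 h0)]
    exact ENNReal.mul_ne_top (ENNReal.inv_ne_top.2 h0) hfin.ne
  · rcases le_total ‖f x‖ₑ ε with h | h
    · exact h.trans le_self_add
    · refine le_trans ?_ le_add_self
      have h1 : ‖f x‖ₑ ^ p = ‖f x‖ₑ ^ (p - 1) * ‖f x‖ₑ := by
        conv_lhs => rw [show p = (p - 1) + 1 by ring]
        rw [ENNReal.rpow_add_of_nonneg _ _ (by linarith) zero_le_one, ENNReal.rpow_one]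
      have h2 : ε ^ (p - 1) ≤ ‖f x‖ₑ ^ (p - 1) := ENNReal.rpow_le_rpow h (by linarith)
      calc ‖f x‖ₑ = (ε ^ (p - 1))⁻¹ * ε ^ (p - 1) * ‖f x‖ₑ := by
            rw [ENNReal.inv_mul_cancel h0 htop, one_mul]
        _ ≤ (ε ^ (p - 1))⁻¹ * ‖f x‖ₑ ^ (p - 1) * ‖f x‖ₑ := by gcongr
        _ = (ε ^ (p - 1))⁻¹ * ‖f x‖ₑ ^ p := by rw [h1, mul_assoc]

/-- A wavelet series is negligible at infinity if its level-wise suprema are summable and the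
coefficients on each level tend to zero: up to a uniformly small error it is a finite sum. -/
theorem negligibleAtInfinity_synthesis [Fintype ι] (ψ : ι → 𝓢(Rd d, ℂ))
    {a : ι × ℤ × (Fin d → ℤ) → ℂ} {c : ℤ → ℝ≥0∞} (hac : ∀ p, ‖a p‖ₑ ≤ c p.2.1)
    (hc : ∑' k, c k ≠ ⊤)
    (hfin : ∀ k : ℤ, ∀ δ : ℝ≥0∞, δ ≠ 0 →
      {r : ι × (Fin d → ℤ) | δ ≤ ‖a (r.1, k, r.2)‖ₑ}.Finite) :
    NegligibleAtInfinity (synthesis ψ a) := by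
  classical
  intro ε hε
  obtain ⟨K, hKtop, hK⟩ := exists_majorant_le ψ
  have hε2 : ε / 2 ≠ 0 := by simpa using hε
  obtain ⟨T, hT⟩ : ∃ T : Finset ℤ, K * ∑' k : {k // k ∉ T}, c k ≤ ε / 2 := by
    have h := ENNReal.Tendsto.const_mul (a := K) (ENNReal.tendsto_tsum_compl_atTop_zero hc)
      (Or.inr hKtop)
    rw [mul_zero] at h
    obtain ⟨T, hT⟩ := (h.eventually (gt_mem_nhds hε2.bot_lt)).exists
    exact ⟨T, hT.le⟩
  -- Coefficients below `δ` on the finitely many levels in `T` contribute at most `ε / 2`.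
  set δ : ℝ≥0∞ := (ε / 2) / (K * T.card + 1) with hδ
  have hden : K * T.card + 1 ≠ ⊤ := by finiteness
  have hδ0 : δ ≠ 0 := ENNReal.div_ne_zero.2 ⟨hε2, hden⟩
  have hδK : K * (T.card * δ) ≤ ε / 2 := by
    calc K * (T.card * δ) ≤ (K * T.card + 1) * δ := by
          rw [← mul_assoc]; gcongr; exact le_self_add
      _ ≤ ε / 2 := ENNReal.mul_div_le
  set J : Set (ι × ℤ × (Fin d → ℤ)) := {p | p.2.1 ∈ T ∧ δ ≤ ‖a p‖ₑ} with hJ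
  have hJfin : J.Finite := by
    refine (T.finite_toSet.biUnion (t := fun k => (fun r : ι × (Fin d → ℤ) => (r.1, k, r.2)) ''
      {r | δ ≤ ‖a (r.1, k, r.2)‖ₑ}) fun k _ => (hfin k δ hδ0).image _).subset ?_
    rintro ⟨e, k, n⟩ ⟨hk, hδp⟩
    exact Set.mem_biUnion hk ⟨(e, n), hδp, rfl⟩
  set a' : ι × ℤ × (Fin d → ℤ) → ℂ := fun p => if p ∈ J then 0 else a p with ha'
  have hmaj : ∀ x, majorant ψ a' x ≤ ε := by
    intro x
    set c' : ℤ → ℝ≥0∞ := fun k => (if k ∈ T then δ else 0) + (if k ∈ T then 0 else c k) with hc'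
    refine (hK a' c' (fun p => ?_) x).trans ?_
    · simp only [ha', hc']
      by_cases hp : p ∈ J
      · simp [hp]
      · by_cases hT' : p.2.1 ∈ T
        · simp only [hp, hT', if_true, if_false, add_zero]
          by_contra hlt
          exact hp ⟨hT', (not_le.1 hlt).le⟩
        · simp only [hp, hT', if_false, zero_add]
          exact hac p
    · have e1 : ∑' k, (if k ∈ T then δ else 0) = T.card * δ := by
        rw [tsum_eq_sum (s := T) (fun k hk => by simp [hk]),
          Finset.sum_congr rfl (fun k hk => if_pos hk), Finset.sum_const, nsmul_eq_mul]
      have e2 : ∑' k, (if k ∈ T then 0 else c k) = ∑' k : {k // k ∉ T}, c k := by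
        have h := tsum_subtype {k | k ∉ T} c
        rw [show ∑' k : {k // k ∉ T}, c k = ∑' x : ({k | k ∉ T} : Set ℤ), c x from rfl, h]
        refine tsum_congr fun k => ?_
        by_cases hk : k ∈ T <;> simp [hk]
      rw [hc', ENNReal.tsum_add, e1, e2, mul_add]
      exact (add_le_add hδK hT).trans_eq (ENNReal.add_halves ε)
  refine ⟨fun x => ∑ p ∈ hJfin.toFinset, ‖a p‖ₑ * ‖wavelet ψ p x‖ₑ, ?_, fun x => ?_⟩
  · rw [lintegral_finsetSum _ fun p _ => (continuous_wavelet ψ p).measurable.enorm.const_mul _]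
    refine (ENNReal.sum_lt_top.2 fun p _ => ?_).ne
    rw [lintegral_const_mul _ (continuous_wavelet ψ p).measurable.enorm, (lintegral_wavelet ψ p).2]
    finiteness
  · refine (enorm_synthesis_le ψ a x).trans ?_
    have h1 : majorant ψ a x = majorant ψ a' x +
        ∑' p, (if p ∈ hJfin.toFinset then ‖a p‖ₑ * ‖wavelet ψ p x‖ₑ else 0) := by
      rw [majorant, majorant, ← ENNReal.tsum_add]
      refine tsum_congr fun p => ?_
      by_cases hp : p ∈ J <;> simp [ha', hp]
    rw [h1, tsum_eq_sum (s := hJfin.toFinset) (fun p hp => by simp [hp]),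
      Finset.sum_congr rfl (fun p hp => if_pos hp)]
    gcongr
    exact hmaj x

/-- A function in `L_p`, `1 ≤ p < ∞`, whose wavelet coefficients have summable level-wise suprema
and tend to zero on each level is almost everywhere the sum of its wavelet series. -/
theorem IsWaveletSystem.ae_eq_synthesis [Fintype ι] (hd : 0 < d) {R : ℝ} {ψ : ι → 𝓢(Rd d, ℂ)}
    (hψ : IsWaveletSystem R ψ) {f : Rd d → ℂ} {p : ℝ} (hp : 1 ≤ p)
    (hf : MemLp f (ENNReal.ofReal p) volume) {c : ℤ → ℝ≥0∞}
    (hac : ∀ p, ‖waveletCoeff ψ f p‖ₑ ≤ c p.2.1) (hc : ∑' k, c k ≠ ⊤)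
    (hfin : ∀ k : ℤ, ∀ δ : ℝ≥0∞, δ ≠ 0 →
      {r : ι × (Fin d → ℤ) | δ ≤ ‖waveletCoeff ψ f (r.1, k, r.2)‖ₑ}.Finite) :
    f =ᵐ[volume] synthesis ψ (waveletCoeff ψ f) := by
  set a := waveletCoeff ψ f with ha
  obtain ⟨K, hKtop, hK⟩ := exists_majorant_le ψ
  have hM : K * ∑' k, c k ≠ ⊤ := ENNReal.mul_ne_top hKtop hc
  have hb : ∀ x, majorant ψ a x ≤ K * ∑' k, c k := hK a c hac
  have hsm : AEStronglyMeasurable (synthesis ψ a) volume :=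
    aestronglyMeasurable_synthesis fun x => ne_top_of_le_ne_top hM (hb x)
  have hsn := negligibleAtInfinity_synthesis ψ hac hc hfin
  have hfn := negligibleAtInfinity_of_memLp hp hf
  obtain ⟨C, hC0, hC⟩ := exists_wavelet_le_wt ψ 0
  have hint : ∀ g : Rd d → ℂ, AEStronglyMeasurable g volume → NegligibleAtInfinity g → ∀ r,
      Integrable (fun x => g x * (starRingEnd ℂ) (wavelet ψ r x)) volume := by
    intro g hg hgn r
    refine ⟨hg.mul (Complex.continuous_conj.comp (continuous_wavelet ψ r)).aestronglyMeasurable, ?_⟩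
    have h := hgn.lintegral_mul_ne_top (H := fun x => ‖wavelet ψ r x‖ₑ)
      (continuous_wavelet ψ r).measurable.enorm.aemeasurable (lintegral_wavelet ψ r).1.2.ne
      (M := ENNReal.ofReal C) ENNReal.ofReal_ne_top (fun x => by
        rw [← ofReal_norm]
        exact ENNReal.ofReal_le_ofReal ((hC r x).trans (by simp [wt])))
    refine lt_of_le_of_lt (lintegral_mono fun x => le_of_eq ?_) h.lt_top
    rw [enorm_mul, ← ofReal_norm ((starRingEnd ℂ) _), RCLike.norm_conj, ofReal_norm, mul_comm]
  have hz := hψ.ae_eq_zero_of_waveletCoeff hd (hf.1.sub hsm)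
    (hfn.sub hsn hsm.enorm) fun r => by
      have e1 := hψ.waveletCoeff_synthesis hM hb r
      rw [ha, waveletCoeff, waveletCoeff, coeff, coeff] at e1
      have hv : (((cubeVol d r.2.1)⁻¹ : ℝ) : ℂ) ≠ 0 := by
        exact_mod_cast (inv_pos.2 (cubeVol_pos d _)).ne'
      have e2 := mul_left_cancel₀ hv e1
      rw [waveletCoeff, coeff]
      refine mul_eq_zero_of_right _ ?_
      simp only [Pi.sub_apply, sub_mul]
      refine (integral_sub (hint f hf.1 hfn r) (hint _ hsm hsn r)).trans ?_
      exact sub_eq_zero.2 e2.symm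
  filter_upwards [hz] with x hx
  exact sub_eq_zero.1 hx

end BesovExpansion

/-! ### Distributing the budget over the wavelets -/

section Budget

/-- The number of terms spent on a coefficient of modulus `b` on a level of `ℓ_τ` norm `c`, if the
total budget is `N` and the quasi-seminorm is `B`. Rounding down keeps the total below `N`; if `b`
and `c` both vanish, the value is `0`, since `0 ^ τ = 0` for `τ > 0`. -/
noncomputable def budget (τ q N B c b : ℝ) : ℕ := ⌊b ^ τ * c ^ (-τ) * (N * c ^ q * B ^ (-q))⌋₊

/-- The error of a coefficient of modulus `b` approximated at rate `n^{-r}` with `n = budget`, where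
`τ = 1 / r` and `q = 1 / (1 + r)`: the bound depends only on the level. -/
theorem mul_rpow_budget_le {r τ q N B c b : ℝ} (hr : 0 < r) (hτ : τ * r = 1) (hq : q * (1 + r) = 1)
    (hN : 0 < N) (hB : 0 < B) (hc : 0 < c) (hb0 : 0 ≤ b) :
    b * (max 1 (budget τ q N B c b : ℝ)) ^ (-r) ≤ 2 ^ r * (N ^ (-r) * B ^ (1 - q) * c ^ q) := by
  have hτ0 : 0 < τ := by
    by_contra h
    push Not at h
    nlinarith
  set M : ℝ := N * c ^ q * B ^ (-q) with hM
  have hM0 : 0 < M := by positivity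
  have hD : c * M ^ (-r) = N ^ (-r) * B ^ (1 - q) * c ^ q := by
    have hqr : q * r = 1 - q := by linarith
    rw [hM, Real.mul_rpow (by positivity) (by positivity), Real.mul_rpow hN.le (by positivity),
      ← Real.rpow_mul hc.le, ← Real.rpow_mul hB.le]
    have e1 : -q * -r = 1 - q := by linarith
    have e2 : c * c ^ (q * -r) = c ^ q := by
      conv_lhs => rw [← Real.rpow_one c]
      rw [← Real.rpow_mul hc.le, ← Real.rpow_add hc]
      congr 1
      linarith
    rw [e1]
    linear_combination (N ^ (-r) * B ^ (1 - q)) * e2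
  rw [← hD]
  have h2r : (1 : ℝ) ≤ 2 ^ r := Real.one_le_rpow (by norm_num) hr.le
  have hcM : 0 < c * M ^ (-r) := by positivity
  set n := budget τ q N B c b with hn
  have hnM : n = ⌊b ^ τ * c ^ (-τ) * M⌋₊ := rfl
  -- In terms of `t = b^τ c^{-τ} M` the bound reads `b = c M^{-r} t^r`.
  set t : ℝ := b ^ τ * c ^ (-τ) * M with ht
  have ht0 : 0 ≤ t := by positivity
  have hbt : b = c * M ^ (-r) * t ^ r := by
    rw [ht, Real.mul_rpow (x := b ^ τ * c ^ (-τ)) (y := M) (by positivity) hM0.le,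
      Real.mul_rpow (x := b ^ τ) (y := c ^ (-τ)) (by positivity) (by positivity),
      ← Real.rpow_mul hb0, ← Real.rpow_mul hc.le, hτ, Real.rpow_one, neg_mul, hτ,
      Real.rpow_neg_one, Real.rpow_neg hM0.le]
    field_simp
  have hle : t ^ r * (max 1 (n : ℝ)) ^ (-r) ≤ 2 ^ r := by
    have hmax : 0 < max 1 (n : ℝ) := lt_max_of_lt_left one_pos
    rw [Real.rpow_neg hmax.le, ← div_eq_mul_inv, ← Real.div_rpow ht0 hmax.le]
    refine Real.rpow_le_rpow (by positivity) ?_ hr.le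
    rw [div_le_iff₀ hmax]
    have h1 : t < n + 1 := by rw [hnM]; exact Nat.lt_floor_add_one t
    linarith [le_max_left 1 (n : ℝ), le_max_right 1 (n : ℝ)]
  calc b * (max 1 (n : ℝ)) ^ (-r) = c * M ^ (-r) * (t ^ r * (max 1 (n : ℝ)) ^ (-r)) := by
        conv_lhs => rw [hbt]
        ring
    _ ≤ c * M ^ (-r) * 2 ^ r := by gcongr
    _ = _ := by ring

end Budget

/-! ### Approximation of all wavelets -/

section AllWavelets

variable {d : ℕ} {A : Set ℝ} {φ : ℝ → Rd d → ℂ}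

theorem Phi_zero {S : Rd d → ℂ} (hS : S ∈ Phi A φ 0) : S = 0 := by
  obtain ⟨a, α, y, -, rfl⟩ := hS
  funext x
  simp

/-- Approximation of all wavelets at once, with a constant independent of the cube. For
`n = 0` this is the decay of the wavelet itself. -/
theorem exists_wavelet_approx (hd : 0 < d) {R : ℝ} (hR : 0 < R) (hφ : IsAdmissible R A φ)
    (hA : A.Nonempty) {ι : Type} [Fintype ι] {ψ : ι → 𝓢(Rd d, ℂ)} (hψ : IsWaveletSystem R ψ)
    {r : ℝ} (hr : 0 ≤ r) (b : ℕ) :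
    ∃ C : ℝ, 0 ≤ C ∧ ∀ (p : ι × ℤ × (Fin d → ℤ)) (n : ℕ), ∃ S ∈ Phi A φ n, ∀ x,
      ‖wavelet ψ p x - S x‖ ≤ C * (max 1 (n : ℝ)) ^ (-r) *
        wt b (((2 : ℝ) ^ p.2.1)⁻¹ • x - latticePt p.2.2) := by
  choose C hC0 hC using fun e => exists_Phi_approx hd hR hφ hr b (ψ e) (hψ.bandlimited e)
  obtain ⟨C', hC'0, hC'⟩ := exists_wavelet_le_wt ψ b
  refine ⟨∑ e, C e + C', add_nonneg (Finset.sum_nonneg fun e _ => hC0 e) hC'0, fun p n => ?_⟩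
  have hCe : C p.1 ≤ ∑ e, C e :=
    Finset.single_le_sum (f := C) (fun e _ => hC0 e) (Finset.mem_univ _)
  rcases Nat.eq_zero_or_pos n with rfl | hn
  · refine ⟨_, zero_mem_Phi hA 0, fun x => ?_⟩
    have h1 := wt_nonneg b (((2 : ℝ) ^ p.2.1)⁻¹ • x - latticePt p.2.2)
    rw [sub_zero, Nat.cast_zero, max_eq_left zero_le_one, Real.one_rpow, mul_one]
    refine (hC' p x).trans ?_
    gcongr
    linarith [hC0 p.1]
  · obtain ⟨S, hS, hSle⟩ := hC p.1 n hn
    refine ⟨dyadic S p.2.1 p.2.2, dyadic_mem_Phi hφ.a1 hS _ _, fun x => ?_⟩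
    rw [wavelet, dyadic_eq, dyadic_eq, max_eq_right (by exact_mod_cast hn)]
    refine (hSle _).trans ?_
    have h1 := wt_nonneg b (((2 : ℝ) ^ p.2.1)⁻¹ • x - latticePt p.2.2)
    gcongr
    linarith

end AllWavelets

/-! ### Nonlinear approximation of wavelet series -/

section NonlinearApproximation

variable {d : ℕ} {ι : Type}

/-- The `ℓ_τ` quasi-norm of the coefficients on the level `k`. -/
noncomputable def levelNorm (τ : ℝ) (a : ι × ℤ × (Fin d → ℤ) → ℂ) (k : ℤ) : ℝ≥0∞ :=
  (∑' r : ι × (Fin d → ℤ), ‖a (r.1, k, r.2)‖ₑ ^ τ) ^ (1 / τ)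

theorem levelNorm_rpow {τ : ℝ} (hτ : 0 < τ) (a : ι × ℤ × (Fin d → ℤ) → ℂ) (k : ℤ) :
    levelNorm τ a k ^ τ = ∑' r : ι × (Fin d → ℤ), ‖a (r.1, k, r.2)‖ₑ ^ τ := by
  rw [levelNorm, ← ENNReal.rpow_mul, one_div_mul_cancel hτ.ne', ENNReal.rpow_one]

theorem enorm_le_levelNorm {τ : ℝ} (hτ : 0 < τ) (a : ι × ℤ × (Fin d → ℤ) → ℂ)
    (p : ι × ℤ × (Fin d → ℤ)) : ‖a p‖ₑ ≤ levelNorm τ a p.2.1 := by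
  rw [← ENNReal.rpow_le_rpow_iff hτ, levelNorm_rpow hτ]
  exact ENNReal.le_tsum (f := fun r : ι × (Fin d → ℤ) => ‖a (r.1, p.2.1, r.2)‖ₑ ^ τ) (p.1, p.2.2)

theorem finite_le_enorm_of_levelNorm_ne_top {τ : ℝ} (hτ : 0 < τ) {a : ι × ℤ × (Fin d → ℤ) → ℂ}
    {k : ℤ} (h : levelNorm τ a k ≠ ⊤) {δ : ℝ≥0∞} (hδ : δ ≠ 0) :
    {r : ι × (Fin d → ℤ) | δ ≤ ‖a (r.1, k, r.2)‖ₑ}.Finite := by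
  have h1 : ∑' r : ι × (Fin d → ℤ), ‖a (r.1, k, r.2)‖ₑ ^ τ ≠ ⊤ := by
    rw [← levelNorm_rpow hτ]
    exact ENNReal.rpow_ne_top_of_nonneg hτ.le h
  refine (ENNReal.finite_const_le_of_tsum_ne_top h1
    (ε := δ ^ τ) (by simp [ENNReal.rpow_eq_zero_iff, hδ, hτ, not_lt.2 hτ.le])).subset
    fun r hr => ?_
  exact ENNReal.rpow_le_rpow hr hτ.le

/-- The inclusion `ℓ_q ⊆ ℓ_1` for `q ≤ 1`. -/
theorem tsum_ne_top_of_tsum_rpow_ne_top {κ : Type*} {c : κ → ℝ≥0∞} {q : ℝ} (hq : 0 < q)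
    (hq1 : q ≤ 1) (h : ∑' k, c k ^ q ≠ ⊤) : ∑' k, c k ≠ ⊤ := by
  set S := ∑' k, c k ^ q with hS
  have h1q : 1 ≤ 1 / q := by rwa [le_div_iff₀ hq, one_mul]
  refine ne_top_of_le_ne_top (b := S * S ^ (1 / q - 1))
    (ENNReal.mul_ne_top h (ENNReal.rpow_ne_top_of_nonneg (by linarith) h)) ?_
  rw [hS, ← ENNReal.tsum_mul_right, ← hS]
  refine ENNReal.tsum_le_tsum fun k => ?_
  calc c k = c k ^ q * (c k ^ q) ^ (1 / q - 1) := by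
        rw [← ENNReal.rpow_mul, ← ENNReal.rpow_add_of_nonneg _ _ hq.le
          (mul_nonneg hq.le (by linarith)), show q + q * (1 / q - 1) = 1 by field_simp; ring,
          ENNReal.rpow_one]
    _ ≤ c k ^ q * S ^ (1 / q - 1) := by
        refine mul_le_mul_right (ENNReal.rpow_le_rpow ?_ (by linarith)) _
        exact ENNReal.le_tsum (f := fun k => c k ^ q) k

theorem ofReal_toReal_rpow {x : ℝ≥0∞} (hx : x ≠ ⊤) {y : ℝ} (hy : 0 ≤ y) :
    ENNReal.ofReal (x.toReal ^ y) = x ^ y := by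
  rw [← ENNReal.ofReal_rpow_of_nonneg ENNReal.toReal_nonneg hy, ENNReal.ofReal_toReal hx]

/-- The numbers of terms add up to at most `N`. -/
theorem tsum_budget_le {τ q : ℝ} (hτ : 0 < τ) (hq : 0 < q) {a : ι × ℤ × (Fin d → ℤ) → ℂ}
    {B : ℝ≥0∞} (hB0 : B ≠ 0) (hB : B ≠ ⊤) (hBq : ∑' k, levelNorm τ a k ^ q = B ^ q)
    (hfin : ∀ k, levelNorm τ a k ≠ ⊤) (N : ℕ) :
    ∑' p, (budget τ q N B.toReal (levelNorm τ a p.2.1).toReal ‖a p‖ : ℝ≥0∞) ≤ N := by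
  have hBpos : 0 < B.toReal := ENNReal.toReal_pos hB0 hB
  rw [tsum_index_eq]
  have key : ∀ k : ℤ, ∑' r : ι × (Fin d → ℤ),
      (budget τ q N B.toReal (levelNorm τ a k).toReal ‖a (r.1, k, r.2)‖ : ℝ≥0∞) ≤
        ENNReal.ofReal (N * B.toReal ^ (-q)) * levelNorm τ a k ^ q := by
    intro k
    set c := (levelNorm τ a k).toReal with hc
    have hc0 : 0 ≤ c := ENNReal.toReal_nonneg
    calc _ ≤ ∑' r : ι × (Fin d → ℤ), ENNReal.ofReal (c ^ (-τ) * (N * c ^ q * B.toReal ^ (-q))) *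
          ‖a (r.1, k, r.2)‖ₑ ^ τ := by
          refine ENNReal.tsum_le_tsum fun r => ?_
          rw [← ofReal_norm, ENNReal.ofReal_rpow_of_nonneg (norm_nonneg _) hτ.le,
            ← ENNReal.ofReal_mul (by positivity), ← ENNReal.ofReal_natCast]
          refine ENNReal.ofReal_le_ofReal ((Nat.floor_le (by positivity)).trans_eq (by ring))
      _ = ENNReal.ofReal (c ^ (-τ) * (N * c ^ q * B.toReal ^ (-q)) * c ^ τ) := by
          rw [ENNReal.tsum_mul_left, ← levelNorm_rpow hτ, ← ofReal_toReal_rpow (hfin k) hτ.le,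
            ← ENNReal.ofReal_mul (by positivity)]
      _ ≤ ENNReal.ofReal (N * B.toReal ^ (-q) * c ^ q) := by
          refine ENNReal.ofReal_le_ofReal ?_
          -- An inequality only, because `c` may vanish.
          have h1 : c ^ (-τ) * c ^ τ ≤ 1 := by
            rw [Real.rpow_neg hc0]
            exact inv_mul_le_one
          calc _ = c ^ (-τ) * c ^ τ * (N * B.toReal ^ (-q) * c ^ q) := by ring
            _ ≤ 1 * (N * B.toReal ^ (-q) * c ^ q) := by gcongr
            _ = _ := one_mul _
      _ = _ := by rw [ENNReal.ofReal_mul (by positivity), ofReal_toReal_rpow (hfin k) hq.le]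
  refine (ENNReal.tsum_le_tsum key).trans ?_
  rw [ENNReal.tsum_mul_left, hBq, ← ofReal_toReal_rpow hB hq.le,
    ← ENNReal.ofReal_mul (by positivity), mul_assoc, ← Real.rpow_add hBpos, neg_add_cancel,
    Real.rpow_zero, mul_one, ENNReal.ofReal_natCast]

/-- The `N`-term approximation of a wavelet series, uniform in `x`: each term is approximated with
its own share of the `N` terms. -/
theorem exists_Phi_approx_synthesis (hd : 0 < d) {R : ℝ} (hR : 0 < R) {A : Set ℝ}
    {φ : ℝ → Rd d → ℂ} (hφ : IsAdmissible R A φ) (hA : A.Nonempty) [Fintype ι]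
    {ψ : ι → 𝓢(Rd d, ℂ)} (hψ : IsWaveletSystem R ψ) {r τ q : ℝ} (hr : 0 < r) (hτ : τ * r = 1)
    (hq : q * (1 + r) = 1) :
    ∃ C : ℝ, 0 < C ∧ ∀ (a : ι × ℤ × (Fin d → ℤ) → ℂ) (B : ℝ≥0∞), B ≠ ⊤ →
      ∑' k, levelNorm τ a k ^ q = B ^ q → ∀ N : ℕ, 1 ≤ N → ∃ S ∈ Phi A φ N, ∀ x,
        ‖synthesis ψ a x - S x‖ₑ ≤ ENNReal.ofReal (C * (N : ℝ) ^ (-r)) * B := by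
  classical
  have hτ0 : 0 < τ := pos_of_mul_pos_left (hτ ▸ one_pos) hr.le
  have hq0 : 0 < q := pos_of_mul_pos_left (hq ▸ one_pos) (by linarith)
  have hq1 : q ≤ 1 := by nlinarith
  obtain ⟨C, hC0, hC⟩ := exists_wavelet_approx hd hR hφ hA hψ hr.le (d + 1)
  obtain ⟨K, hKtop, hK⟩ := exists_tsum_level_wt_le d ι
  obtain ⟨K', hK'top, hK'⟩ := exists_majorant_le ψ
  refine ⟨2 ^ r * C * K.toReal + 1, by positivity, fun a B hB hBq N hN => ?_⟩
  have hBqtop : B ^ q ≠ ⊤ := ENNReal.rpow_ne_top_of_nonneg hq0.le hB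
  have hsum : ∑' k, levelNorm τ a k ≠ ⊤ :=
    tsum_ne_top_of_tsum_rpow_ne_top hq0 hq1 (hBq ▸ hBqtop)
  have hfin : ∀ k, levelNorm τ a k ≠ ⊤ := ENNReal.ne_top_of_tsum_ne_top hsum
  have hac := enorm_le_levelNorm hτ0 a
  rcases eq_or_ne B 0 with rfl | hB0
  · have ha : ∀ p, a p = 0 := by
      intro p
      rw [ENNReal.zero_rpow_of_pos hq0, ENNReal.tsum_eq_zero] at hBq
      have h1 := (ENNReal.rpow_eq_zero_iff_of_pos hq0).1 (hBq p.2.1)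
      have h2 := hac p
      rw [h1] at h2
      simpa using h2
    refine ⟨_, zero_mem_Phi hA N, fun x => ?_⟩
    simp [synthesis, ha]
  have hBpos : 0 < B.toReal := ENNReal.toReal_pos hB0 hB
  have hNpos : (0 : ℝ) < N := by exact_mod_cast hN
  set c : ℤ → ℝ := fun k => (levelNorm τ a k).toReal with hc
  set n : ι × ℤ × (Fin d → ℤ) → ℕ := fun p => budget τ q N B.toReal (c p.2.1) ‖a p‖ with hn
  have hnsum : ∑' p, (n p : ℝ≥0∞) ≤ N := tsum_budget_le hτ0 hq0 hB0 hB hBq hfin N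
  have hJ : {p | n p ≠ 0}.Finite := by
    refine (ENNReal.finite_const_le_of_tsum_ne_top (ne_top_of_le_ne_top (by simp) hnsum)
      one_ne_zero).subset fun p hp => ?_
    have : 1 ≤ n p := Nat.one_le_iff_ne_zero.2 hp
    simpa using this
  choose S hS hSle using fun p => hC p (n p)
  have hS0 : ∀ p, p ∉ hJ.toFinset → S p = 0 := fun p hp => by
    have h0 : n p = 0 := by simpa using hp
    exact Phi_zero (h0 ▸ hS p)
  refine ⟨fun x => ∑ p ∈ hJ.toFinset, a p * S p x, ?_, fun x => ?_⟩
  · have h1 := sum_mem_Phi hA hJ.toFinset n (fun p x => a p * S p x)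
      fun p _ => const_mul_mem_Phi (hS p) (a p)
    refine Phi_mono hA ?_ h1
    have h2 := (ENNReal.sum_le_tsum hJ.toFinset).trans hnsum
    exact_mod_cast h2
  · have hs1 : Summable fun p => a p * wavelet ψ p x :=
      summable_synthesis (ne_top_of_le_ne_top (ENNReal.mul_ne_top hK'top hsum) (hK' a _ hac x))
    have hz : ∀ p ∉ hJ.toFinset, a p * S p x = 0 := fun p hp => by simp [hS0 p hp]
    have hs2 : Summable fun p => a p * S p x := summable_of_ne_finset_zero hz
    beta_reduce
    rw [synthesis, ← tsum_eq_sum (L := SummationFilter.unconditional _) hz, ← hs1.tsum_sub hs2]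
    refine enorm_tsum_le_tsum_enorm.trans ?_
    set M : ℝ := 2 ^ r * (N : ℝ) ^ (-r) * B.toReal ^ (1 - q) * C with hM
    have hM0 : 0 ≤ M := by positivity
    clear_value M
    have hterm : ∀ p : ι × ℤ × (Fin d → ℤ), ‖a p * wavelet ψ p x - a p * S p x‖ₑ ≤
        ENNReal.ofReal (M * c p.2.1 ^ q) *
          ENNReal.ofReal (wt (d + 1) (((2 : ℝ) ^ p.2.1)⁻¹ • x - latticePt p.2.2)) := by
      intro p
      set w := wt (d + 1) (((2 : ℝ) ^ p.2.1)⁻¹ • x - latticePt p.2.2) with hw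
      have hw0 : 0 ≤ w := wt_nonneg _ _
      rw [← mul_sub, ← ofReal_norm, ← ENNReal.ofReal_mul (by positivity), norm_mul]
      refine ENNReal.ofReal_le_ofReal ?_
      have hle : ‖a p‖ ≤ c p.2.1 := by
        have := ENNReal.toReal_mono (hfin _) (hac p)
        simpa using this
      rcases (ENNReal.toReal_nonneg : 0 ≤ (levelNorm τ a p.2.1).toReal).eq_or_lt with h0 | h0
      · have : ‖a p‖ = 0 := le_antisymm (hle.trans h0.ge) (norm_nonneg _)
        rw [this, zero_mul]
        positivity
      · have hbud := mul_rpow_budget_le hr hτ hq hNpos hBpos h0 (norm_nonneg (a p))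
        calc ‖a p‖ * ‖wavelet ψ p x - S p x‖
            ≤ ‖a p‖ * (C * (max 1 (n p : ℝ)) ^ (-r) * w) := by gcongr; exact hSle p x
          _ = ‖a p‖ * (max 1 (n p : ℝ)) ^ (-r) * (C * w) := by ring
          _ ≤ 2 ^ r * ((N : ℝ) ^ (-r) * B.toReal ^ (1 - q) * c p.2.1 ^ q) * (C * w) := by
              gcongr
          _ = _ := by rw [hM]; ring
    calc _ ≤ ∑' p : ι × ℤ × (Fin d → ℤ), ENNReal.ofReal (M * c p.2.1 ^ q) *
          ENNReal.ofReal (wt (d + 1) (((2 : ℝ) ^ p.2.1)⁻¹ • x - latticePt p.2.2)) :=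
          ENNReal.tsum_le_tsum hterm
      _ ≤ ∑' k : ℤ, ENNReal.ofReal M * levelNorm τ a k ^ q * K := by
          rw [tsum_index_eq]
          refine ENNReal.tsum_le_tsum fun k => ?_
          dsimp only
          rw [ENNReal.tsum_mul_left, ENNReal.ofReal_mul hM0, ofReal_toReal_rpow (hfin k) hq0.le]
          gcongr
          exact hK k x
      _ = ENNReal.ofReal (M * B.toReal ^ q * K.toReal) := by
          rw [ENNReal.tsum_mul_right, ENNReal.tsum_mul_left, hBq,
            ENNReal.ofReal_mul (by positivity), ENNReal.ofReal_mul hM0,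
            ofReal_toReal_rpow hB hq0.le, ENNReal.ofReal_toReal hKtop]
      _ ≤ ENNReal.ofReal ((2 ^ r * C * K.toReal + 1) * (N : ℝ) ^ (-r) * B.toReal) := by
          refine ENNReal.ofReal_le_ofReal ?_
          have hBB : B.toReal ^ (1 - q) * B.toReal ^ q = B.toReal := by
            rw [← Real.rpow_add hBpos, sub_add_cancel, Real.rpow_one]
          calc M * B.toReal ^ q * K.toReal
              = 2 ^ r * C * K.toReal * (N : ℝ) ^ (-r) *
                  (B.toReal ^ (1 - q) * B.toReal ^ q) := by rw [hM]; ring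
            _ = 2 ^ r * C * K.toReal * (N : ℝ) ^ (-r) * B.toReal := by rw [hBB]
            _ ≤ _ := by gcongr; linarith
      _ = _ := by rw [ENNReal.ofReal_mul (by positivity), ENNReal.ofReal_toReal hB]

end NonlinearApproximation

end KernelApprox

theorem mainTheorem3 {d : ℕ} (hd : 0 < d)
    {R : ℝ} (hR : 0 < R)
    {A : Set ℝ} (hApos : A ⊆ Set.Ioi 0) (hAinf : A.Infinite)
    (φ : ℝ → Rd d → ℂ) (hφ : IsAdmissible R A φ)
    {ι : Type} [Fintype ι] (ψ : ι → 𝓢(Rd d, ℂ)) (hψ : IsWaveletSystem R ψ)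
    {s τ q : ℝ} (hs : 0 < s) (hτ : 1 / τ = s / d) (hq : 1 / q = 1 + s / d) :
    ∃ C : ℝ, 0 < C ∧ ∀ f ∈ BesovSpace ψ τ q, ∀ N : ℕ, 1 ≤ N →
      ∃ S ∈ Phi A φ N,
        eLpNorm (fun x => f x - S x) ∞ volume ≤
          ENNReal.ofReal (C * (N : ℝ) ^ (-(s / d))) * besovSeminorm ψ τ q f := by
  have hr : 0 < s / d := by positivity
  have hτr : τ * (s / d) = 1 := by
    rw [← hτ, mul_one_div_cancel]
    rintro rfl
    simp at hτ
    exact hr.ne hτ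
  have hqr : q * (1 + s / d) = 1 := by
    rw [← hq, mul_one_div_cancel]
    rintro rfl
    rw [div_zero] at hq
    linarith
  have hτ0 : 0 < τ := pos_of_mul_pos_left (hτr ▸ one_pos) hr.le
  have hq0 : 0 < q := pos_of_mul_pos_left (hqr ▸ one_pos) (by linarith)
  have hq1 : q ≤ 1 := by nlinarith
  obtain ⟨C, hC0, hC⟩ :=
    exists_Phi_approx_synthesis hd hR hφ hAinf.nonempty hψ hr hτr hqr
  refine ⟨C, hC0, fun f hf N hN => ?_⟩
  obtain ⟨-, hfL, hfB⟩ := hf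
  have hBq : ∑' k, levelNorm τ (waveletCoeff ψ f) k ^ q = besovSeminorm ψ τ q f ^ q := by
    rw [besovSeminorm, ← ENNReal.rpow_mul, one_div_mul_cancel hq0.ne', ENNReal.rpow_one]
    rfl
  have hsum : ∑' k, levelNorm τ (waveletCoeff ψ f) k ≠ ⊤ :=
    tsum_ne_top_of_tsum_rpow_ne_top hq0 hq1
      (hBq ▸ ENNReal.rpow_ne_top_of_nonneg hq0.le hfB.ne)
  have hae := hψ.ae_eq_synthesis hd (le_max_left 1 τ) hfL
    (enorm_le_levelNorm hτ0 (waveletCoeff ψ f)) hsum fun k δ hδ =>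
      finite_le_enorm_of_levelNorm_ne_top hτ0 (ENNReal.ne_top_of_tsum_ne_top hsum k) hδ
  obtain ⟨S, hS, hSle⟩ := hC _ _ hfB.ne hBq N hN
  refine ⟨S, hS, ?_⟩
  rw [eLpNorm_exponent_top]
  refine essSup_le_of_ae_le _ ?_
  filter_upwards [hae] with x hx
  simp only [hx]
  exact hSle x
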